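/- **Definitions.** Let $L=(l_1,\dots,l_n)$, $n\ge 3$, be a family of parallel line segments in the plane, without loss of generality vertical; a segment may be a single point. Suppose that some leftmost segment and some other, rightmost segment are single points ("fixed points"). A *placement* is a choice $P=(p_1,\dots,p_n)$ of points $p_i\in l_i$. $P$ is *optimal* for the MinMaxArea problem if the largest area of a (possibly degenerate) triangle $p_ip_jp_k$ with $i,j,k$ pairwise different is as small as possible among all placements; this smallest possible value is the *value* of MinMaxArea on $L$. The *top chain* is the top half of the convex hull of the lower endpoints of the segments, the *bottom chain* is the bottom half of the convex hull of the upper endpoints, and the *convex body region* $K(L)$ is the set of points that lie on or below the top chain and on or above the bottom chain. **Theorem.** 1. For every such $L$ there is an optimal placement $P$ whose convex hull is $K(L)$; every placement whose convex hull is $K(L)$ is optimal; and the value of MinMaxArea on $L$ exists and is equal to the largest area of a triangle with corners in $K(L)$. 2. MinMaxArea on such $L$ can be solved in $O(n\log n)$ time: there are a constant $C$ and a real RAM program (unit-cost arithmetic operations $+,-,\cdot,/$ and comparisons on reals, rational constants, indirectly addressed arrays, index arithmetic by $+$, truncated $-$ and halving, no rounding of reals) which, for all $n\ge 3$ and every such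 $L$, given $n$ and the coordinates of the segments in arbitrary order, halts after at most $C\,n\log n$ steps and outputs the value of MinMaxArea on $L$, an optimal placement $P$ whose convex hull is $K(L)$, and the indices $i,j,k$ of three different segments such that the triangle $p_ip_jp_k$ has area equal to that value (so it is a largest-area triangle of $P$). -/

import Mathlib

/-! ## Vertical segments, placements, triangles -/

/-- A vertical line segment in the plane, possibly a single point (`lo = hi`). -/
structure VSeg where
  x : ℝ
  lo : ℝ
  hi : ℝ
  lo_le_hi : lo ≤ hi

namespace VSeg

/-- The lower endpoint. -/
def lower (s : VSeg) : ℝ × ℝ := (s.x, s.lo)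

/-- The upper endpoint. -/
def upper (s : VSeg) : ℝ × ℝ := (s.x, s.hi)

/-- The points of the segment. -/
def points (s : VSeg) : Set (ℝ × ℝ) := {q | q.1 = s.x ∧ s.lo ≤ q.2 ∧ q.2 ≤ s.hi}

/-- The segment is a single fixed point. -/
def IsPoint (s : VSeg) : Prop := s.lo = s.hi

end VSeg

/-- The segment `L l` is a leftmost one, `L r` is a rightmost one, these are two different members
of the family, and both are fixed points. -/
def HasFixedExtremes {n : ℕ} (L : Fin n → VSeg) (l r : Fin n) : Prop :=
  l ≠ r ∧ (∀ i, (L l).x ≤ (L i).x) ∧ (∀ i, (L i).x ≤ (L r).x) ∧ (L l).IsPoint ∧ (L r).IsPoint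

/-- The (nonnegative) area of the triangle with corners `p`, `q`, `r`. -/
noncomputable def triangleArea (p q r : ℝ × ℝ) : ℝ :=
  |(q.1 - p.1) * (r.2 - p.2) - (r.1 - p.1) * (q.2 - p.2)| / 2

/-- A choice of one point on every segment. -/
def IsPlacement {n : ℕ} (L : Fin n → VSeg) (p : Fin n → ℝ × ℝ) : Prop :=
  ∀ i, p i ∈ (L i).points

/-- The areas of the triangles whose corners are three members, with different indices,
of the family `p`. -/
def cornerAreas {n : ℕ} (p : Fin n → ℝ × ℝ) : Set ℝ :=
  {A | ∃ i j k : Fin n, i ≠ j ∧ i ≠ k ∧ j ≠ k ∧ A = triangleArea (p i) (p j) (p k)}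

/-- The areas of the triangles with corners in the set `K`. -/
def inscribedAreas (K : Set (ℝ × ℝ)) : Set ℝ :=
  {A | ∃ p ∈ K, ∃ q ∈ K, ∃ r ∈ K, A = triangleArea p q r}

/-- `m` is the value of the MinMaxArea problem on `L`: the smallest possible area, over all
placements, of the largest-area triangle of the placement (the minimum being attained). -/
def IsMinMaxArea {n : ℕ} (L : Fin n → VSeg) (m : ℝ) : Prop :=
  IsLeast {A | ∃ p, IsPlacement L p ∧ IsGreatest (cornerAreas p) A} m

/-- `p` is an optimal placement for the MinMaxArea problem on `L`: its largest triangle has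
the smallest possible area. -/
def IsOptimalPlacement {n : ℕ} (L : Fin n → VSeg) (p : Fin n → ℝ × ℝ) : Prop :=
  IsPlacement L p ∧ ∃ m, IsMinMaxArea L m ∧ IsGreatest (cornerAreas p) m

/-! ## The convex body region -/

/-- The top chain: the top half of the convex hull of the lower endpoints. -/
def topChain {n : ℕ} (L : Fin n → VSeg) : Set (ℝ × ℝ) :=
  {q | q ∈ convexHull ℝ (Set.range fun i => (L i).lower) ∧
    ∀ y, (q.1, y) ∈ convexHull ℝ (Set.range fun i => (L i).lower) → y ≤ q.2}

/-- The bottom chain: the bottom half of the convex hull of the upper endpoints. -/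
def bottomChain {n : ℕ} (L : Fin n → VSeg) : Set (ℝ × ℝ) :=
  {q | q ∈ convexHull ℝ (Set.range fun i => (L i).upper) ∧
    ∀ y, (q.1, y) ∈ convexHull ℝ (Set.range fun i => (L i).upper) → q.2 ≤ y}

/-- The convex body region: the points on or below the top chain and on or above the bottom
chain. -/
def convexBody {n : ℕ} (L : Fin n → VSeg) : Set (ℝ × ℝ) :=
  {q | ∃ b t : ℝ, (q.1, b) ∈ bottomChain L ∧ (q.1, t) ∈ topChain L ∧ b ≤ q.2 ∧ q.2 ≤ t}

/-! ## The real RAM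

Structured programs over a memory of index (natural number) cells and real cells, with unit cost
for every elementary operation. Reals can only be added, subtracted, multiplied, divided and
compared: there is no rounding and no conversion from reals to indices. Indices can only be added,
subtracted, halved and compared. A program text names finitely many registers and arrays; array
cells are addressed indirectly through computed indices. -/

/-- Index expressions; `sub` is truncated subtraction and `half` rounds down. -/
inductive NExp where
  | const (k : ℕ)
  | reg (v : ℕ)
  | get (a : ℕ) (i : NExp)
  | add (e f : NExp)
  | sub (e f : NExp)
  | half (e : NExp)

/-- Real expressions, with rational constants; `get a i` reads cell `i` of the real array `a`. -/
inductive RExp where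
  | const (q : ℚ)
  | reg (v : ℕ)
  | get (a : ℕ) (i : NExp)
  | add (e f : RExp)
  | sub (e f : RExp)
  | mul (e f : RExp)
  | div (e f : RExp)

/-- Tests. -/
inductive BExp where
  | nlt (e f : NExp)
  | rlt (e f : RExp)
  | neg (b : BExp)
  | and (b c : BExp)

/-- Programs. -/
inductive Prog where
  | skip
  | setN (v : ℕ) (e : NExp)
  | setR (v : ℕ) (e : RExp)
  | putN (a : ℕ) (i : NExp) (e : NExp)
  | putR (a : ℕ) (i : NExp) (e : RExp)
  | seq (c d : Prog)
  | ite (b : BExp) (c d : Prog)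
  | loop (b : BExp) (c : Prog)

/-- Memory contents: index registers, real registers, index arrays, real arrays. -/
structure RamState where
  nreg : ℕ → ℕ
  rreg : ℕ → ℝ
  narr : ℕ → ℕ → ℕ
  rarr : ℕ → ℕ → ℝ

/-- Value of an index expression. -/
def NExp.eval (s : RamState) : NExp → ℕ
  | const k => k
  | reg v => s.nreg v
  | get a i => s.narr a (i.eval s)
  | add e f => e.eval s + f.eval s
  | sub e f => e.eval s - f.eval s
  | half e => e.eval s / 2

/-- Number of elementary operations in an index expression. -/
def NExp.cost : NExp → ℕ
  | const _ => 1
  | reg _ => 1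
  | get _ i => i.cost + 1
  | add e f => e.cost + f.cost + 1
  | sub e f => e.cost + f.cost + 1
  | half e => e.cost + 1

/-- Value of a real expression (a division by zero returns zero). -/
noncomputable def RExp.eval (s : RamState) : RExp → ℝ
  | const q => (q : ℝ)
  | reg v => s.rreg v
  | get a i => s.rarr a (i.eval s)
  | add e f => e.eval s + f.eval s
  | sub e f => e.eval s - f.eval s
  | mul e f => e.eval s * f.eval s
  | div e f => e.eval s / f.eval s

/-- Number of elementary operations in a real expression. -/
def RExp.cost : RExp → ℕ
  | const _ => 1
  | reg _ => 1
  | get _ i => i.cost + 1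
  | add e f => e.cost + f.cost + 1
  | sub e f => e.cost + f.cost + 1
  | mul e f => e.cost + f.cost + 1
  | div e f => e.cost + f.cost + 1

/-- Truth of a test. -/
def BExp.Holds (s : RamState) : BExp → Prop
  | nlt e f => e.eval s < f.eval s
  | rlt e f => e.eval s < f.eval s
  | neg b => ¬ b.Holds s
  | and b c => b.Holds s ∧ c.Holds s

/-- Number of elementary operations in a test. -/
def BExp.cost : BExp → ℕ
  | nlt e f => e.cost + f.cost + 1
  | rlt e f => e.cost + f.cost + 1
  | neg b => b.cost + 1
  | and b c => b.cost + c.cost + 1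

/-- `Runs c s t s'`: started in state `s`, the program `c` halts after exactly `t` steps
in state `s'`. -/
inductive Runs : Prog → RamState → ℕ → RamState → Prop
  | skip (s : RamState) : Runs Prog.skip s 1 s
  | setN (s : RamState) (v : ℕ) (e : NExp) :
      Runs (Prog.setN v e) s (e.cost + 1)
        { s with nreg := Function.update s.nreg v (e.eval s) }
  | setR (s : RamState) (v : ℕ) (e : RExp) :
      Runs (Prog.setR v e) s (e.cost + 1)
        { s with rreg := Function.update s.rreg v (e.eval s) }
  | putN (s : RamState) (a : ℕ) (i e : NExp) :
      Runs (Prog.putN a i e) s (i.cost + e.cost + 1)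
        { s with narr :=
            Function.update s.narr a (Function.update (s.narr a) (i.eval s) (e.eval s)) }
  | putR (s : RamState) (a : ℕ) (i : NExp) (e : RExp) :
      Runs (Prog.putR a i e) s (i.cost + e.cost + 1)
        { s with rarr :=
            Function.update s.rarr a (Function.update (s.rarr a) (i.eval s) (e.eval s)) }
  | seq {c d : Prog} {s s₁ s₂ : RamState} {t₁ t₂ : ℕ} :
      Runs c s t₁ s₁ → Runs d s₁ t₂ s₂ → Runs (Prog.seq c d) s (t₁ + t₂) s₂
  | ite_true {b : BExp} {c d : Prog} {s s₁ : RamState} {t : ℕ} :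
      b.Holds s → Runs c s t s₁ → Runs (Prog.ite b c d) s (b.cost + 1 + t) s₁
  | ite_false {b : BExp} {c d : Prog} {s s₁ : RamState} {t : ℕ} :
      ¬ b.Holds s → Runs d s t s₁ → Runs (Prog.ite b c d) s (b.cost + 1 + t) s₁
  | loop_true {b : BExp} {c : Prog} {s s₁ s₂ : RamState} {t₁ t₂ : ℕ} :
      b.Holds s → Runs c s t₁ s₁ → Runs (Prog.loop b c) s₁ t₂ s₂ →
      Runs (Prog.loop b c) s (b.cost + 1 + t₁ + t₂) s₂
  | loop_false {b : BExp} {c : Prog} {s : RamState} :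
      ¬ b.Holds s → Runs (Prog.loop b c) s (b.cost + 1) s

/-! ## Input and output conventions -/

/-- The input: `n` in index register `0`; the abscissae, the lower ordinates and the upper
ordinates of the segments, in the given (arbitrary) order, in cells `0, …, n - 1` of the real
arrays `0`, `1`, `2`. All other cells hold zero. -/
noncomputable def inputState {n : ℕ} (L : Fin n → VSeg) : RamState where
  nreg v := if v = 0 then n else 0
  rreg _ := 0
  narr _ _ := 0
  rarr a i :=
    if h : i < n then
      if a = 0 then (L ⟨i, h⟩).x
      else if a = 1 then (L ⟨i, h⟩).lo
      else if a = 2 then (L ⟨i, h⟩).hi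
      else 0
    else 0

/-- The placement that is read off from a final state: the coordinates of its points are
in the real arrays `3` and `4`. -/
def outputPlacement (n : ℕ) (s : RamState) : Fin n → ℝ × ℝ :=
  fun i => (s.rarr 3 i, s.rarr 4 i)

/-- The area that is read off from a final state: it is in real register `0`. -/
def outputArea (s : RamState) : ℝ := s.rreg 0

/-- The triangle that is read off from a final state is `(i, j, k)`: the indices of its three
corners are in the index registers `1`, `2`, `3`. -/
def OutputTriangle {n : ℕ} (s : RamState) (i j k : Fin n) : Prop :=
  s.nreg 1 = i ∧ s.nreg 2 = j ∧ s.nreg 3 = k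

/-- The final state `s` holds a solution of the MinMaxArea problem on `L`: an optimal placement,
whose convex hull is the convex body region, the value of the problem, and a largest-area triangle
of the placement (given by the indices of three different segments). -/
def HoldsSolution {n : ℕ} (L : Fin n → VSeg) (s : RamState) : Prop :=
  IsMinMaxArea L (outputArea s) ∧
  IsOptimalPlacement L (outputPlacement n s) ∧
  convexHull ℝ (Set.range (outputPlacement n s)) = convexBody L ∧
  ∃ i j k : Fin n, OutputTriangle s i j k ∧ i ≠ j ∧ i ≠ k ∧ j ≠ k ∧
    triangleArea (outputPlacement n s i) (outputPlacement n s j) (outputPlacement n s k)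
      = outputArea s

/-! Structure. The area of a triangle is a convex function of each corner, so the largest triangle
in a convex hull can be taken with generators as corners, and a larger hull has at least as large a
maximum. The hull of every placement contains the convex body region (`convexBody_subset`): the hull
of the lower endpoints lies below the placement's hull and the hull of the upper endpoints lies
above it, in the vertical sense. Hence a placement whose hull is exactly the region is optimal. One
such placement takes on every segment the point closest to the chord between two fixed extremes
(`convexHull_clampPoint`). The chord lies in both endpoint hulls, because its ends are at once lower
and upper endpoints. A chosen point off the chord is a lower endpoint above it or an upper endpoint
below it. So every chosen point lies below some point of the lower endpoints' hull and above some
point of the upper endpoints' hull.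

Algorithm. This clamped placement takes linear time. Its hull comes from merge sort and two monotone
chain scans, the second one on the negated points. It remains to find a largest triangle of a
strictly convex polygon `v 0, …, v (M - 1)`. For a fixed first corner `a`, two pointers find the
best second and third corners `b` and `c` in time linear in the ranges searched. The best `b` and
`c` can be chosen nondecreasing in `a` (`StrictPolygon.le_max`, `StrictPolygon.le_min`). The proof
is an exchange argument: moving one corner changes the area by a difference of heights over the line
of motion, and heights along a convex polygon are unimodal. The first corners are therefore treated
in levels of binary subdivision, each new one searching only between the results of its two
neighbours. On one level consecutive ranges share only their ends, so a level costs `O(M)`, and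
there are `O(log M)` levels.

Correctness and cost are proved together by weakest preconditions (`wp`). Loop invariants carry a
budget for the remaining cost, which also serves as potential in the amortized arguments. -/

/-! ### Areas of triangles -/

/-- Twice the signed area of the triangle `p q r`. -/
def orient (p q r : ℝ × ℝ) : ℝ :=
  (q.1 - p.1) * (r.2 - p.2) - (r.1 - p.1) * (q.2 - p.2)

theorem triangleArea_eq_orient (p q r : ℝ × ℝ) : triangleArea p q r = |orient p q r| / 2 := rfl

theorem triangleArea_nonneg (p q r : ℝ × ℝ) : 0 ≤ triangleArea p q r := by
  unfold triangleArea; positivity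

theorem triangleArea_rotate (p q r : ℝ × ℝ) : triangleArea p q r = triangleArea q r p := by
  unfold triangleArea
  congr 2
  ring

theorem triangleArea_swap (p q r : ℝ × ℝ) : triangleArea p q r = triangleArea p r q := by
  unfold triangleArea
  rw [← abs_neg]
  congr 2
  ring

/-- The signed area is affine in one corner, and the absolute value of an affine function is convex.
-/
theorem convexOn_triangleArea (q r : ℝ × ℝ) :
    ConvexOn ℝ Set.univ (fun p => triangleArea p q r) := by
  refine ⟨convex_univ, fun x _ y _ a b ha hb hab => ?_⟩
  simp only [triangleArea, smul_eq_mul]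
  have hb' : b = 1 - a := by linarith
  have h : ((q.1 - (a • x + b • y).1) * (r.2 - (a • x + b • y).2)
      - (r.1 - (a • x + b • y).1) * (q.2 - (a • x + b • y).2))
      = a * ((q.1 - x.1) * (r.2 - x.2) - (r.1 - x.1) * (q.2 - x.2))
      + b * ((q.1 - y.1) * (r.2 - y.2) - (r.1 - y.1) * (q.2 - y.2)) := by
    simp only [Prod.fst_add, Prod.snd_add, Prod.smul_fst, Prod.smul_snd, smul_eq_mul]
    subst hb'; ring
  rw [h]
  have := abs_add_le (a * ((q.1 - x.1) * (r.2 - x.2) - (r.1 - x.1) * (q.2 - x.2)))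
    (b * ((q.1 - y.1) * (r.2 - y.2) - (r.1 - y.1) * (q.2 - y.2)))
  rw [abs_mul, abs_mul, abs_of_nonneg ha, abs_of_nonneg hb] at this
  linarith

/-- A convex function on a convex hull is dominated by its values at the generators. -/
theorem exists_triangleArea_ge_left {S : Set (ℝ × ℝ)} {u : ℝ × ℝ} (q r : ℝ × ℝ)
    (hu : u ∈ convexHull ℝ S) : ∃ p ∈ S, triangleArea u q r ≤ triangleArea p q r :=
  ((convexOn_triangleArea q r).subset (Set.subset_univ _) (convex_convexHull ℝ S)
    ).exists_ge_of_mem_convexHull (subset_convexHull ℝ S) hu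

/-- The area of a triangle in a convex hull is at most that of a triangle of generators. -/
theorem exists_triangleArea_ge {S : Set (ℝ × ℝ)} {u v w : ℝ × ℝ}
    (hu : u ∈ convexHull ℝ S) (hv : v ∈ convexHull ℝ S) (hw : w ∈ convexHull ℝ S) :
    ∃ p ∈ S, ∃ q ∈ S, ∃ r ∈ S, triangleArea u v w ≤ triangleArea p q r := by
  -- The corners are moved to generators one at a time; the rotations below bring each to the first
  -- place.
  obtain ⟨p, hp, h1⟩ := exists_triangleArea_ge_left v w hu
  obtain ⟨q, hq, h2⟩ := exists_triangleArea_ge_left w p hv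
  obtain ⟨r, hr, h3⟩ := exists_triangleArea_ge_left p q hw
  refine ⟨p, hp, q, hq, r, hr, ?_⟩
  rw [triangleArea_rotate p v w] at h1
  rw [triangleArea_rotate q w p] at h2
  rw [triangleArea_rotate r p q] at h3
  linarith

theorem triangleArea_eq_zero_of_eq_left (p r : ℝ × ℝ) : triangleArea p p r = 0 := by
  simp [triangleArea]

theorem triangleArea_eq_zero_of_eq_right (p r : ℝ × ℝ) : triangleArea p r r = 0 := by
  simp [triangleArea]

theorem triangleArea_eq_zero_of_eq_outer (p r : ℝ × ℝ) : triangleArea p r p = 0 := by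
  simp [triangleArea]

/-- Three points that span a triangle of positive area have different indices. -/
theorem ne_of_triangleArea_pos {ι : Type*} {p : ι → ℝ × ℝ} {i j k : ι}
    (h : 0 < triangleArea (p i) (p j) (p k)) : i ≠ j ∧ i ≠ k ∧ j ≠ k := by
  refine ⟨?_, ?_, ?_⟩ <;> rintro rfl
  · simp [triangleArea_eq_zero_of_eq_left] at h
  · simp [triangleArea_eq_zero_of_eq_outer] at h
  · simp [triangleArea_eq_zero_of_eq_right] at h

/-! ### Optimal placements and the convex body region -/

section Placements

variable {n : ℕ} {L : Fin n → VSeg} {l r : Fin n} {p : Fin n → ℝ × ℝ}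

theorem exists_cornerAreas_ge (hn : 3 ≤ n) {A : ℝ}
    (hA : A ∈ inscribedAreas (convexHull ℝ (Set.range p))) : ∃ A' ∈ cornerAreas p, A ≤ A' := by
  obtain ⟨u, hu, v, hv, w, hw, rfl⟩ := hA
  obtain ⟨_, ⟨i, rfl⟩, _, ⟨j, rfl⟩, _, ⟨k, rfl⟩, h⟩ := exists_triangleArea_ge hu hv hw
  -- Positive area forces different indices; if the area is zero, any three different indices do,
  -- and they exist as `n` is at least 3.
  rcases (triangleArea_nonneg (p i) (p j) (p k)).eq_or_lt with h0 | h0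
  · refine ⟨_, ⟨⟨0, by omega⟩, ⟨1, by omega⟩, ⟨2, by omega⟩, by simp, by simp, by simp, rfl⟩, ?_⟩
    exact (h.trans h0.ge).trans (triangleArea_nonneg _ _ _)
  · obtain ⟨h1, h2, h3⟩ := ne_of_triangleArea_pos h0
    exact ⟨_, ⟨i, j, k, h1, h2, h3, rfl⟩, h⟩

theorem cornerAreas_subset {K : Set (ℝ × ℝ)} (h : Set.range p ⊆ K) :
    cornerAreas p ⊆ inscribedAreas K := by
  rintro _ ⟨i, j, k, -, -, -, rfl⟩
  exact ⟨_, h ⟨i, rfl⟩, _, h ⟨j, rfl⟩, _, h ⟨k, rfl⟩, rfl⟩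

/-- This replaces the combinatorial maximum by one that depends on the convex hull only, so that
placements can be compared by inclusion of hulls. -/
theorem isGreatest_cornerAreas_iff (hn : 3 ≤ n) {m : ℝ} :
    IsGreatest (cornerAreas p) m ↔
      IsGreatest (inscribedAreas (convexHull ℝ (Set.range p))) m := by
  have hsub : cornerAreas p ⊆ inscribedAreas (convexHull ℝ (Set.range p)) :=
    cornerAreas_subset (subset_convexHull ℝ _)
  constructor
  · rintro ⟨h1, h2⟩
    refine ⟨hsub h1, fun A hA => ?_⟩
    obtain ⟨A', hA', h⟩ := exists_cornerAreas_ge hn hA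
    exact h.trans (h2 hA')
  · rintro ⟨h1, h2⟩
    obtain ⟨A', hA', h⟩ := exists_cornerAreas_ge hn h1
    have : m = A' := le_antisymm h (h2 (hsub hA'))
    exact ⟨this ▸ hA', fun A hA => h2 (hsub hA)⟩

theorem exists_isGreatest_cornerAreas (hn : 3 ≤ n) (p : Fin n → ℝ × ℝ) :
    ∃ m, IsGreatest (cornerAreas p) m := by
  have hfin : (cornerAreas p).Finite := by
    refine (Set.finite_range
      (fun t : Fin n × Fin n × Fin n => triangleArea (p t.1) (p t.2.1) (p t.2.2))).subset ?_
    rintro _ ⟨i, j, k, -, -, -, rfl⟩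
    exact ⟨(i, j, k), rfl⟩
  have hne : (cornerAreas p).Nonempty :=
    ⟨_, ⟨0, by omega⟩, ⟨1, by omega⟩, ⟨2, by omega⟩, by simp, by simp, by simp, rfl⟩
  exact hfin.isCompact.exists_isGreatest hne

/-- Convexity of the downward shadow of `S` lets a relation "lies below some point of `S`" pass from
generators to their hull. -/
theorem convex_exists_ge {S : Set (ℝ × ℝ)} (hS : Convex ℝ S) :
    Convex ℝ {z : ℝ × ℝ | ∃ y, z.2 ≤ y ∧ (z.1, y) ∈ S} := by
  rintro z ⟨y, hy, hyS⟩ w ⟨y', hy', hyS'⟩ a b ha hb hab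
  refine ⟨a * y + b * y', ?_, ?_⟩
  · simp only [Prod.snd_add, Prod.smul_snd, smul_eq_mul]
    gcongr
  · simpa using hS hyS hyS' ha hb hab

theorem convex_exists_le {S : Set (ℝ × ℝ)} (hS : Convex ℝ S) :
    Convex ℝ {z : ℝ × ℝ | ∃ y, y ≤ z.2 ∧ (z.1, y) ∈ S} := by
  rintro z ⟨y, hy, hyS⟩ w ⟨y', hy', hyS'⟩ a b ha hb hab
  refine ⟨a * y + b * y', ?_, ?_⟩
  · simp only [Prod.snd_add, Prod.smul_snd, smul_eq_mul]
    gcongr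
  · simpa using hS hyS hyS' ha hb hab

theorem mem_of_vertical {S : Set (ℝ × ℝ)} (hS : Convex ℝ S) {x y a b : ℝ}
    (ha : (x, a) ∈ S) (hb : (x, b) ∈ S) (hay : a ≤ y) (hyb : y ≤ b) : (x, y) ∈ S := by
  have hc : Convex ℝ ((fun y : ℝ => (x, y)) ⁻¹' S) := by
    intro u hu v hv s t hs ht hst
    have := hS hu hv hs ht hst
    have hx : s * x + t * x = x := by rw [← add_mul, hst, one_mul]
    simpa [hx] using this
  exact hc.ordConnected.out ha hb ⟨hay, hyb⟩

/-- The convex body region is contained in the convex hull of every placement. -/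
theorem convexBody_subset (hp : IsPlacement L p) :
    convexBody L ⊆ convexHull ℝ (Set.range p) := by
  rintro ⟨x, y⟩ ⟨b, t, ⟨hb, -⟩, ⟨ht, -⟩, hby, hyt⟩
  have hH := convex_convexHull ℝ (Set.range p)
  -- Each lower endpoint lies below the placed point of its segment, so the whole hull of the lower
  -- endpoints lies in the downward shadow of the placement's hull.
  have h1 : convexHull ℝ (Set.range fun i => (L i).lower) ⊆ _ :=
    convexHull_min (by
      rintro _ ⟨i, rfl⟩
      obtain ⟨hx, hlo, -⟩ := hp i
      refine ⟨(p i).2, hlo, ?_⟩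
      have : ((L i).lower.1, (p i).2) = p i := Prod.ext hx.symm rfl
      rw [this]
      exact subset_convexHull ℝ _ ⟨i, rfl⟩) (convex_exists_ge hH)
  have h2 : convexHull ℝ (Set.range fun i => (L i).upper) ⊆ _ :=
    convexHull_min (by
      rintro _ ⟨i, rfl⟩
      obtain ⟨hx, -, hhi⟩ := hp i
      refine ⟨(p i).2, hhi, ?_⟩
      have : ((L i).upper.1, (p i).2) = p i := Prod.ext hx.symm rfl
      rw [this]
      exact subset_convexHull ℝ _ ⟨i, rfl⟩) (convex_exists_le hH)
  obtain ⟨t', htt', ht'⟩ := h1 ht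
  obtain ⟨b', hbb', hb'⟩ := h2 hb
  exact mem_of_vertical hH hb' ht' (hbb'.trans hby) (hyt.trans htt')

/-- The vertical fibre is compact. This turns a point of the hull of the lower endpoints into a
point of the top chain. -/
theorem exists_top {S : Set (ℝ × ℝ)} (hS : IsCompact S) {x y : ℝ} (hy : (x, y) ∈ S) :
    ∃ t, y ≤ t ∧ (x, t) ∈ S ∧ ∀ z, (x, z) ∈ S → z ≤ t := by
  have hc : IsCompact (S ∩ {q | q.1 = x}) :=
    hS.inter_right (isClosed_eq continuous_fst continuous_const)
  obtain ⟨q, ⟨hq, hqx⟩, hmax⟩ := hc.exists_isMaxOn ⟨(x, y), hy, rfl⟩ continuous_snd.continuousOn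
  have hqe : q = (x, q.2) := Prod.ext hqx rfl
  exact ⟨q.2, hmax ⟨hy, rfl⟩, hqe ▸ hq, fun z hz => hmax ⟨hz, rfl⟩⟩

theorem exists_bot {S : Set (ℝ × ℝ)} (hS : IsCompact S) {x y : ℝ} (hy : (x, y) ∈ S) :
    ∃ t, t ≤ y ∧ (x, t) ∈ S ∧ ∀ z, (x, z) ∈ S → t ≤ z := by
  have hc : IsCompact (S ∩ {q | q.1 = x}) :=
    hS.inter_right (isClosed_eq continuous_fst continuous_const)
  obtain ⟨q, ⟨hq, hqx⟩, hmin⟩ := hc.exists_isMinOn ⟨(x, y), hy, rfl⟩ continuous_snd.continuousOn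
  have hqe : q = (x, q.2) := Prod.ext hqx rfl
  exact ⟨q.2, hmin ⟨hy, rfl⟩, hqe ▸ hq, fun z hz => hmin ⟨hz, rfl⟩⟩

/-- The ordinate at `x` of the line through `a` and `b` (of the horizontal line through `a`, if
`a` and `b` lie on a vertical line). -/
noncomputable def chordAt (a b : ℝ × ℝ) (x : ℝ) : ℝ :=
  a.2 + (b.2 - a.2) * (x - a.1) / (b.1 - a.1)

theorem chordAt_mem {S : Set (ℝ × ℝ)} (hS : Convex ℝ S) {a b : ℝ × ℝ} (ha : a ∈ S) (hb : b ∈ S)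
    {x : ℝ} (hax : a.1 ≤ x) (hxb : x ≤ b.1) : (x, chordAt a b x) ∈ S := by
  rcases (hax.trans hxb).eq_or_lt with h | h
  · have hx : x = a.1 := le_antisymm (h ▸ hxb) hax
    subst hx
    simpa [chordAt] using ha
  · have hd : 0 < b.1 - a.1 := sub_pos.2 h
    have hmem := hS ha hb (a := (b.1 - x) / (b.1 - a.1)) (b := (x - a.1) / (b.1 - a.1))
      (div_nonneg (by linarith) hd.le) (div_nonneg (by linarith) hd.le) (by field_simp; ring)
    convert hmem using 1
    refine Prod.ext ?_ ?_
    · simp only [Prod.fst_add, Prod.smul_fst, smul_eq_mul]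
      field_simp; ring
    · simp only [chordAt, Prod.snd_add, Prod.smul_snd, smul_eq_mul]
      field_simp; ring

/-- The point of the segment `s` that is closest to the line through `a` and `b`. -/
noncomputable def clampPoint (a b : ℝ × ℝ) (s : VSeg) : ℝ × ℝ :=
  (s.x, max s.lo (min s.hi (chordAt a b s.x)))

theorem isPlacement_clampPoint (a b : ℝ × ℝ) :
    IsPlacement L (fun i => clampPoint a b (L i)) := fun i =>
  ⟨rfl, le_max_left _ _, max_le (L i).lo_le_hi (min_le_left _ _)⟩

/-- Clamping moves a point off the chord only upwards to a lower endpoint or downwards to an upper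
endpoint. So the witness above it in the lower endpoints' hull is either that endpoint or the chord
point, and likewise below it in the upper endpoints' hull. -/
theorem convexHull_clampPoint (hl : ∀ i, (L l).x ≤ (L i).x) (hr : ∀ i, (L i).x ≤ (L r).x)
    (hpl : (L l).IsPoint) (hpr : (L r).IsPoint) :
    convexHull ℝ (Set.range fun i => clampPoint (L l).lower (L r).lower (L i)) = convexBody L := by
  refine Set.Subset.antisymm ?_ (convexBody_subset (isPlacement_clampPoint _ _))
  have hlow := convex_convexHull ℝ (Set.range fun i => (L i).lower)
  have hupp := convex_convexHull ℝ (Set.range fun i => (L i).upper)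
  have hml : ∀ i, (L i).lower ∈ convexHull ℝ (Set.range fun i => (L i).lower) :=
    fun i => subset_convexHull ℝ _ ⟨i, rfl⟩
  have hmu : ∀ i, (L i).upper ∈ convexHull ℝ (Set.range fun i => (L i).upper) :=
    fun i => subset_convexHull ℝ _ ⟨i, rfl⟩
  -- Here the fixed extremes matter: the ends of the chord, hence the chord, belong to both endpoint
  -- hulls.
  have hll : (L l).upper = (L l).lower := Prod.ext rfl hpl.symm
  have hrr : (L r).upper = (L r).lower := Prod.ext rfl hpr.symm
  have h1 := convexHull_min (s := Set.range fun i => clampPoint (L l).lower (L r).lower (L i))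
    (by
      rintro _ ⟨i, rfl⟩
      rcases le_total (min (L i).hi (chordAt (L l).lower (L r).lower (L i).x)) (L i).lo with h | h
      · exact ⟨(L i).lo, by simp only [clampPoint, max_eq_left h, le_refl], hml i⟩
      · refine ⟨chordAt (L l).lower (L r).lower (L i).x, ?_,
          chordAt_mem hlow (hml l) (hml r) (hl i) (hr i)⟩
        simp only [clampPoint, max_eq_right h]
        exact min_le_right _ _) (convex_exists_ge hlow)
  have h2 := convexHull_min (s := Set.range fun i => clampPoint (L l).lower (L r).lower (L i))
    (by
      rintro _ ⟨i, rfl⟩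
      rcases le_total (L i).hi (chordAt (L l).lower (L r).lower (L i).x) with h | h
      · exact ⟨(L i).hi, by simp only [clampPoint, min_eq_left h, le_max_right], hmu i⟩
      · refine ⟨chordAt (L l).lower (L r).lower (L i).x, ?_,
          chordAt_mem hupp (hll ▸ hmu l) (hrr ▸ hmu r) (hl i) (hr i)⟩
        simp only [clampPoint, min_eq_right h]
        exact le_max_right _ _) (convex_exists_le hupp)
  rintro ⟨x, y⟩ hz
  obtain ⟨t', hyt, ht'⟩ := h1 hz
  obtain ⟨b', hby, hb'⟩ := h2 hz
  obtain ⟨t, htt, ht, htmax⟩ :=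
    exists_top ((Set.finite_range fun i => (L i).lower).isCompact_convexHull (𝕜 := ℝ)) ht'
  obtain ⟨b, hbb, hb, hbmin⟩ :=
    exists_bot ((Set.finite_range fun i => (L i).upper).isCompact_convexHull (𝕜 := ℝ)) hb'
  exact ⟨b, t, ⟨hb, hbmin⟩, ⟨ht, htmax⟩, hbb.trans hby, hyt.trans htt⟩

/-- The largest triangle of a placement that spans the convex body region is at most as large as
that of any other placement. -/
theorem isMinMaxArea_of_convexHull_eq (hn : 3 ≤ n) (hp : IsPlacement L p)
    (hK : convexHull ℝ (Set.range p) = convexBody L) {m : ℝ} (hm : IsGreatest (cornerAreas p) m) :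
    IsMinMaxArea L m := by
  refine ⟨⟨p, hp, hm⟩, ?_⟩
  rintro A ⟨p', hp', hA⟩
  rw [isGreatest_cornerAreas_iff hn] at hm hA
  obtain ⟨u, hu, v, hv, w, hw, h⟩ := hm.1
  rw [hK] at hu hv hw
  have hsub := convexBody_subset hp'
  exact hA.2 ⟨u, hsub hu, v, hsub hv, w, hsub hw, h⟩

theorem isOptimalPlacement_of_convexHull_eq (hn : 3 ≤ n) (hp : IsPlacement L p)
    (hK : convexHull ℝ (Set.range p) = convexBody L) : IsOptimalPlacement L p := by
  obtain ⟨m, hm⟩ := exists_isGreatest_cornerAreas hn p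
  exact ⟨hp, m, isMinMaxArea_of_convexHull_eq hn hp hK hm, hm⟩

theorem minMaxArea_structure (hn : 3 ≤ n) (hL : HasFixedExtremes L l r) :
    (∃ p, IsOptimalPlacement L p ∧ convexHull ℝ (Set.range p) = convexBody L) ∧
      (∀ p, IsPlacement L p → convexHull ℝ (Set.range p) = convexBody L →
        IsOptimalPlacement L p) ∧
      (∃ m, IsMinMaxArea L m ∧ IsGreatest (inscribedAreas (convexBody L)) m) := by
  obtain ⟨-, hl, hr, hpl, hpr⟩ := hL
  have hK := convexHull_clampPoint hl hr hpl hpr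
  have hp := isPlacement_clampPoint (L := L) (L l).lower (L r).lower
  obtain ⟨m, hm⟩ := exists_isGreatest_cornerAreas hn
    (fun i => clampPoint (L l).lower (L r).lower (L i))
  refine ⟨⟨_, isOptimalPlacement_of_convexHull_eq hn hp hK, hK⟩,
    fun p hp hK => isOptimalPlacement_of_convexHull_eq hn hp hK,
    m, isMinMaxArea_of_convexHull_eq hn hp hK hm, ?_⟩
  rwa [isGreatest_cornerAreas_iff hn, hK] at hm

end Placements

/-! ### A program logic with costs -/

/-- Started in `s`, the program `c` halts with a cost and a final state that satisfy `Q`. -/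
def wp (c : Prog) (s : RamState) (Q : ℕ → RamState → Prop) : Prop :=
  ∃ t s', Runs c s t s' ∧ Q t s'

theorem wp.mono {c : Prog} {s : RamState} {Q Q' : ℕ → RamState → Prop} (h : wp c s Q)
    (hQ : ∀ t s', Q t s' → Q' t s') : wp c s Q' := by
  obtain ⟨t, s', hr, hq⟩ := h
  exact ⟨t, s', hr, hQ _ _ hq⟩

/-- The rules for the elementary constructs are equivalences, so that `simp only` can execute
straight-line code symbolically. -/
theorem wp_skip {s : RamState} {Q : ℕ → RamState → Prop} : wp Prog.skip s Q ↔ Q 1 s := by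
  constructor
  · rintro ⟨_, _, hr, hq⟩
    cases hr
    exact hq
  · exact fun h => ⟨_, _, Runs.skip s, h⟩

theorem wp_setN {v : ℕ} {e : NExp} {s : RamState} {Q : ℕ → RamState → Prop} :
    wp (Prog.setN v e) s Q ↔
      Q (e.cost + 1) { s with nreg := Function.update s.nreg v (e.eval s) } := by
  constructor
  · rintro ⟨_, _, hr, hq⟩
    cases hr
    exact hq
  · exact fun h => ⟨_, _, Runs.setN s v e, h⟩

theorem wp_setR {v : ℕ} {e : RExp} {s : RamState} {Q : ℕ → RamState → Prop} :
    wp (Prog.setR v e) s Q ↔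
      Q (e.cost + 1) { s with rreg := Function.update s.rreg v (e.eval s) } := by
  constructor
  · rintro ⟨_, _, hr, hq⟩
    cases hr
    exact hq
  · exact fun h => ⟨_, _, Runs.setR s v e, h⟩

theorem wp_putN {a : ℕ} {i e : NExp} {s : RamState} {Q : ℕ → RamState → Prop} :
    wp (Prog.putN a i e) s Q ↔
      Q (i.cost + e.cost + 1)
        { s with narr := Function.update s.narr a (Function.update (s.narr a) (i.eval s) (e.eval s)) } := by
  constructor
  · rintro ⟨_, _, hr, hq⟩
    cases hr
    exact hq
  · exact fun h => ⟨_, _, Runs.putN s a i e, h⟩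

theorem wp_putR {a : ℕ} {i : NExp} {e : RExp} {s : RamState} {Q : ℕ → RamState → Prop} :
    wp (Prog.putR a i e) s Q ↔
      Q (i.cost + e.cost + 1)
        { s with rarr := Function.update s.rarr a (Function.update (s.rarr a) (i.eval s) (e.eval s)) } := by
  constructor
  · rintro ⟨_, _, hr, hq⟩
    cases hr
    exact hq
  · exact fun h => ⟨_, _, Runs.putR s a i e, h⟩

theorem wp_seq {c d : Prog} {s : RamState} {Q : ℕ → RamState → Prop} :
    wp (Prog.seq c d) s Q ↔ wp c s fun t s' => wp d s' fun t' s'' => Q (t + t') s'' := by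
  constructor
  · rintro ⟨_, _, hr, hq⟩
    cases hr with
    | seq h1 h2 => exact ⟨_, _, h1, _, _, h2, hq⟩
  · rintro ⟨_, _, h1, _, _, h2, hq⟩
    exact ⟨_, _, Runs.seq h1 h2, hq⟩

theorem wp_ite {b : BExp} {c d : Prog} {s : RamState} {Q : ℕ → RamState → Prop} :
    wp (Prog.ite b c d) s Q ↔
      (b.Holds s → wp c s fun t s' => Q (b.cost + 1 + t) s') ∧
      (¬ b.Holds s → wp d s fun t s' => Q (b.cost + 1 + t) s') := by
  constructor
  · rintro ⟨_, _, hr, hq⟩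
    cases hr with
    | ite_true hb h => exact ⟨fun _ => ⟨_, _, h, hq⟩, fun hn => absurd hb hn⟩
    | ite_false hb h => exact ⟨fun hn => absurd hn hb, fun _ => ⟨_, _, h, hq⟩⟩
  · rintro ⟨h1, h2⟩
    by_cases hb : b.Holds s
    · obtain ⟨_, _, h, hq⟩ := h1 hb
      exact ⟨_, _, Runs.ite_true hb h, hq⟩
    · obtain ⟨_, _, h, hq⟩ := h2 hb
      exact ⟨_, _, Runs.ite_false hb h, hq⟩

/-- The loop rule: `I d s` is an invariant that includes a bound `d` on the remaining cost. -/
theorem wp_loop {b : BExp} {c : Prog} {Q : RamState → Prop} (I : ℕ → RamState → Prop)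
    (hexit : ∀ d s, I d s → ¬ b.Holds s → b.cost + 1 ≤ d ∧ Q s)
    (hstep : ∀ d s, I d s → b.Holds s →
      wp c s fun t s' => ∃ d', I d' s' ∧ b.cost + 1 + t + d' ≤ d)
    {d : ℕ} {s : RamState} (h : I d s) :
    wp (Prog.loop b c) s fun t s' => t ≤ d ∧ Q s' := by
  -- Every round costs at least one step, so the budget itself proves termination.
  induction d using Nat.strong_induction_on generalizing s with
  | _ d ih =>
    by_cases hb : b.Holds s
    · obtain ⟨t, s', hr, d', hI, hd⟩ := hstep d s h hb
      obtain ⟨t', s'', hr', ht', hQ⟩ := ih d' (by omega) hI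
      exact ⟨_, _, Runs.loop_true hb hr hr', by omega, hQ⟩
    · obtain ⟨hd, hQ⟩ := hexit d s h hb
      exact ⟨_, _, Runs.loop_false hb, hd, hQ⟩

/-- The loop rule for loops with a bound `K` on the cost of a round and a bound `μ s` on the number
of remaining rounds. -/
theorem wp_loop_count {b : BExp} {c : Prog} (I : RamState → Prop) (μ : RamState → ℕ) (K : ℕ)
    (hK : b.cost + 1 ≤ K)
    (hstep : ∀ s, I s → b.Holds s →
      wp c s fun t s' => I s' ∧ μ s' + 1 ≤ μ s ∧ b.cost + 1 + t ≤ K)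
    {s : RamState} (h : I s) :
    wp (Prog.loop b c) s fun t s' => t ≤ K * μ s + K ∧ I s' ∧ ¬ b.Holds s' := by
  -- The extra `K` pays for the last, failing test.
  refine wp_loop (fun d s => I s ∧ d = K * μ s + K) ?_ ?_ ⟨h, rfl⟩
  · rintro d s ⟨hI, rfl⟩ hb
    exact ⟨by omega, hI, hb⟩
  · rintro d s ⟨hI, rfl⟩ hb
    refine (hstep s hI hb).mono ?_
    rintro t s' ⟨hI', hμ, ht⟩
    refine ⟨_, ⟨hI', rfl⟩, ?_⟩
    have := Nat.mul_le_mul_left K hμ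
    rw [Nat.mul_add, Nat.mul_one] at this
    omega

/-- A sequence of programs. -/
def Prog.block : List Prog → Prog
  | [] => Prog.skip
  | [c] => c
  | c :: d :: l => Prog.seq c (Prog.block (d :: l))

theorem wp_block_one {c : Prog} {s : RamState} {Q : ℕ → RamState → Prop} :
    wp (Prog.block [c]) s Q ↔ wp c s Q := Iff.rfl

theorem wp_block_cons {c d : Prog} {l : List Prog} {s : RamState} {Q : ℕ → RamState → Prop} :
    wp (Prog.block (c :: d :: l)) s Q ↔
      wp c s fun t s' => wp (Prog.block (d :: l)) s' fun t' s'' => Q (t + t') s'' := wp_seq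

/-! ### Memory that a program does not touch -/

/-- The index registers that a program may write. -/
def Prog.nregs : Prog → List ℕ
  | skip => []
  | setN v _ => [v]
  | setR _ _ => []
  | putN _ _ _ => []
  | putR _ _ _ => []
  | seq c d => c.nregs ++ d.nregs
  | ite _ c d => c.nregs ++ d.nregs
  | loop _ c => c.nregs

/-- The real registers that a program may write. -/
def Prog.rregs : Prog → List ℕ
  | skip => []
  | setN _ _ => []
  | setR v _ => [v]
  | putN _ _ _ => []
  | putR _ _ _ => []
  | seq c d => c.rregs ++ d.rregs
  | ite _ c d => c.rregs ++ d.rregs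
  | loop _ c => c.rregs

/-- The index arrays that a program may write. -/
def Prog.narrs : Prog → List ℕ
  | skip => []
  | setN _ _ => []
  | setR _ _ => []
  | putN a _ _ => [a]
  | putR _ _ _ => []
  | seq c d => c.narrs ++ d.narrs
  | ite _ c d => c.narrs ++ d.narrs
  | loop _ c => c.narrs

/-- The real arrays that a program may write. -/
def Prog.rarrs : Prog → List ℕ
  | skip => []
  | setN _ _ => []
  | setR _ _ => []
  | putN _ _ _ => []
  | putR a _ _ => [a]
  | seq c d => c.rarrs ++ d.rarrs
  | ite _ c d => c.rarrs ++ d.rarrs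
  | loop _ c => c.rarrs

/-- The states `s` and `s'` agree on all memory that `c` does not write. -/
structure Frame (c : Prog) (s s' : RamState) : Prop where
  nreg : ∀ v, v ∉ c.nregs → s'.nreg v = s.nreg v
  rreg : ∀ v, v ∉ c.rregs → s'.rreg v = s.rreg v
  narr : ∀ a, a ∉ c.narrs → s'.narr a = s.narr a
  rarr : ∀ a, a ∉ c.rarrs → s'.rarr a = s.rarr a

/-- The written memory is read off from the program text, so that preservation of a register or
array is settled by `decide` or `simp`. -/
theorem Runs.frame {c : Prog} {s s' : RamState} {t : ℕ} (h : Runs c s t s') : Frame c s s' := by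
  induction h with
  | skip s => exact ⟨fun _ _ => rfl, fun _ _ => rfl, fun _ _ => rfl, fun _ _ => rfl⟩
  | setN s v e =>
    exact ⟨fun w hw => Function.update_of_ne (by simpa [Prog.nregs] using hw) _ _,
      fun _ _ => rfl, fun _ _ => rfl, fun _ _ => rfl⟩
  | setR s v e =>
    exact ⟨fun _ _ => rfl, fun w hw => Function.update_of_ne (by simpa [Prog.rregs] using hw) _ _,
      fun _ _ => rfl, fun _ _ => rfl⟩
  | putN s a i e =>
    exact ⟨fun _ _ => rfl, fun _ _ => rfl,
      fun w hw => Function.update_of_ne (by simpa [Prog.narrs] using hw) _ _, fun _ _ => rfl⟩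
  | putR s a i e =>
    exact ⟨fun _ _ => rfl, fun _ _ => rfl, fun _ _ => rfl,
      fun w hw => Function.update_of_ne (by simpa [Prog.rarrs] using hw) _ _⟩
  | seq _ _ ih1 ih2 =>
    refine ⟨fun v hv => ?_, fun v hv => ?_, fun v hv => ?_, fun v hv => ?_⟩ <;>
      simp only [Prog.nregs, Prog.rregs, Prog.narrs, Prog.rarrs, List.mem_append, not_or] at hv
    · rw [ih2.nreg v hv.2, ih1.nreg v hv.1]
    · rw [ih2.rreg v hv.2, ih1.rreg v hv.1]
    · rw [ih2.narr v hv.2, ih1.narr v hv.1]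
    · rw [ih2.rarr v hv.2, ih1.rarr v hv.1]
  | ite_true _ _ ih =>
    refine ⟨fun v hv => ?_, fun v hv => ?_, fun v hv => ?_, fun v hv => ?_⟩ <;>
      simp only [Prog.nregs, Prog.rregs, Prog.narrs, Prog.rarrs, List.mem_append, not_or] at hv
    · exact ih.nreg v hv.1
    · exact ih.rreg v hv.1
    · exact ih.narr v hv.1
    · exact ih.rarr v hv.1
  | ite_false _ _ ih =>
    refine ⟨fun v hv => ?_, fun v hv => ?_, fun v hv => ?_, fun v hv => ?_⟩ <;>
      simp only [Prog.nregs, Prog.rregs, Prog.narrs, Prog.rarrs, List.mem_append, not_or] at hv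
    · exact ih.nreg v hv.2
    · exact ih.rreg v hv.2
    · exact ih.narr v hv.2
    · exact ih.rarr v hv.2
  | loop_true _ _ _ ih1 ih2 =>
    exact ⟨fun v hv => (ih2.nreg v hv).trans (ih1.nreg v hv),
      fun v hv => (ih2.rreg v hv).trans (ih1.rreg v hv),
      fun v hv => (ih2.narr v hv).trans (ih1.narr v hv),
      fun v hv => (ih2.rarr v hv).trans (ih1.rarr v hv)⟩
  | loop_false _ => exact ⟨fun _ _ => rfl, fun _ _ => rfl, fun _ _ => rfl, fun _ _ => rfl⟩

theorem wp.frame {c : Prog} {s : RamState} {Q : ℕ → RamState → Prop} (h : wp c s Q) :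
    wp c s fun t s' => Q t s' ∧ Frame c s s' := by
  obtain ⟨t, s', hr, hq⟩ := h
  exact ⟨t, s', hr, hq, hr.frame⟩

/-- The smaller one of two index expressions. -/
def NExp.min (e f : NExp) : NExp := NExp.sub e (NExp.sub e f)

theorem NExp.eval_min (s : RamState) (e f : NExp) :
    (NExp.min e f).eval s = Min.min (e.eval s) (f.eval s) := by
  simp only [NExp.min, NExp.eval]; omega

theorem NExp.cost_min (e f : NExp) : (NExp.min e f).cost = 2 * e.cost + f.cost + 2 := by
  simp only [NExp.min, NExp.cost]; omega

/-- The index expression `v + 1` for a register `v`. -/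
def NExp.succ (v : ℕ) : NExp := NExp.add (NExp.reg v) (NExp.const 1)

theorem NExp.eval_succ (s : RamState) (v : ℕ) : (NExp.succ v).eval s = s.nreg v + 1 := rfl

theorem NExp.cost_succ (v : ℕ) : (NExp.succ v).cost = 3 := rfl

/-! ### Merging sorted runs -/

/-- The state of a merge of the runs `[lo, e₁)` and `[m, e₂)` of `A` into `B`, when the parts
`[lo, i)` and `[m, j)` have been moved to the part `[lo, k)` of `B`; below `lo`, `B` agrees
with `B₀`. -/
structure Merging (key : ℕ → ℝ) (A B₀ B : ℕ → ℕ) (lo m e₁ e₂ i j k : ℕ) : Prop where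
  lo_le : lo ≤ i
  i_le : i ≤ e₁
  m_le : m ≤ j
  -- The second run may be empty with `m` beyond `e₂`, when the input ends inside the first run.
  j_le : j ≤ e₂ ∨ j = m
  count : k + m = i + j
  old : ∀ p < lo, B p = B₀ p
  sorted : ∀ p q, lo ≤ p → p ≤ q → q < k → key (B p) ≤ key (B q)
  le_left : ∀ p q, lo ≤ p → p < k → i ≤ q → q < e₁ → key (B p) ≤ key (A q)
  le_right : ∀ p q, lo ≤ p → p < k → j ≤ q → q < e₂ → key (B p) ≤ key (A q)
  from_left : ∀ q, lo ≤ q → q < i → ∃ p, lo ≤ p ∧ p < k ∧ B p = A q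
  from_right : ∀ q, m ≤ q → q < j → ∃ p, lo ≤ p ∧ p < k ∧ B p = A q
  origin : ∀ p, lo ≤ p → p < k → ∃ q, (q < e₁ ∨ q < e₂) ∧ B p = A q

theorem Merging.init (key : ℕ → ℝ) (A B₀ : ℕ → ℕ) {lo m e₁ e₂ : ℕ} (h : lo ≤ e₁) :
    Merging key A B₀ B₀ lo m e₁ e₂ lo m lo where
  lo_le := le_rfl
  i_le := h
  m_le := le_rfl
  j_le := Or.inr rfl
  count := rfl
  old _ _ := rfl
  sorted p q _ _ _ := by omega
  le_left p q _ _ _ _ := by omega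
  le_right p q _ _ _ _ := by omega
  from_left q _ _ := by omega
  from_right q _ _ := by omega
  origin p _ _ := by omega

section

variable {key : ℕ → ℝ} {A B₀ B : ℕ → ℕ} {lo m e₁ e₂ i j k : ℕ}

/-- The moved entry `A i` is a lower bound for the rest of its own run by sortedness, and for the
other run through its head `A j`. -/
theorem Merging.step_left (h : Merging key A B₀ B lo m e₁ e₂ i j k)
    (hA : ∀ p q, lo ≤ p → p ≤ q → q < e₁ → key (A p) ≤ key (A q))
    (hA' : ∀ p q, m ≤ p → p ≤ q → q < e₂ → key (A p) ≤ key (A q))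
    (hi : i < e₁) (hij : j < e₂ → key (A i) ≤ key (A j)) :
    Merging key A B₀ (Function.update B k (A i)) lo m e₁ e₂ (i + 1) j (k + 1) := by
  have hlo := h.lo_le
  have hm := h.m_le
  have hc := h.count
  have hk : lo ≤ k := by omega
  have hne : ∀ p, p ≠ k → Function.update B k (A i) p = B p :=
    fun p hp => Function.update_of_ne hp _ _
  have heq : Function.update B k (A i) k = A i := Function.update_self _ _ _
  refine ⟨by omega, hi, hm, h.j_le, by omega, fun p hp => ?_, fun p q hp hpq hq => ?_,
    fun p q hp hpk hq hqe => ?_, fun p q hp hpk hq hqe => ?_, fun q hq hqi => ?_,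
    fun q hq hqj => ?_, fun p hp hpk => ?_⟩
  · rw [hne p (by omega), h.old p hp]
  · rcases eq_or_ne q k with rfl | hqk
    · rw [heq]
      rcases eq_or_ne p q with rfl | hpq'
      · rw [heq]
      · rw [hne p hpq']
        exact h.le_left p i hp (by omega) le_rfl hi
    · rw [hne q hqk, hne p (by omega)]
      exact h.sorted p q hp hpq (by omega)
  · rcases eq_or_ne p k with rfl | hpk'
    · rw [heq]
      exact hA i q hlo (by omega) hqe
    · rw [hne p hpk']
      exact h.le_left p q hp (by omega) (by omega) hqe
  · rcases eq_or_ne p k with rfl | hpk'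
    · rw [heq]
      exact (hij (by omega)).trans (hA' j q hm hq hqe)
    · rw [hne p hpk']
      exact h.le_right p q hp (by omega) hq hqe
  · rcases eq_or_ne q i with rfl | hqi'
    · exact ⟨k, hk, by omega, heq⟩
    · obtain ⟨p, hp, hpk, hpq⟩ := h.from_left q hq (by omega)
      exact ⟨p, hp, by omega, by rw [hne p (by omega), hpq]⟩
  · obtain ⟨p, hp, hpk, hpq⟩ := h.from_right q hq hqj
    exact ⟨p, hp, by omega, by rw [hne p (by omega), hpq]⟩
  · rcases eq_or_ne p k with rfl | hpk'
    · exact ⟨i, Or.inl hi, heq⟩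
    · rw [hne p hpk']
      exact h.origin p hp (by omega)

theorem Merging.step_right (h : Merging key A B₀ B lo m e₁ e₂ i j k)
    (hA : ∀ p q, lo ≤ p → p ≤ q → q < e₁ → key (A p) ≤ key (A q))
    (hA' : ∀ p q, m ≤ p → p ≤ q → q < e₂ → key (A p) ≤ key (A q))
    (hj : j < e₂) (hij : i < e₁ → key (A j) ≤ key (A i)) :
    Merging key A B₀ (Function.update B k (A j)) lo m e₁ e₂ i (j + 1) (k + 1) := by
  have hlo := h.lo_le
  have hm := h.m_le
  have hc := h.count
  have hk : lo ≤ k := by omega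
  have hne : ∀ p, p ≠ k → Function.update B k (A j) p = B p :=
    fun p hp => Function.update_of_ne hp _ _
  have heq : Function.update B k (A j) k = A j := Function.update_self _ _ _
  refine ⟨hlo, h.i_le, by omega, Or.inl hj, by omega, fun p hp => ?_, fun p q hp hpq hq => ?_,
    fun p q hp hpk hq hqe => ?_, fun p q hp hpk hq hqe => ?_, fun q hq hqi => ?_,
    fun q hq hqj => ?_, fun p hp hpk => ?_⟩
  · rw [hne p (by omega), h.old p hp]
  · rcases eq_or_ne q k with rfl | hqk
    · rw [heq]
      rcases eq_or_ne p q with rfl | hpq'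
      · rw [heq]
      · rw [hne p hpq']
        exact h.le_right p j hp (by omega) le_rfl hj
    · rw [hne q hqk, hne p (by omega)]
      exact h.sorted p q hp hpq (by omega)
  · rcases eq_or_ne p k with rfl | hpk'
    · rw [heq]
      exact (hij (by omega)).trans (hA i q hlo hq hqe)
    · rw [hne p hpk']
      exact h.le_left p q hp (by omega) hq hqe
  · rcases eq_or_ne p k with rfl | hpk'
    · rw [heq]
      exact hA' j q hm (by omega) hqe
    · rw [hne p hpk']
      exact h.le_right p q hp (by omega) (by omega) hqe
  · obtain ⟨p, hp, hpk, hpq⟩ := h.from_left q hq hqi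
    exact ⟨p, hp, by omega, by rw [hne p (by omega), hpq]⟩
  · rcases eq_or_ne q j with rfl | hqi'
    · exact ⟨k, hk, by omega, heq⟩
    · obtain ⟨p, hp, hpk, hpq⟩ := h.from_right q hq (by omega)
      exact ⟨p, hp, by omega, by rw [hne p (by omega), hpq]⟩
  · rcases eq_or_ne p k with rfl | hpk'
    · exact ⟨j, Or.inr hj, heq⟩
    · rw [hne p hpk']
      exact h.origin p hp (by omega)

end

/-- The blocks of length `w` of the part `[0, n)` of `A` are sorted. -/
def BlockSorted (key : ℕ → ℝ) (w n : ℕ) (A : ℕ → ℕ) : Prop :=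
  ∀ b p q, b * w ≤ p → p ≤ q → q < (b + 1) * w → q < n → key (A p) ≤ key (A q)

/-- The part `[0, n)` of `A` lists the part `[0, n)` of `A'`, without new entries. -/
def SameEntries (n : ℕ) (A A' : ℕ → ℕ) : Prop :=
  (∀ p < n, ∃ q < n, A' p = A q) ∧ ∀ q < n, ∃ p < n, A' p = A q

/-- The state of a merge pass that has treated the blocks below `st`. -/
structure MergePass (key : ℕ → ℝ) (w n : ℕ) (A B : ℕ → ℕ) (st : ℕ) : Prop where
  block : ∃ b, st = b * (2 * w)
  sorted : ∀ b p q, b * (2 * w) ≤ p → p ≤ q → q < (b + 1) * (2 * w) → q < st → q < n →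
    key (B p) ≤ key (B q)
  origin : ∀ p < st, p < n → ∃ q < n, B p = A q
  covers : ∀ q < st, q < n → ∃ p < st, p < n ∧ B p = A q

theorem MergePass.init (key : ℕ → ℝ) (w n : ℕ) (A B : ℕ → ℕ) : MergePass key w n A B 0 :=
  ⟨⟨0, by simp⟩, fun _ _ _ _ _ _ h => by omega, fun _ h => by omega, fun _ h => by omega⟩

/-- Cells below `st` are untouched by the merge, the current block is sorted by it, and later blocks
are not yet claimed. Ends are cut off at `n`, so the last block may be incomplete or lack a second
run. -/
theorem MergePass.step {key : ℕ → ℝ} {w n : ℕ} {A B₀ B : ℕ → ℕ} {st i j : ℕ}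
    (h : MergePass key w n A B₀ st)
    (hM : Merging key A B₀ B st (st + w) (min (st + w) n) (min (st + 2 * w) n) i j
      (min (st + 2 * w) n)) :
    MergePass key w n A B (st + 2 * w) := by
  obtain ⟨⟨b₀, hb₀⟩, hs, ho, hc⟩ := h
  have hcount := hM.count
  have h1 := hM.i_le
  have h2 := hM.j_le
  have hj := hM.m_le
  have hend : st + 2 * w = (b₀ + 1) * (2 * w) := by rw [hb₀]; ring
  refine ⟨⟨b₀ + 1, hend⟩, fun b p q hp hpq hq hq' hqn => ?_, fun p hp hpn => ?_,
    fun q hq hqn => ?_⟩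
  · rcases lt_trichotomy b b₀ with hb | rfl | hb
    · have : (b + 1) * (2 * w) ≤ b₀ * (2 * w) := Nat.mul_le_mul_right _ hb
      rw [hM.old p (by omega), hM.old q (by omega)]
      exact hs b p q hp hpq hq (by omega) hqn
    · exact hM.sorted p q (by omega) hpq (by omega)
    · have : (b₀ + 1) * (2 * w) ≤ b * (2 * w) := Nat.mul_le_mul_right _ hb
      omega
  · by_cases hps : p < st
    · rw [hM.old p hps]
      exact ho p hps hpn
    · obtain ⟨q, hq, hpq⟩ := hM.origin p (by omega) (by omega)
      exact ⟨q, by omega, hpq⟩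
  · by_cases hqs : q < st
    · obtain ⟨p, hp, hpn, hpq⟩ := hc q hqs hqn
      exact ⟨p, by omega, hpn, by rw [hM.old p hp, hpq]⟩
    · by_cases hqw : q < st + w
      · obtain ⟨p, hp, hpk, hpq⟩ := hM.from_left q (by omega) (by omega)
        exact ⟨p, by omega, by omega, hpq⟩
      · obtain ⟨p, hp, hpk, hpq⟩ := hM.from_right q (by omega) (by omega)
        exact ⟨p, by omega, by omega, hpq⟩

theorem MergePass.finish {key : ℕ → ℝ} {w n : ℕ} {A B : ℕ → ℕ} {st : ℕ}
    (h : MergePass key w n A B st) (hst : n ≤ st) :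
    BlockSorted key (2 * w) n B ∧ SameEntries n A B :=
  ⟨fun b p q hp hpq hq hqn => h.sorted b p q hp hpq hq (by omega) hqn,
    fun p hp => h.origin p (by omega) hp, fun q hq => by
      obtain ⟨p, -, hp⟩ := h.covers q (by omega) hq
      exact ⟨p, hp⟩⟩

/-- Block `b` of length `2 * w` consists of the blocks `2 * b` and `2 * b + 1` of length `w`. -/
theorem BlockSorted.left {key : ℕ → ℝ} {w n : ℕ} {A : ℕ → ℕ} (h : BlockSorted key w n A)
    {st b : ℕ} (hst : st = b * (2 * w)) :
    ∀ p q, st ≤ p → p ≤ q → q < min (st + w) n → key (A p) ≤ key (A q) := by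
  intro p q hp hpq hq
  have h1 : 2 * b * w = st := by rw [hst]; ring
  have h2 : (2 * b + 1) * w = st + w := by rw [hst]; ring
  exact h (2 * b) p q (by omega) hpq (by omega) (by omega)

theorem BlockSorted.right {key : ℕ → ℝ} {w n : ℕ} {A : ℕ → ℕ} (h : BlockSorted key w n A)
    {st b : ℕ} (hst : st = b * (2 * w)) :
    ∀ p q, st + w ≤ p → p ≤ q → q < min (st + 2 * w) n → key (A p) ≤ key (A q) := by
  intro p q hp hpq hq
  have h1 : (2 * b + 1) * w = st + w := by rw [hst]; ring
  have h2 : (2 * b + 1 + 1) * w = st + 2 * w := by rw [hst]; ring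
  exact h (2 * b + 1) p q (by omega) hpq (by omega) (by omega)

/-! ### The sorting program

Index registers: `0` the length, `4` the block length, `5` the start of the block, `6`, `7`, `8`
the positions in the two runs and in the output, `9`, `10` the ends of the runs. -/

/-- One step of merging. -/
def mergeStep : Prog :=
  .block [
    .ite (.and (.nlt (.reg 6) (.reg 9)) (.neg (.and (.nlt (.reg 7) (.reg 10))
        (.rlt (.get 3 (.get 0 (.reg 7))) (.get 3 (.get 0 (.reg 6)))))))
      (.block [.putN 1 (.reg 8) (.get 0 (.reg 6)), .setN 6 (.succ 6)])
      (.block [.putN 1 (.reg 8) (.get 0 (.reg 7)), .setN 7 (.succ 7)]),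
    .setN 8 (.succ 8)]

/-- Merging the two runs of a block. -/
def mergeBlock : Prog :=
  .block [
    .setN 6 (.reg 5),
    .setN 7 (.add (.reg 5) (.reg 4)),
    .setN 8 (.reg 5),
    .setN 9 (.min (.add (.reg 5) (.reg 4)) (.reg 0)),
    .setN 10 (.min (.add (.add (.reg 5) (.reg 4)) (.reg 4)) (.reg 0)),
    .loop (.nlt (.reg 8) (.reg 10)) mergeStep,
    .setN 5 (.add (.add (.reg 5) (.reg 4)) (.reg 4))]

/-- Merging neighbouring runs, and copying the result back. -/
def mergePass : Prog :=
  .block [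
    .setN 5 (.const 0),
    .loop (.nlt (.reg 5) (.reg 0)) mergeBlock,
    .setN 8 (.const 0),
    .loop (.nlt (.reg 8) (.reg 0))
      (.block [.putN 0 (.reg 8) (.get 1 (.reg 8)), .setN 8 (.succ 8)]),
    .setN 4 (.add (.reg 4) (.reg 4))]

/-- Merge sort of the index array `0` by the keys in the real array `3`. -/
def mergeSort : Prog :=
  .block [.setN 4 (.const 1), .loop (.nlt (.reg 4) (.reg 0)) mergePass]

/-- The assumption `hm` says that the first run is complete or that the second is empty. With the
count of moved entries it excludes that both runs are exhausted while the output is unfinished. -/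
theorem wp_mergeStep {B₀ : ℕ → ℕ} {lo m : ℕ} {s : RamState}
    (hA : ∀ p q, lo ≤ p → p ≤ q → q < s.nreg 9 → s.rarr 3 (s.narr 0 p) ≤ s.rarr 3 (s.narr 0 q))
    (hA' : ∀ p q, m ≤ p → p ≤ q → q < s.nreg 10 → s.rarr 3 (s.narr 0 p) ≤ s.rarr 3 (s.narr 0 q))
    (hm : s.nreg 9 = m ∨ s.nreg 10 ≤ s.nreg 9)
    (h : Merging (s.rarr 3) (s.narr 0) B₀ (s.narr 1) lo m (s.nreg 9) (s.nreg 10) (s.nreg 6)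
      (s.nreg 7) (s.nreg 8)) (hk : s.nreg 8 < s.nreg 10) :
    wp mergeStep s fun t s' => t ≤ 40 ∧ s'.nreg 8 = s.nreg 8 + 1 ∧
      Merging (s.rarr 3) (s.narr 0) B₀ (s'.narr 1) lo m (s.nreg 9) (s.nreg 10) (s'.nreg 6)
      (s'.nreg 7) (s'.nreg 8) := by
  simp only [mergeStep, wp_block_cons, wp_block_one, wp_ite, wp_putN, wp_setN, NExp.eval,
    BExp.Holds, RExp.eval, NExp.cost, BExp.cost, RExp.cost, NExp.eval_succ, NExp.cost_succ]
  have hc := h.count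
  have h1 := h.i_le
  have h2 := h.m_le
  refine ⟨fun hb => ?_, fun hb => ?_⟩
  · simp
    refine h.step_left hA hA' hb.1 fun hj => ?_
    exact not_lt.1 fun hlt => hb.2 ⟨hj, hlt⟩
  · simp
    have hj : s.nreg 7 < s.nreg 10 := by
      by_contra hj
      exact hb ⟨by omega, fun hh => hj hh.1⟩
    refine h.step_right hA hA' hj fun hi => ?_
    by_contra hlt
    exact hb ⟨hi, fun hh => hlt hh.2.le⟩

theorem wp_mergeLoop {key : ℕ → ℝ} {A B₀ : ℕ → ℕ} {lo m e₁ e₂ : ℕ}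
    (hA : ∀ p q, lo ≤ p → p ≤ q → q < e₁ → key (A p) ≤ key (A q))
    (hA' : ∀ p q, m ≤ p → p ≤ q → q < e₂ → key (A p) ≤ key (A q))
    (hm : e₁ = m ∨ e₂ ≤ e₁) {s : RamState} (h9 : s.nreg 9 = e₁) (h10 : s.nreg 10 = e₂)
    (hn : s.narr 0 = A) (hr : s.rarr 3 = key) (hlo : s.nreg 8 ≤ e₂)
    (h : Merging key A B₀ (s.narr 1) lo m e₁ e₂ (s.nreg 6) (s.nreg 7) (s.nreg 8)) :
    wp (.loop (.nlt (.reg 8) (.reg 10)) mergeStep) s fun t s' => t ≤ 50 * (e₂ - s.nreg 8) + 50 ∧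
      Merging key A B₀ (s'.narr 1) lo m e₁ e₂ (s'.nreg 6) (s'.nreg 7) e₂ := by
  have hloop := wp_loop_count (b := .nlt (.reg 8) (.reg 10)) (c := mergeStep)
    (fun s => s.nreg 9 = e₁ ∧ s.nreg 10 = e₂ ∧ s.narr 0 = A ∧ s.rarr 3 = key ∧ s.nreg 8 ≤ e₂ ∧
      Merging key A B₀ (s.narr 1) lo m e₁ e₂ (s.nreg 6) (s.nreg 7) (s.nreg 8))
    (fun s => e₂ - s.nreg 8) 50 (by simp [BExp.cost, NExp.cost]) ?_ (s := s)
    ⟨h9, h10, hn, hr, hlo, h⟩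
  · refine hloop.mono ?_
    rintro t s' ⟨ht, ⟨-, h10, -, -, hle, hM⟩, hb⟩
    simp only [BExp.Holds, NExp.eval] at hb
    have : s'.nreg 8 = e₂ := by omega
    exact ⟨ht, this ▸ hM⟩
  · rintro s ⟨h9, h10, hn, hr, hlo, h⟩ hb
    subst h9 h10 hn hr
    simp only [BExp.Holds, NExp.eval] at hb
    refine (wp_mergeStep hA hA' hm h hb).frame.mono ?_
    rintro t s' ⟨⟨ht, h8, hM⟩, hf⟩
    refine ⟨⟨hf.nreg 9 (by decide), hf.nreg 10 (by decide), hf.narr 0 (by decide),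
      hf.rarr 3 (by decide), by omega, hM⟩, by omega, ?_⟩
    simp only [BExp.cost, NExp.cost]
    omega

/-- The cost is charged to the entries of the block that really exist. There is at least one, which
absorbs the constant overhead, and the charges of a pass add up to `O(n)` for every `w`. -/
theorem wp_mergeBlock {s : RamState} (hst : s.nreg 5 < s.nreg 0) (hw : 0 < s.nreg 4)
    (hA : BlockSorted (s.rarr 3) (s.nreg 4) (s.nreg 0) (s.narr 0))
    (h : MergePass (s.rarr 3) (s.nreg 4) (s.nreg 0) (s.narr 0) (s.narr 1) (s.nreg 5)) :
    wp mergeBlock s fun t s' =>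
      t ≤ 200 * (min (s.nreg 5 + 2 * s.nreg 4) (s.nreg 0) - s.nreg 5) ∧
      s'.nreg 5 = s.nreg 5 + 2 * s.nreg 4 ∧
      MergePass (s.rarr 3) (s.nreg 4) (s.nreg 0) (s.narr 0) (s'.narr 1) (s'.nreg 5) := by
  obtain ⟨b, hb⟩ := h.block
  simp only [mergeBlock, wp_block_cons, wp_block_one, wp_setN, NExp.eval, NExp.cost,
    NExp.eval_min, NExp.cost_min]
  have e2 : s.nreg 5 + s.nreg 4 + s.nreg 4 = s.nreg 5 + 2 * s.nreg 4 := by omega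
  refine (wp_mergeLoop (B₀ := s.narr 1) (hA.left hb) (hA.right hb) (by omega)
    (by simp) (by simp [e2]) (by simp) (by simp) (by simp; omega)
    (by simpa using Merging.init _ _ _ (by omega))).frame.mono ?_
  rintro t s' ⟨⟨ht, hM⟩, hf⟩
  have h4 : s'.nreg 4 = s.nreg 4 := by rw [hf.nreg 4 (by decide)]; simp
  have h5 : s'.nreg 5 = s.nreg 5 := by rw [hf.nreg 5 (by decide)]; simp
  simp only [Function.update_self, h4, h5, e2, true_and]
  refine ⟨?_, h.step hM⟩
  simp at ht
  omega

theorem wp_mergePass {s : RamState} (hw : 0 < s.nreg 4)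
    (hA : BlockSorted (s.rarr 3) (s.nreg 4) (s.nreg 0) (s.narr 0)) :
    wp mergePass s fun t s' => t ≤ 300 * s.nreg 0 + 300 ∧ s'.nreg 4 = 2 * s.nreg 4 ∧
      BlockSorted (s.rarr 3) (2 * s.nreg 4) (s.nreg 0) (s'.narr 0) ∧
      SameEntries (s.nreg 0) (s.narr 0) (s'.narr 0) := by
  simp only [mergePass, wp_block_cons, wp_block_one, wp_setN, NExp.eval, NExp.cost]
  -- In the budget, 200 per entry pays for the merging and 4 per entry for the loop test of its
  -- block; the final 4 is the failing test.
  have hloop := wp_loop (b := .nlt (.reg 5) (.reg 0)) (c := mergeBlock)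
    (Q := fun s' => s.nreg 0 ≤ s'.nreg 5 ∧
      MergePass (s.rarr 3) (s.nreg 4) (s.nreg 0) (s.narr 0) (s'.narr 1) (s'.nreg 5))
    (fun d s' => s'.nreg 0 = s.nreg 0 ∧ s'.nreg 4 = s.nreg 4 ∧ s'.narr 0 = s.narr 0 ∧
      s'.rarr 3 = s.rarr 3 ∧ d = 204 * (s.nreg 0 - s'.nreg 5) + 4 ∧
      MergePass (s.rarr 3) (s.nreg 4) (s.nreg 0) (s.narr 0) (s'.narr 1) (s'.nreg 5))
    ?_ ?_ (d := 204 * s.nreg 0 + 4)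
    (s := { s with nreg := Function.update s.nreg 5 0 })
    ⟨by simp, by simp, rfl, rfl, by simp, by simpa using MergePass.init _ _ _ _ _⟩
  · refine hloop.frame.mono ?_
    rintro t₁ s₁ ⟨⟨ht₁, hst, hP⟩, hf₁⟩
    obtain ⟨hsort, hsame⟩ := hP.finish hst
    have h0 : s₁.nreg 0 = s.nreg 0 := by rw [hf₁.nreg 0 (by decide)]; simp
    have h4 : s₁.nreg 4 = s.nreg 4 := by rw [hf₁.nreg 4 (by decide)]; simp
    have hcopy := wp_loop_count (b := .nlt (.reg 8) (.reg 0))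
      (c := .block [.putN 0 (.reg 8) (.get 1 (.reg 8)), .setN 8 (.succ 8)])
      (fun s' => s'.nreg 0 = s.nreg 0 ∧ s'.narr 1 = s₁.narr 1 ∧ s'.nreg 8 ≤ s.nreg 0 ∧
        ∀ p < s'.nreg 8, s'.narr 0 p = s₁.narr 1 p)
      (fun s' => s.nreg 0 - s'.nreg 8) 20 (by simp [BExp.cost, NExp.cost]) ?_
      (s := { s₁ with nreg := Function.update s₁.nreg 8 0 })
      ⟨by simp [h0], rfl, by simp, by simp⟩
    · refine hcopy.frame.mono ?_
      rintro t₂ s₂ ⟨⟨ht₂, ⟨h0', -, hle, hcp⟩, hb⟩, hf₂⟩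
      simp only [BExp.Holds, NExp.eval] at hb
      have h4' : s₂.nreg 4 = s.nreg 4 := by rw [hf₂.nreg 4 (by decide)]; simp [h4]
      have hcp' : ∀ p < s.nreg 0, s₂.narr 0 p = s₁.narr 1 p := fun p hp => hcp p (by omega)
      simp only [Function.update_self, h4']
      simp at ht₂
      refine ⟨by omega, by omega, fun b p q hp hpq hq hqn => ?_, fun p hp => ?_, fun q hq => ?_⟩
      · rw [hcp' p (by omega), hcp' q hqn]
        exact hsort b p q hp hpq hq hqn
      · rw [hcp' p hp]
        exact hsame.1 p hp
      · obtain ⟨p, hp, hpq⟩ := hsame.2 q hq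
        exact ⟨p, hp, by rw [hcp' p hp, hpq]⟩
    · rintro s' ⟨h0', h1, hle, hcp⟩ hb
      simp only [BExp.Holds, NExp.eval] at hb
      simp only [wp_block_cons, wp_block_one, wp_putN, wp_setN, NExp.eval, NExp.cost,
        NExp.eval_succ, NExp.cost_succ, BExp.cost]
      refine ⟨⟨by simp [h0'], by simp [h1], by simp; omega, fun p hp => ?_⟩, by simp; omega,
        by omega⟩
      simp only [Function.update_self] at hp ⊢
      rcases eq_or_ne p (s'.nreg 8) with rfl | hne
      · simp [h1]
      · simp [hne, hcp p (by omega)]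
  · rintro d s' ⟨h0, h4, hn, hr, rfl, hP⟩ hb
    simp only [BExp.Holds, NExp.eval] at hb
    exact ⟨by simp only [BExp.cost, NExp.cost]; omega, by omega, hP⟩
  · rintro d s' ⟨h0, h4, hn, hr, rfl, hP⟩ hb
    simp only [BExp.Holds, NExp.eval] at hb
    refine (wp_mergeBlock hb (by omega) (by rwa [h0, h4, hn, hr])
      (by rwa [h0, h4, hn, hr])).frame.mono ?_
    rintro t s'' ⟨⟨ht, h5, hP'⟩, hf⟩
    rw [h0, h4, hn, hr] at hP'
    refine ⟨_, ⟨(hf.nreg 0 (by decide)).trans h0, (hf.nreg 4 (by decide)).trans h4,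
      (hf.narr 0 (by decide)).trans hn, (hf.rarr 3 (by decide)).trans hr, rfl, hP'⟩, ?_⟩
    simp only [BExp.cost, NExp.cost]
    omega

theorem SameEntries.refl (n : ℕ) (A : ℕ → ℕ) : SameEntries n A A :=
  ⟨fun p hp => ⟨p, hp, rfl⟩, fun p hp => ⟨p, hp, rfl⟩⟩

theorem SameEntries.trans {n : ℕ} {A A' A'' : ℕ → ℕ} (h : SameEntries n A A')
    (h' : SameEntries n A' A'') : SameEntries n A A'' := by
  refine ⟨fun p hp => ?_, fun q hq => ?_⟩
  · obtain ⟨q, hq, e⟩ := h'.1 p hp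
    obtain ⟨r, hr, e'⟩ := h.1 q hq
    exact ⟨r, hr, e.trans e'⟩
  · obtain ⟨p, hp, e⟩ := h.2 q hq
    obtain ⟨r, hr, e'⟩ := h'.2 p hp
    exact ⟨r, hr, e'.trans e⟩

/-- The sorting program sorts the first `n` cells of the index array `0`. -/
theorem wp_mergeSort (s : RamState) :
    wp mergeSort s fun t s' => t ≤ (300 * s.nreg 0 + 310) * (Nat.clog 2 (s.nreg 0) + 1) ∧
      SameEntries (s.nreg 0) (s.narr 0) (s'.narr 0) ∧
      ∀ p q, p ≤ q → q < s.nreg 0 → s.rarr 3 (s'.narr 0 p) ≤ s.rarr 3 (s'.narr 0 q) := by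
  set n := s.nreg 0 with hn
  have hclog : n ≤ 2 ^ Nat.clog 2 n := Nat.le_pow_clog (by norm_num) n
  have hloop := wp_loop (b := .nlt (.reg 4) (.reg 0)) (c := mergePass)
    (Q := fun s' => SameEntries n (s.narr 0) (s'.narr 0) ∧
      ∀ p q, p ≤ q → q < n → s.rarr 3 (s'.narr 0 p) ≤ s.rarr 3 (s'.narr 0 q))
    (fun d s' => s'.nreg 0 = n ∧ s'.rarr 3 = s.rarr 3 ∧
      SameEntries n (s.narr 0) (s'.narr 0) ∧
      BlockSorted (s.rarr 3) (s'.nreg 4) n (s'.narr 0) ∧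
      -- The block length is `2 ^ j`, which stays below `n` only while `j < Nat.clog 2 n`.
      ∃ j, s'.nreg 4 = 2 ^ j ∧ d = (300 * n + 310) * (Nat.clog 2 n - j) + 10)
    ?_ ?_ (d := (300 * n + 310) * Nat.clog 2 n + 10)
    (s := { s with nreg := Function.update s.nreg 4 1 })
    ⟨by simp [hn], rfl, SameEntries.refl _ _, ?_, 0, by simp, by simp⟩
  · simp only [mergeSort, wp_block_cons, wp_block_one, wp_setN, NExp.eval, NExp.cost]
    refine hloop.mono ?_
    rintro t s' ⟨ht, hQ⟩
    exact ⟨by rw [Nat.mul_add, Nat.mul_one]; omega, hQ⟩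
  · rintro d s' ⟨h0, hr, hsame, hsort, j, hj, rfl⟩ hb
    simp only [BExp.Holds, NExp.eval] at hb
    refine ⟨by simp only [BExp.cost, NExp.cost]; omega, hsame, fun p q hpq hq => ?_⟩
    -- On exit block `0` covers all of `[0, n)`.
    exact hsort 0 p q (by omega) hpq (by omega) hq
  · rintro d s' ⟨h0, hr, hsame, hsort, j, hj, rfl⟩ hb
    simp only [BExp.Holds, NExp.eval] at hb
    have hjc : j < Nat.clog 2 n := by
      by_contra hge
      have := Nat.pow_le_pow_right (n := 2) (by norm_num) (not_lt.1 hge)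
      omega
    refine (wp_mergePass (by rw [hj]; positivity) (by rwa [h0, hr])).frame.mono ?_
    rintro t s'' ⟨⟨ht, h4, hsort', hsame'⟩, hf⟩
    rw [h0, hr, ← h4] at hsort'
    rw [h0] at hsame' ht
    refine ⟨_, ⟨(hf.nreg 0 (by decide)).trans h0, (hf.rarr 3 (by decide)).trans hr,
      hsame.trans hsame', hsort', j + 1, by rw [h4, hj, pow_succ, mul_comm], rfl⟩, ?_⟩
    have : Nat.clog 2 n - j = (Nat.clog 2 n - (j + 1)) + 1 := by omega
    rw [this, Nat.mul_add, Nat.mul_one]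
    simp only [BExp.cost, NExp.cost]
    omega
  · intro b p q hp hpq hq _
    simp only [Function.update_self] at hp hq
    have : p = q := by omega
    rw [this]

/-! ### Convex chains -/

theorem orient_rotate (p q r : ℝ × ℝ) : orient p q r = orient q r p := by
  unfold orient; ring

theorem orient_swap (p q r : ℝ × ℝ) : orient p q r = -orient q p r := by
  unfold orient; ring

theorem orient_neg (p q r : ℝ × ℝ) : orient (-p) (-q) (-r) = orient p q r := by
  simp only [orient, Prod.fst_neg, Prod.snd_neg]; ring

/-- The points `S 0, …, S t` are the vertices of the lower convex hull of `Q`, from left to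
right. -/
structure LowerChain (S : ℕ → ℝ × ℝ) (t : ℕ) (Q : Set (ℝ × ℝ)) : Prop where
  mem : ∀ j ≤ t, S j ∈ Q
  mono : ∀ j < t, (S j).1 < (S (j + 1)).1
  turn : ∀ j, j + 1 < t → 0 < orient (S j) (S (j + 1)) (S (j + 2))
  supp : ∀ j < t, ∀ q ∈ Q, 0 ≤ orient (S j) (S (j + 1)) q
  first_le : ∀ q ∈ Q, (S 0).1 ≤ q.1
  -- For positive `t` this follows from `supp`; it is needed when `t = 0` and all points lie on one
  -- vertical line.
  first_low : ∀ q ∈ Q, q.1 = (S 0).1 → (S 0).2 ≤ q.2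
  last_le : ∀ q ∈ Q, q.1 ≤ (S t).1
  last_low : ∀ q ∈ Q, q.1 = (S t).1 → (S t).2 ≤ q.2

namespace LowerChain

variable {S U : ℕ → ℝ × ℝ} {t t' : ℕ} {Q : Set (ℝ × ℝ)} {p q : ℝ × ℝ}

theorem congr (h : LowerChain S t Q) (hU : ∀ j ≤ t, U j = S j) : LowerChain U t Q where
  mem j hj := by rw [hU j hj]; exact h.mem j hj
  mono j hj := by rw [hU j hj.le, hU (j + 1) hj]; exact h.mono j hj
  turn j hj := by
    rw [hU j (by omega), hU (j + 1) (by omega), hU (j + 2) (by omega)]; exact h.turn j hj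
  supp j hj := by rw [hU j hj.le, hU (j + 1) hj]; exact h.supp j hj
  first_le := by rw [hU 0 (by omega)]; exact h.first_le
  first_low := by rw [hU 0 (by omega)]; exact h.first_low
  last_le := by rw [hU t le_rfl]; exact h.last_le
  last_low := by rw [hU t le_rfl]; exact h.last_low

theorem lt_of_lt (h : LowerChain S t Q) {i j : ℕ} (hij : i < j) (hj : j ≤ t) :
    (S i).1 < (S j).1 := by
  induction j, hij using Nat.le_induction with
  | base => exact h.mono i (by omega)
  | succ j hij ih => exact (ih (by omega)).trans (h.mono j (by omega))

theorem le_of_le (h : LowerChain S t Q) {i j : ℕ} (hij : i ≤ j) (hj : j ≤ t) :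
    (S i).1 ≤ (S j).1 := by
  rcases hij.eq_or_lt with rfl | hlt
  · exact le_rfl
  · exact (h.lt_of_lt hlt hj).le

theorem eq_of_fst_eq (h : LowerChain S t Q) {i j : ℕ} (hi : i ≤ t) (hj : j ≤ t)
    (he : (S i).1 = (S j).1) : i = j := by
  rcases lt_trichotomy i j with hlt | heq | hgt
  · exact absurd he (h.lt_of_lt hlt hj).ne
  · exact heq
  · exact absurd he (h.lt_of_lt hgt hi).ne'

theorem singleton (S : ℕ → ℝ × ℝ) : LowerChain S 0 {S 0} where
  mem j hj := by obtain rfl : j = 0 := by omega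
                 rfl
  mono j hj := by omega
  turn j hj := by omega
  supp j hj := by omega
  first_le := by rintro q rfl; exact le_rfl
  first_low := by rintro q rfl _; exact le_rfl
  last_le := by rintro q rfl; exact le_rfl
  last_low := by rintro q rfl _; exact le_rfl

/-- A point to the right of a chain that lies above its last edge lies above all its edges. -/
theorem supp_of_last (h : LowerChain S t' Q) (htt : t ≤ t')
    (hp : ∀ q ∈ Q, q.1 ≤ p.1) (hlast : t = 0 ∨ 0 < orient (S (t - 1)) (S t) p) :
    ∀ j < t, 0 ≤ orient (S j) (S (j + 1)) p := by
  intro j hj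
  obtain ⟨m, rfl⟩ : ∃ m, t = m + 1 := ⟨t - 1, by omega⟩
  have hlast' : 0 < orient (S m) (S (m + 1)) p := by
    rcases hlast with h0 | h0
    · omega
    · exact h0
  have hjm : j ≤ m := by omega
  clear hlast
  -- Induction from the last edge backwards: `key` writes the height of `p` over edge `k` as a
  -- nonnegative combination of the turn after edge `k` and the height of `p` over edge `k + 1`.
  induction hjm using Nat.decreasingInduction with
  | self => exact hlast'.le
  | of_succ k hk ih =>
    have ih' := ih (by omega)
    have h1 := h.mono k (by omega)
    have h2 := h.mono (k + 1) (by omega)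
    have h3 := h.supp k (by omega) _ (h.mem (k + 2) (by omega))
    have h4 := hp _ (h.mem (k + 1) (by omega))
    have key : orient (S k) (S (k + 1)) p * ((S (k + 2)).1 - (S (k + 1)).1)
        = orient (S k) (S (k + 1)) (S (k + 2)) * (p.1 - (S (k + 1)).1)
          + ((S (k + 1)).1 - (S k).1) * orient (S (k + 1)) (S (k + 2)) p := by
      unfold orient; ring
    have h5 : 0 ≤ orient (S k) (S (k + 1)) p * ((S (k + 2)).1 - (S (k + 1)).1) := by
      rw [key]
      exact add_nonneg (mul_nonneg h3 (by linarith)) (mul_nonneg (by linarith) ih')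
    exact nonneg_of_mul_nonneg_left h5 (by simpa using h2)

/-- All old points lie above the edge from the last remaining vertex to the new point. -/
theorem supp_new (h : LowerChain S t' Q) (htt : t ≤ t')
    (hpop : t = t' ∨ orient (S t) (S (t + 1)) p ≤ 0)
    (hlast : t = 0 ∨ 0 < orient (S (t - 1)) (S t) p)
    (hlt : (S t).1 < p.1) (hq : q ∈ Q) : 0 ≤ orient (S t) p q := by
  rcases lt_or_ge q.1 (S t).1 with hqt | hqt
  · have ht0 : t ≠ 0 := by
      rintro rfl
      exact absurd (h.first_le q hq) (not_le.2 hqt)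
    obtain ⟨m, rfl⟩ : ∃ m, t = m + 1 := ⟨t - 1, by omega⟩
    have hlast' : 0 < orient (S m) (S (m + 1)) p := by simpa using hlast
    have h1 := h.mono m (by omega)
    have h2 := h.supp m (by omega) q hq
    -- Left of the last remaining vertex, `q` lies above the extended last edge, and the new edge,
    -- turning left, extends below that line.
    have key : ((S (m + 1)).1 - (S m).1) * orient (S (m + 1)) p q
        = (p.1 - (S (m + 1)).1) * orient (S m) (S (m + 1)) q
          + ((S (m + 1)).1 - q.1) * orient (S m) (S (m + 1)) p := by
      unfold orient; ring
    have h5 : 0 ≤ ((S (m + 1)).1 - (S m).1) * orient (S (m + 1)) p q := by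
      rw [key]
      exact add_nonneg (mul_nonneg (by linarith) h2) (mul_nonneg (by linarith) hlast'.le)
    exact nonneg_of_mul_nonneg_right h5 (by simpa using h1)
  · by_cases hEq : t = t'
    · subst hEq
      have hx : q.1 = (S t).1 := le_antisymm (h.last_le q hq) hqt
      have hy := h.last_low q hq hx
      have : orient (S t) p q = (p.1 - (S t).1) * (q.2 - (S t).2) := by
        unfold orient; rw [hx]; ring
      rw [this]
      exact mul_nonneg (by linarith) (by linarith)
    -- To the right, `q` lies above the line of the last popped edge, and `p` lies on or below it,
    -- so the new edge runs below that line.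
    · have hpop' := hpop.resolve_left hEq
      have h1 := h.mono t (by omega)
      have h2 := h.supp t (by omega) q hq
      have key : ((S (t + 1)).1 - (S t).1) * orient (S t) p q
          = (p.1 - (S t).1) * orient (S t) (S (t + 1)) q
            + (q.1 - (S t).1) * (-orient (S t) (S (t + 1)) p) := by
        unfold orient; ring
      have h5 : 0 ≤ ((S (t + 1)).1 - (S t).1) * orient (S t) p q := by
        rw [key]
        exact add_nonneg (mul_nonneg (by linarith) h2) (mul_nonneg (by linarith) (by linarith))
      exact nonneg_of_mul_nonneg_right h5 (by simpa using h1)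

/-- Here `t'` is the last position before popping and `t` the one after it. `hpop` is what the last
pop found, `hlast` is why popping stopped. -/
theorem push (h : LowerChain S t' Q) (htt : t ≤ t')
    (hpop : t = t' ∨ orient (S t) (S (t + 1)) p ≤ 0)
    (hp : ∀ q ∈ Q, q.1 ≤ p.1) (hlast : t = 0 ∨ 0 < orient (S (t - 1)) (S t) p)
    (hlt : (S t).1 < p.1) :
    LowerChain (Function.update S (t + 1) p) (t + 1) (insert p Q) := by
  have hne : ∀ j ≤ t, Function.update S (t + 1) p j = S j :=
    fun j hj => Function.update_of_ne (by omega) _ _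
  have heq : Function.update S (t + 1) p (t + 1) = p := Function.update_self _ _ _
  have hs := h.supp_of_last htt hp hlast
  refine ⟨fun j hj => ?_, fun j hj => ?_, fun j hj => ?_, fun j hj q hq => ?_, ?_, ?_, ?_, ?_⟩
  · rcases eq_or_ne j (t + 1) with rfl | hj'
    · rw [heq]; exact Set.mem_insert _ _
    · rw [hne j (by omega)]; exact Set.mem_insert_of_mem _ (h.mem j (by omega))
  · rcases eq_or_ne j t with rfl | hj'
    · rw [heq, hne j le_rfl]; exact hlt
    · rw [hne j (by omega), hne (j + 1) (by omega)]; exact h.mono j (by omega)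
  · rcases eq_or_ne (j + 1) t with rfl | hj'
    · rw [heq, hne j (by omega), hne (j + 1) le_rfl]
      simpa using hlast
    · rw [hne j (by omega), hne (j + 1) (by omega), hne (j + 2) (by omega)]
      exact h.turn j (by omega)
  · rcases eq_or_ne j t with rfl | hj'
    · rw [heq, hne j le_rfl]
      rcases hq with rfl | hq
      · exact le_of_eq (by unfold orient; ring)
      · exact h.supp_new htt hpop hlast hlt hq
    · rw [hne j (by omega), hne (j + 1) (by omega)]
      rcases hq with rfl | hq
      · exact hs j (by omega)
      · exact h.supp j (by omega) q hq
  · rw [hne 0 (by omega)]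
    rintro q (rfl | hq)
    · exact (h.le_of_le (Nat.zero_le t) htt).trans hlt.le
    · exact h.first_le q hq
  · rw [hne 0 (by omega)]
    rintro q (rfl | hq) hx
    · exact absurd hx ((h.le_of_le (Nat.zero_le t) htt).trans_lt hlt).ne'
    · exact h.first_low q hq hx
  · rw [heq]
    rintro q (rfl | hq)
    · exact le_rfl
    · exact hp q hq
  · rw [heq]
    rintro q (rfl | hq) hx
    · exact le_rfl
    · have := h.supp_new htt hpop hlast hlt hq
      have e : orient (S t) p q = (p.1 - (S t).1) * (q.2 - p.2) := by
        unfold orient; rw [hx]; ring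
      rw [e] at this
      have := nonneg_of_mul_nonneg_right this (by linarith)
      linarith

/-- The new point is not left of the old last vertex, and abscissae increase strictly along the
chain. So if `p` is not right of vertex `t`, nothing was popped and `p` lies vertically above or
below that vertex. -/
theorem eq_top (h : LowerChain S t' Q) (htt : t ≤ t') (hp : ∀ q ∈ Q, q.1 ≤ p.1)
    (hge : p.1 ≤ (S t).1) : t = t' ∧ p.1 = (S t).1 := by
  have h1 := hp _ (h.mem t' le_rfl)
  have h2 := h.le_of_le htt le_rfl
  exact ⟨h.eq_of_fst_eq htt le_rfl (by linarith), le_antisymm hge (hp _ (h.mem t htt))⟩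

theorem skip (h : LowerChain S t' Q) (htt : t ≤ t') (hp : ∀ q ∈ Q, q.1 ≤ p.1)
    (hlast : t = 0 ∨ 0 < orient (S (t - 1)) (S t) p)
    (hge : p.1 ≤ (S t).1) (hy : (S t).2 ≤ p.2) : LowerChain S t (insert p Q) := by
  obtain ⟨rfl, hx⟩ := h.eq_top htt hp hge
  have hs := h.supp_of_last htt hp hlast
  refine ⟨fun j hj => Set.mem_insert_of_mem _ (h.mem j hj), h.mono, h.turn, fun j hj q hq => ?_,
    ?_, ?_, ?_, ?_⟩
  · rcases hq with rfl | hq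
    · exact hs j hj
    · exact h.supp j hj q hq
  · rintro q (rfl | hq)
    · exact (h.le_of_le (Nat.zero_le t) htt).trans hx.ge
    · exact h.first_le q hq
  · rintro q (rfl | hq) hx'
    · obtain rfl := h.eq_of_fst_eq (i := t) (j := 0) le_rfl (Nat.zero_le _) (by linarith)
      exact hy
    · exact h.first_low q hq hx'
  · rintro q (rfl | hq)
    · exact hge
    · exact h.last_le q hq
  · rintro q (rfl | hq) hx'
    · exact hy
    · exact h.last_low q hq hx'

/-- This occurs only for a chain with a single vertex: otherwise `hlast` puts `p` strictly above the
last edge, hence strictly above vertex `t`, against `hy`. -/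
theorem replace (h : LowerChain S t' Q) (htt : t ≤ t') (hp : ∀ q ∈ Q, q.1 ≤ p.1)
    (hlast : t = 0 ∨ 0 < orient (S (t - 1)) (S t) p)
    (hge : p.1 ≤ (S t).1) (hy : p.2 ≤ (S t).2) :
    LowerChain (Function.update S t p) t (insert p Q) := by
  obtain ⟨rfl, hx⟩ := h.eq_top htt hp hge
  obtain rfl : t = 0 := by
    by_contra h0
    obtain ⟨m, rfl⟩ : ∃ m, t = m + 1 := ⟨t - 1, by omega⟩
    have hlast' : 0 < orient (S m) (S (m + 1)) p := by simpa using hlast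
    have h1 := h.mono m (by omega)
    have e : orient (S m) (S (m + 1)) p
        = ((S (m + 1)).1 - (S m).1) * (p.2 - (S (m + 1)).2) := by
      unfold orient; rw [hx]; ring
    rw [e] at hlast'
    have := (mul_pos_iff_of_pos_left (sub_pos.2 h1)).1 hlast'
    linarith
  have hq : ∀ q ∈ Q, p.2 ≤ q.2 := fun q hq =>
    hy.trans (h.first_low q hq (le_antisymm (h.last_le q hq) (h.first_le q hq)))
  refine ⟨fun j hj => ?_, fun j hj => by omega, fun j hj => by omega, fun j hj => by omega,
    ?_, ?_, ?_, ?_⟩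
  · obtain rfl : j = 0 := by omega
    simp
  all_goals
    simp only [Function.update_self]
    rintro q (rfl | hqQ)
  · exact le_rfl
  · exact hx.le.trans (h.first_le q hqQ)
  · exact fun _ => le_rfl
  · exact fun _ => hq q hqQ
  · exact le_rfl
  · exact hp q hqQ
  · exact fun _ => le_rfl
  · exact fun _ => hq q hqQ

/-- A vertex lies strictly below every segment between points to both sides of it. -/
theorem orient_pos (h : LowerChain S t Q) {j : ℕ} (hj : j ≤ t) (hp : p ∈ Q) (hq : q ∈ Q)
    (hpj : p.1 < (S j).1) (hjq : (S j).1 < q.1) : 0 < orient p (S j) q := by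
  have h0 : j ≠ 0 := by
    rintro rfl
    exact absurd (h.first_le p hp) (not_le.2 hpj)
  have ht : j ≠ t := by
    rintro rfl
    exact absurd (h.last_le q hq) (not_le.2 hjq)
  obtain ⟨i, rfl⟩ : ∃ i, j = i + 1 := ⟨j - 1, by omega⟩
  have h1 := h.mono i (by omega)
  have h2 := h.mono (i + 1) (by omega)
  have h3 := h.supp i (by omega) p hp
  have h4 := h.supp (i + 1) (by omega) q hq
  have h5 := h.turn i (by omega)
  -- The heights of `q` and `p` over the two edges at the vertex enter with nonnegative sign, and
  -- the strict turn at the vertex makes the sum positive.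
  have key : (((S (i + 1)).1 - (S i).1) * ((S (i + 2)).1 - (S (i + 1)).1))
        * orient p (S (i + 1)) q
      = ((S (i + 1)).1 - (S i).1) * ((S (i + 1)).1 - p.1) * orient (S (i + 1)) (S (i + 2)) q
        + ((S (i + 2)).1 - (S (i + 1)).1) * (q.1 - (S (i + 1)).1) * orient (S i) (S (i + 1)) p
        + ((S (i + 1)).1 - p.1) * (q.1 - (S (i + 1)).1)
          * orient (S i) (S (i + 1)) (S (i + 2)) := by
    unfold orient; ring
  have d1 := sub_pos.2 h1
  have d2 := sub_pos.2 h2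
  have d3 := sub_pos.2 hpj
  have d4 := sub_pos.2 hjq
  have hpos : 0 < (((S (i + 1)).1 - (S i).1) * ((S (i + 2)).1 - (S (i + 1)).1))
      * orient p (S (i + 1)) q := by
    rw [key]; positivity
  exact (mul_pos_iff_of_pos_left (mul_pos d1 d2)).1 hpos

theorem low (h : LowerChain S t Q) {j : ℕ} (hj : j ≤ t) (hq : q ∈ Q) (hx : q.1 = (S j).1) :
    (S j).2 ≤ q.2 := by
  rcases Nat.eq_zero_or_pos j with rfl | h0
  · exact h.first_low q hq hx
  · obtain ⟨i, rfl⟩ : ∃ i, j = i + 1 := ⟨j - 1, by omega⟩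
    have h1 := h.mono i (by omega)
    have h2 := h.supp i (by omega) q hq
    have e : orient (S i) (S (i + 1)) q
        = ((S (i + 1)).1 - (S i).1) * (q.2 - (S (i + 1)).2) := by
      unfold orient; rw [hx]; ring
    rw [e] at h2
    have := nonneg_of_mul_nonneg_right h2 (by linarith)
    linarith

theorem orient_pos_of_lt (h : LowerChain S t Q) {i j k : ℕ} (hij : i < j) (hjk : j < k)
    (hk : k ≤ t) : 0 < orient (S i) (S j) (S k) :=
  h.orient_pos (by omega) (h.mem i (by omega)) (h.mem k hk) (h.lt_of_lt hij (by omega))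
    (h.lt_of_lt hjk hk)

/-- Every point lies above the chain. -/
theorem exists_below (h : LowerChain S t Q) (hq : q ∈ Q) :
    ∃ y ≤ q.2, (q.1, y) ∈ convexHull ℝ (S '' Set.Iic t) := by
  have hmem : ∀ j ≤ t, S j ∈ convexHull ℝ (S '' Set.Iic t) :=
    fun j hj => subset_convexHull ℝ _ ⟨j, hj, rfl⟩
  have main : ∀ j ≤ t, q.1 ≤ (S j).1 →
      ∃ y ≤ q.2, (q.1, y) ∈ convexHull ℝ (S '' Set.Iic t) := by
    intro j
    induction j with
    | zero =>
      intro hj hle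
      have hx : q.1 = (S 0).1 := le_antisymm hle (h.first_le q hq)
      refine ⟨(S 0).2, h.first_low q hq hx, ?_⟩
      rw [hx]
      exact hmem 0 hj
    | succ j ih =>
      intro hj hle
      rcases le_or_gt q.1 (S j).1 with hlt | hgt
      · exact ih (by omega) hlt
      · refine ⟨chordAt (S j) (S (j + 1)) q.1, ?_, chordAt_mem (convex_convexHull ℝ _)
          (hmem j (by omega)) (hmem (j + 1) hj) hgt.le hle⟩
        have h1 := sub_pos.2 (h.mono j (by omega))
        have h2 := h.supp j (by omega) q hq
        unfold orient at h2
        have : ((S (j + 1)).2 - (S j).2) * (q.1 - (S j).1) / ((S (j + 1)).1 - (S j).1)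
            ≤ q.2 - (S j).2 := by
          rw [div_le_iff₀ h1]
          linarith
        unfold chordAt
        linarith
  exact main t le_rfl (h.last_le q hq)

end LowerChain

/-! ### The convex polygon of two chains -/

section TwoChains

variable {S U : ℕ → ℝ × ℝ} {s t : ℕ} {Q : Set (ℝ × ℝ)}

/-- The upper chain of `Q` is the negated lower chain of `-Q`. If the upper vertex lies outside the
vertical strip of the two lower ones, strict convexity of the lower chain applies; strictly inside,
that of the upper chain. On the boundary of the strip it lies above a lower vertex, strictly since
the two differ. -/
theorem LowerChain.orient_pos_upper (h : LowerChain S s Q) (h' : LowerChain U t (-Q))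
    {i j k : ℕ} (hij : i < j) (hj : j ≤ s) (hk : k ≤ t) (hi' : S i ≠ -U k) (hj' : S j ≠ -U k) :
    0 < orient (S i) (S j) (-U k) := by
  have hu : -U k ∈ Q := h'.mem k hk
  have hx := h.lt_of_lt hij hj
  have hSi := h.mem i (by omega)
  have hSj := h.mem j hj
  rcases lt_trichotomy (-U k).1 (S i).1 with h1 | h1 | h1
  · rw [← orient_rotate]
    exact h.orient_pos (by omega) hu hSj h1 hx
  · have h2 := h.low (by omega) hu h1
    have h3 : (S i).2 < (-U k).2 := lt_of_le_of_ne h2 fun he => hi' (Prod.ext h1.symm he)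
    have e : orient (S i) (S j) (-U k) = ((S j).1 - (S i).1) * ((-U k).2 - (S i).2) := by
      unfold orient; rw [h1]; ring
    rw [e]
    exact mul_pos (by linarith) (by linarith)
  rcases lt_trichotomy (-U k).1 (S j).1 with h4 | h4 | h4
  · have h5 := h'.orient_pos (p := -S j) (q := -S i) hk (by simpa using hSj) (by simpa using hSi)
      (by simp only [Prod.fst_neg] at *; linarith) (by simp only [Prod.fst_neg] at *; linarith)
    rw [← orient_neg] at h5
    simp only [neg_neg] at h5
    rwa [orient_rotate, orient_rotate] at h5
  · have h2 := h.low hj hu h4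
    have h3 : (S j).2 < (-U k).2 := lt_of_le_of_ne h2 fun he => hj' (Prod.ext h4.symm he)
    have e : orient (S i) (S j) (-U k) = ((S j).1 - (S i).1) * ((-U k).2 - (S j).2) := by
      unfold orient; rw [h4]; ring
    rw [e]
    exact mul_pos (by linarith) (by linarith)
  · exact h.orient_pos hj hSi hu hx h4

/-- The chains can meet only at their ends: a common inner vertex would lie both strictly below and
strictly above the segment from `S 0` to `S s`. -/
theorem LowerChain.eq_neg_cases (h : LowerChain S s Q) (h' : LowerChain U t (-Q))
    {i k : ℕ} (hi : i ≤ s) (hk : k ≤ t) (he : S i = -U k) :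
    (i = 0 ∧ k = t) ∨ (i = s ∧ k = 0) := by
  have h0 : ∀ j ≤ s, -S j ∈ -Q := fun j hj => by simpa using h.mem j hj
  have h0' : ∀ j ≤ t, -U j ∈ Q := fun j hj => h'.mem j hj
  have hUk : U k = -S i := by rw [he, neg_neg]
  rcases (h.le_of_le (Nat.zero_le i) hi).eq_or_lt with h1 | h1
  · refine Or.inl ⟨(h.eq_of_fst_eq (Nat.zero_le _) hi h1).symm, h'.eq_of_fst_eq hk le_rfl ?_⟩
    refine le_antisymm (h'.le_of_le hk le_rfl) ?_
    have := h.first_le _ (h0' t le_rfl)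
    rw [hUk]
    simp only [Prod.fst_neg] at *
    linarith
  rcases (h.le_of_le hi le_rfl).eq_or_lt with h2 | h2
  · refine Or.inr ⟨h.eq_of_fst_eq hi le_rfl h2, h'.eq_of_fst_eq hk (Nat.zero_le _) ?_⟩
    refine le_antisymm ?_ (h'.le_of_le (Nat.zero_le _) hk)
    have := h.last_le _ (h0' 0 (Nat.zero_le _))
    rw [hUk]
    simp only [Prod.fst_neg] at *
    linarith
  · exfalso
    have h3 := h.orient_pos hi (h.mem 0 (Nat.zero_le _)) (h.mem s le_rfl) h1 h2
    have h4 := h'.orient_pos hk (h0 s le_rfl) (h0 0 (Nat.zero_le _))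
      (by rw [hUk]; simpa using h2) (by rw [hUk]; simpa using h1)
    rw [hUk, orient_neg, orient_swap, orient_rotate] at h4
    have : orient (S 0) (S i) (S s) = orient (S i) (S s) (S 0) := orient_rotate _ _ _
    rw [this, orient_rotate] at h3
    linarith

/-- The polygon that consists of a lower chain and an upper chain, with common ends listed once. -/
structure JoinedChains (S U : ℕ → ℝ × ℝ) (s t a b M : ℕ) (v : ℕ → ℝ × ℝ) : Prop where
  left : ∀ i ≤ s, v i = S i
  right : ∀ i, s < i → i < M → v i = -U (i - (s + 1) + a)
  -- `a` and `b` count the vertices dropped at the two ends of `U`. If all points coincide,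
  -- truncated subtraction gives the correct `M = 1`.
  size : M = s + 1 + (t + 1 - b - a)
  a_cases : (a = 0 ∧ S s ≠ -U 0) ∨ (a = 1 ∧ S s = -U 0)
  b_cases : (b = 0 ∧ S 0 ≠ -U t) ∨ (b = 1 ∧ S 0 = -U t)

/-- The cases are distinguished by the number of corners on the lower chain. Two corners on the
upper chain reduce to two on the lower one by the point reflection that exchanges the chains. -/
theorem JoinedChains.orient_pos {a b M : ℕ} {v : ℕ → ℝ × ℝ} (hv : JoinedChains S U s t a b M v)
    (h : LowerChain S s Q) (h' : LowerChain U t (-Q)) {i j k : ℕ} (hij : i < j) (hjk : j < k)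
    (hk : k < M) : 0 < orient (v i) (v j) (v k) := by
  have hM := hv.size
  have ha : a = 0 ∧ S s ≠ -U 0 ∨ a = 1 := hv.a_cases.imp id And.left
  have hb : b = 0 ∧ S 0 ≠ -U t ∨ b = 1 := hv.b_cases.imp id And.left
  have hne : ∀ x ≤ s, ∀ y, s < y → y < M → S x ≠ -U (y - (s + 1) + a) := by
    intro x hx y hy hyM he
    rcases h.eq_neg_cases h' hx (by omega) he with ⟨rfl, hyt⟩ | ⟨rfl, hyt⟩
    · rcases hb with ⟨-, hb⟩ | hb
      · exact hb (hyt ▸ he)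
      · omega
    · rcases ha with ⟨-, ha⟩ | ha
      · exact ha (hyt ▸ he)
      · omega
  have hQ : - -Q = Q := neg_neg Q
  by_cases hks : k ≤ s
  · rw [hv.left i (by omega), hv.left j (by omega), hv.left k hks]
    exact h.orient_pos_of_lt hij hjk hks
  by_cases hjs : j ≤ s
  · rw [hv.left i (by omega), hv.left j hjs, hv.right k (by omega) hk]
    exact h.orient_pos_upper h' hij hjs (by omega) (hne i (by omega) k (by omega) hk)
      (hne j hjs k (by omega) hk)
  by_cases his : i ≤ s
  · rw [hv.left i his, hv.right j (by omega) (by omega), hv.right k (by omega) hk,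
      orient_rotate, ← orient_neg, neg_neg, neg_neg]
    refine h'.orient_pos_upper (S := U) (U := S) (by rwa [hQ]) (by omega) (by omega) his ?_ ?_
    · intro he
      exact hne i his j (by omega) (by omega) (by rw [he, neg_neg])
    · intro he
      exact hne i his k (by omega) hk (by rw [he, neg_neg])
  · rw [hv.right i (by omega) (by omega), hv.right j (by omega) (by omega),
      hv.right k (by omega) hk, orient_neg]
    exact h'.orient_pos_of_lt (by omega) (by omega) (by omega)

/-- Every point lies vertically between the two chains, and the dropped ends of the upper chain are
still present as ends of the lower one. -/
theorem JoinedChains.subset_convexHull {a b M : ℕ} {v : ℕ → ℝ × ℝ}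
    (hv : JoinedChains S U s t a b M v) (h : LowerChain S s Q) (h' : LowerChain U t (-Q)) :
    Q ⊆ convexHull ℝ (v '' Set.Iio M) := by
  have hM := hv.size
  have hS : S '' Set.Iic s ⊆ v '' Set.Iio M := by
    rintro _ ⟨j, hj, rfl⟩
    simp only [Set.mem_Iic] at hj
    exact ⟨j, by simp only [Set.mem_Iio]; omega, hv.left j hj⟩
  have hU : -(U '' Set.Iic t) ⊆ v '' Set.Iio M := by
    rintro z ⟨k, hk, hz⟩
    simp only [Set.mem_Iic] at hk
    obtain rfl : z = -U k := by rw [hz, neg_neg]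
    by_cases hka : k < a
    · rcases hv.a_cases with ⟨h0, -⟩ | ⟨h1, he⟩
      · omega
      · obtain rfl : k = 0 := by omega
        exact hS ⟨s, Set.mem_Iic.2 le_rfl, he⟩
    by_cases hkb : t < k + b
    · rcases hv.b_cases with ⟨h0, -⟩ | ⟨h1, he⟩
      · omega
      · obtain rfl : k = t := by omega
        exact hS ⟨0, Nat.zero_le _, he⟩
    refine ⟨k - a + (s + 1), by simp only [Set.mem_Iio]; omega, ?_⟩
    rw [hv.right _ (by omega) (by omega)]
    congr 2
    omega
  intro q hq
  obtain ⟨y, hy, hy'⟩ := h.exists_below hq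
  obtain ⟨z, hz, hz'⟩ := h'.exists_below (q := -q) (by simpa using hq)
  have hz'' : (q.1, -z) ∈ convexHull ℝ (v '' Set.Iio M) := by
    refine convexHull_mono hU ?_
    rw [convexHull_neg]
    simpa using hz'
  exact mem_of_vertical (convex_convexHull ℝ _) (convexHull_mono hS hy') hz'' hy
    (by simp only [Prod.snd_neg] at hz; linarith)

end TwoChains

/-! ### The convex hull program

Index registers: `0` the number of points, `5` the number of points treated, `7` the position of
the last vertex, `8` the point under consideration. -/

/-- The point with number `i`, for coordinates in the real arrays `xa` and `ya`. -/
def vertex (s : RamState) (xa ya i : ℕ) : ℝ × ℝ := (s.rarr xa i, s.rarr ya i)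

/-- The expression for `orient`, for coordinates in the real arrays `xa` and `ya`. -/
def RExp.orient (xa ya : ℕ) (e f g : NExp) : RExp :=
  .sub (.mul (.sub (.get xa f) (.get xa e)) (.sub (.get ya g) (.get ya e)))
    (.mul (.sub (.get xa g) (.get xa e)) (.sub (.get ya f) (.get ya e)))

theorem RExp.eval_orient (s : RamState) (xa ya : ℕ) (e f g : NExp) :
    (RExp.orient xa ya e f g).eval s = _root_.orient (vertex s xa ya (e.eval s))
      (vertex s xa ya (f.eval s)) (vertex s xa ya (g.eval s)) := rfl

theorem RExp.cost_orient (xa ya : ℕ) (e f g : NExp) :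
    (RExp.orient xa ya e f g).cost = 4 * e.cost + 2 * f.cost + 2 * g.cost + 15 := by
  simp only [RExp.orient, RExp.cost]; omega

/-- Removing the vertices that are not vertices of the hull with the new point. -/
def popLoop (xa ya d : ℕ) : Prog :=
  .loop (.and (.nlt (.const 0) (.reg 7)) (.neg (.rlt (.const 0)
      (.orient xa ya (.get d (.sub (.reg 7) (.const 1))) (.get d (.reg 7)) (.reg 8)))))
    (.setN 7 (.sub (.reg 7) (.const 1)))

/-- Treating one more point. -/
def chainRound (xa ya d : ℕ) (idx : NExp) : Prog :=
  .block [
    .setN 8 idx,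
    popLoop xa ya d,
    .ite (.rlt (.get xa (.get d (.reg 7))) (.get xa (.reg 8)))
      (.block [.setN 7 (.succ 7), .putN d (.reg 7) (.reg 8)])
      (.ite (.rlt (.get ya (.reg 8)) (.get ya (.get d (.reg 7))))
        (.putN d (.reg 7) (.reg 8))
        .skip),
    .setN 5 (.succ 5)]

/-- The lower hull of the points that `idx` lists by increasing abscissa. -/
def chainScan (xa ya d : ℕ) (idx : NExp) : Prog :=
  .block [
    -- `idx` reads register `5`, so this selects the first point.
    .setN 5 (.const 0),
    .putN d (.const 0) idx,
    .setN 7 (.const 0),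
    .setN 5 (.const 1),
    .loop (.nlt (.reg 5) (.reg 0)) (chainRound xa ya d idx)]

/-- The loop rule with a bound `K` on the cost of a round, for a counter `μ`. -/
theorem wp_loop_amortized {b : BExp} {c : Prog} (I : RamState → Prop) (μ : RamState → ℕ) (K : ℕ)
    (hK : b.cost + 1 ≤ K)
    (hstep : ∀ s, I s → b.Holds s →
      wp c s fun t s' => I s' ∧ μ s' + 1 ≤ μ s ∧ b.cost + 1 + t ≤ K)
    {s : RamState} (h : I s) :
    wp (Prog.loop b c) s fun t s' => t + K * μ s' ≤ K * μ s + K ∧ I s' ∧ ¬ b.Holds s' := by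
  induction hm : μ s using Nat.strong_induction_on generalizing s with
  | _ m ih =>
    subst hm
    by_cases hb : b.Holds s
    · obtain ⟨t, s', hr, hI, hμ, ht⟩ := hstep s h hb
      obtain ⟨t', s'', hr', ht', hQ⟩ := ih (μ s') (by omega) hI rfl
      refine ⟨_, _, Runs.loop_true hb hr hr', ?_, hQ⟩
      have := Nat.mul_le_mul_left K hμ
      rw [Nat.mul_add, Nat.mul_one] at this
      omega
    · exact ⟨_, _, Runs.loop_false hb, by omega, h, hb⟩

/-- Popping only lowers register `7`, so the cell after the new top still holds the last popped
vertex. The cost bound has the stack height as potential. -/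
theorem wp_popLoop (xa ya d : ℕ) (s : RamState) :
    wp (popLoop xa ya d) s fun t s' => t + 80 * s'.nreg 7 ≤ 80 * s.nreg 7 + 80 ∧
      s'.nreg 7 ≤ s.nreg 7 ∧
      (s'.nreg 7 = s.nreg 7 ∨ orient (vertex s xa ya (s.narr d (s'.nreg 7)))
        (vertex s xa ya (s.narr d (s'.nreg 7 + 1))) (vertex s xa ya (s.nreg 8)) ≤ 0) ∧
      (s'.nreg 7 = 0 ∨ 0 < orient (vertex s xa ya (s.narr d (s'.nreg 7 - 1)))
        (vertex s xa ya (s.narr d (s'.nreg 7))) (vertex s xa ya (s.nreg 8))) := by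
  refine (wp_loop_amortized (fun s' => s'.narr d = s.narr d ∧ s'.rarr = s.rarr ∧
    s'.nreg 8 = s.nreg 8 ∧ s'.nreg 7 ≤ s.nreg 7 ∧
      (s'.nreg 7 = s.nreg 7 ∨ orient (vertex s xa ya (s.narr d (s'.nreg 7)))
        (vertex s xa ya (s.narr d (s'.nreg 7 + 1))) (vertex s xa ya (s.nreg 8)) ≤ 0))
    (fun s' => s'.nreg 7) 80 ?_ ?_ ⟨rfl, rfl, rfl, le_rfl, Or.inl rfl⟩).mono ?_
  · simp [BExp.cost, NExp.cost, RExp.cost, RExp.cost_orient]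
  · rintro s' ⟨hn, hr, h8, hle, -⟩ hb
    simp only [BExp.Holds, NExp.eval, RExp.eval, RExp.eval_orient, vertex, hn, hr, h8,
      Rat.cast_zero] at hb
    simp only [wp_setN, NExp.eval, NExp.cost, BExp.cost, RExp.cost, RExp.cost_orient]
    refine ⟨⟨hn, hr, by simp [h8], by simp; omega, Or.inr ?_⟩, by simp; omega, by omega⟩
    have : s'.nreg 7 - 1 + 1 = s'.nreg 7 := by omega
    simp only [Function.update_self, this]
    exact not_lt.1 hb.2
  · rintro t s' ⟨ht, ⟨hn, hr, h8, hle, hpop⟩, hb⟩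
    refine ⟨ht, hle, hpop, ?_⟩
    simp only [BExp.Holds, NExp.eval, RExp.eval, RExp.eval_orient, vertex, hn, hr, h8,
      Rat.cast_zero, not_and, not_not] at hb
    rcases Nat.eq_zero_or_pos (s'.nreg 7) with h0 | h0
    · exact Or.inl h0
    · exact Or.inr (hb h0)

/-- A round can pop many vertices but pushes at most one, so its amortized cost is constant. The
predicate `P` tracks a property of the listed indices, such as being in range. -/
theorem wp_chainRound {xa ya d : ℕ} {idx : NExp} (hcost : idx.cost ≤ 10) {P : ℕ → Prop}
    {Q : Set (ℝ × ℝ)} {s : RamState}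
    (h : LowerChain (fun j => vertex s xa ya (s.narr d j)) (s.nreg 7) Q)
    (hp : ∀ q ∈ Q, q.1 ≤ (vertex s xa ya (idx.eval s)).1)
    (hP : ∀ j ≤ s.nreg 7, P (s.narr d j)) (hPi : P (idx.eval s)) :
    wp (chainRound xa ya d idx) s fun t s' => t + 80 * s'.nreg 7 ≤ 80 * s.nreg 7 + 200 ∧
      s'.nreg 5 = s.nreg 5 + 1 ∧ s'.nreg 7 ≤ s.nreg 7 + 1 ∧
      LowerChain (fun j => vertex s xa ya (s'.narr d j)) (s'.nreg 7)
        (insert (vertex s xa ya (idx.eval s)) Q) ∧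
      ∀ j ≤ s'.nreg 7, P (s'.narr d j) := by
  simp only [chainRound, wp_block_cons, wp_block_one]
  rw [wp_setN]
  set i := idx.eval s with hi
  refine (wp_popLoop xa ya d _).frame.mono ?_
  rintro t s' ⟨⟨ht, hle, hpop, hlast⟩, hf⟩
  have hn : s'.narr d = s.narr d := hf.narr d (by simp [popLoop, Prog.narrs])
  have hr : s'.rarr = s.rarr := funext fun a => hf.rarr a (by simp [popLoop, Prog.rarrs])
  have h8 : s'.nreg 8 = i := by rw [hf.nreg 8 (by simp [popLoop, Prog.nregs])]; simp
  have h5 : s'.nreg 5 = s.nreg 5 := by rw [hf.nreg 5 (by simp [popLoop, Prog.nregs])]; simp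
  have hupd : ∀ k, (fun j => vertex s xa ya (Function.update (s.narr d) k i j)) =
      Function.update (fun j => vertex s xa ya (s.narr d j)) k (vertex s xa ya i) := by
    intro k
    funext j
    rcases eq_or_ne j k with rfl | hj
    · simp
    · simp [hj]
  have hPu : ∀ k j, j ≤ s.nreg 7 ∨ j = k → P (Function.update (s.narr d) k i j) := by
    intro k j hj
    rcases eq_or_ne j k with rfl | hjk
    · simpa using hPi
    · simpa [hjk] using hP j (by omega)
  have e7 : (7 : ℕ) ≠ 8 := by decide
  simp only [Function.update_of_ne e7, Function.update_self] at ht hle hpop hlast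
  replace hpop : s'.nreg 7 = s.nreg 7 ∨ orient (vertex s xa ya (s.narr d (s'.nreg 7)))
    (vertex s xa ya (s.narr d (s'.nreg 7 + 1))) (vertex s xa ya i) ≤ 0 := hpop
  replace hlast : s'.nreg 7 = 0 ∨ 0 < orient (vertex s xa ya (s.narr d (s'.nreg 7 - 1)))
    (vertex s xa ya (s.narr d (s'.nreg 7))) (vertex s xa ya i) := hlast
  simp only [wp_block_cons, wp_block_one, wp_ite, wp_putN, wp_setN, wp_skip, NExp.eval,
    BExp.Holds, RExp.eval, NExp.cost, BExp.cost, RExp.cost, NExp.eval_succ, NExp.cost_succ, hn,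
    hr, h8]
  refine ⟨fun hb => ?_, fun hb => ⟨fun hb' => ?_, fun hb' => ?_⟩⟩
  · have := h.push hle hpop hp hlast hb
    rw [← hupd] at this
    refine ⟨by simp; omega, by simp [h5], by simp; omega, by simpa [h8] using this, ?_⟩
    intro j hj
    simp [h8] at hj ⊢
    exact hPu _ j (by omega)
  · have := h.replace hle hp hlast (not_lt.1 hb) hb'.le
    rw [← hupd] at this
    refine ⟨by simp; omega, by simp [h5], by simp; omega, by simpa using this, ?_⟩
    intro j hj
    simp at hj ⊢
    exact hPu _ j (by omega)
  · have := h.skip hle hp hlast (not_lt.1 hb) (not_lt.1 hb')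
    refine ⟨by simp; omega, by simp [h5], by simp; omega, by simpa [hn] using this, ?_⟩
    intro j hj
    simp at hj ⊢
    exact hP j (by omega)

theorem image_Iio_succ {α : Type*} (f : ℕ → α) (n : ℕ) :
    f '' Set.Iio (n + 1) = insert (f n) (f '' Set.Iio n) := by
  rw [← Set.image_insert_eq]
  congr 1
  ext x
  simp only [Set.mem_Iio, Set.mem_insert_iff]
  omega

/-- The hull program finds the lower hull of the listed points. -/
theorem wp_chainScan {xa ya d : ℕ} {idx : NExp} (hd : d ≠ 0) (hcost : idx.cost ≤ 10) {f : ℕ → ℕ}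
    {s : RamState} (hs : 0 < s.nreg 0)
    (hidx : ∀ s', s'.nreg 0 = s.nreg 0 → s'.narr 0 = s.narr 0 → idx.eval s' = f (s'.nreg 5))
    (hmono : ∀ i j, i ≤ j → j < s.nreg 0 →
      (vertex s xa ya (f i)).1 ≤ (vertex s xa ya (f j)).1) {P : ℕ → Prop}
    (hP : ∀ i < s.nreg 0, P (f i)) :
    wp (chainScan xa ya d idx) s fun t s' => t ≤ 300 * s.nreg 0 + 50 ∧
      s'.nreg 7 < s.nreg 0 ∧
      LowerChain (fun j => vertex s xa ya (s'.narr d j)) (s'.nreg 7)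
        ((fun i => vertex s xa ya (f i)) '' Set.Iio (s.nreg 0)) ∧
      ∀ j ≤ s'.nreg 7, P (s'.narr d j) := by
  have hloop := @wp_loop (.nlt (.reg 5) (.reg 0)) (chainRound xa ya d idx)
    (fun s' => s'.nreg 7 < s.nreg 0 ∧
      LowerChain (fun j => vertex s xa ya (s'.narr d j)) (s'.nreg 7)
        ((fun i => vertex s xa ya (f i)) '' Set.Iio (s.nreg 0)) ∧
      ∀ j ≤ s'.nreg 7, P (s'.narr d j))
    (fun c s' => s'.nreg 0 = s.nreg 0 ∧ s'.narr 0 = s.narr 0 ∧ s'.rarr = s.rarr ∧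
      s'.nreg 5 ≤ s.nreg 0 ∧ s'.nreg 7 < s'.nreg 5 ∧
      LowerChain (fun j => vertex s xa ya (s'.narr d j)) (s'.nreg 7)
        ((fun i => vertex s xa ya (f i)) '' Set.Iio (s'.nreg 5)) ∧
      (∀ j ≤ s'.nreg 7, P (s'.narr d j)) ∧
      -- Amortized 200 per point, 4 for each loop test, and 80 of potential for each vertex on the
      -- stack.
      c = 204 * (s.nreg 0 - s'.nreg 5) + 80 * s'.nreg 7 + 4) ?_ ?_
  · simp only [chainScan, wp_block_cons, wp_block_one]
    have h1 : idx.eval { s with nreg := Function.update s.nreg 5 0 } = f 0 := by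
      rw [hidx { s with nreg := Function.update s.nreg 5 0 } (by simp) rfl]
      simp
    rw [wp_setN, wp_putN, wp_setN, wp_setN]
    refine (hloop (d := 204 * (s.nreg 0 - 1) + 4) ?_).mono ?_
    refine ⟨by simp, by simp [hd.symm], rfl, by simp [NExp.eval]; omega, by simp [NExp.eval],
      ?_, ?_, by simp [NExp.eval]⟩
    · have h2 : (fun i => vertex s xa ya (f i)) '' Set.Iio 1 = {vertex s xa ya (f 0)} := by
        rw [image_Iio_succ]
        simp
      have := LowerChain.singleton (fun _ => vertex s xa ya (f 0))
      simp only [NExp.eval, Function.update_self]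
      rw [h1, h2]
      simpa using this.congr (U := fun j => vertex s xa ya (Function.update (s.narr d) 0 (f 0) j))
        (fun j hj => by
          obtain rfl : j = 0 := by omega
          simp)
    · intro j hj
      simp [NExp.eval] at hj
      obtain rfl : j = 0 := by omega
      simp only [NExp.eval, h1, Function.update_self]
      exact hP 0 hs
    · rintro t s' ⟨ht, hQ⟩
      refine ⟨?_, hQ⟩
      simp only [NExp.cost] at ht ⊢
      omega
  · rintro c s' ⟨h0, hn, hr, hle, hlt, hC, hPj, rfl⟩ hb
    simp only [BExp.Holds, NExp.eval] at hb
    have h5 : s'.nreg 5 = s.nreg 0 := by omega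
    rw [h5] at hC
    exact ⟨by simp only [BExp.cost, NExp.cost]; omega, by omega, hC, hPj⟩
  · rintro c s' ⟨h0, hn, hr, hle, hlt, hC, hPj, rfl⟩ hb
    simp only [BExp.Holds, NExp.eval] at hb
    have hv : ∀ i, vertex s xa ya i = vertex s' xa ya i := by
      intro i; simp only [vertex, hr]
    have hi := hidx s' h0 hn
    simp only [hv] at hC hmono
    refine (wp_chainRound (P := P) hcost hC ?_ hPj (hi ▸ hP _ (by omega))).frame.mono ?_
    · rintro _ ⟨i, hi', rfl⟩
      simp only [Set.mem_Iio] at hi'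
      rw [hi]
      exact hmono i _ hi'.le (by omega)
    · rintro t s'' ⟨⟨ht, h5, h7, hC', hPj'⟩, hf⟩
      rw [hi] at hC'
      refine ⟨_, ⟨(hf.nreg 0 ?_).trans h0, (hf.narr 0 ?_).trans hn,
        (funext fun a => hf.rarr a ?_).trans hr, by omega, by omega, ?_, hPj', rfl⟩, ?_⟩
      · simp [chainRound, popLoop, Prog.block, Prog.nregs]
      · simpa [chainRound, popLoop, Prog.block, Prog.narrs] using hd.symm
      · simp [chainRound, popLoop, Prog.block, Prog.rarrs]
      · rw [h5, image_Iio_succ]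
        simpa only [hv] using hC'
      · simp only [BExp.cost, NExp.cost]
        omega

/-! ### Heights in convex quadrilaterals -/

section Quadrilateral

variable {a b q x y z : ℝ × ℝ}

theorem orient_self_left (p r : ℝ × ℝ) : orient p p r = 0 := by unfold orient; ring

theorem orient_self_right (p r : ℝ × ℝ) : orient p r r = 0 := by unfold orient; ring

theorem orient_self_outer (p r : ℝ × ℝ) : orient p r p = 0 := by unfold orient; ring

/-- Along a convex quadrilateral `q x y z`, the height over a line through `q` does not increase
after it has stopped increasing. -/
theorem height_descends (h1 : 0 < orient q x y) (h2 : 0 ≤ orient x y z) (h3 : 0 ≤ orient q y z)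
    (hq : orient a b q = 0) (hy : 0 ≤ orient a b y) (hxy : orient a b y ≤ orient a b x) :
    orient a b z ≤ orient a b y := by
  -- Heights are affine, and `z` is an affine combination of `q`, `x`, `y` whose coefficients are
  -- ratios of areas.
  have key : orient q x y * (orient a b y - orient a b z)
      = orient q y z * (orient a b x - orient a b y)
        + orient x y z * (orient a b y - orient a b q) := by
    unfold orient; ring
  have : 0 ≤ orient q x y * (orient a b y - orient a b z) := by
    rw [key, hq, sub_zero]
    exact add_nonneg (mul_nonneg h3 (by linarith)) (mul_nonneg h2 hy)
  have := nonneg_of_mul_nonneg_right this h1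
  linarith

/-- The mirror image of `height_descends`, for the quadrilateral `x y z q`. -/
theorem height_ascends (h1 : 0 < orient y z q) (h2 : 0 ≤ orient x y z) (h3 : 0 ≤ orient x y q)
    (hq : orient a b q = 0) (hy : 0 ≤ orient a b y) (hyz : orient a b y ≤ orient a b z) :
    orient a b x ≤ orient a b y := by
  have key : orient y z q * (orient a b y - orient a b x)
      = orient x y q * (orient a b z - orient a b y)
        + orient x y z * (orient a b y - orient a b q) := by
    unfold orient; ring
  have : 0 ≤ orient y z q * (orient a b y - orient a b x) := by
    rw [key, hq, sub_zero]
    exact add_nonneg (mul_nonneg h3 (by linarith)) (mul_nonneg h2 hy)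
  have := nonneg_of_mul_nonneg_right this h1
  linarith

/-- The corner `y` lies beyond the diagonal `x z` as seen from `q`. Both ends of the diagonal have
height at least `m` and `q` has height `0 ≤ m`, so moving away from `q` does not lead below `m`. -/
theorem height_between {m : ℝ} (h1 : 0 < orient q x z) (h2 : 0 ≤ orient x y z)
    (h3 : 0 ≤ orient q y z) (h4 : 0 ≤ orient q x y) (hq : orient a b q = 0) (hm : 0 ≤ m)
    (hx : m ≤ orient a b x) (hz : m ≤ orient a b z) : m ≤ orient a b y := by
  have key : orient q x z * (orient a b y - m) = orient q y z * (orient a b x - m)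
      + orient q x y * (orient a b z - m) + orient x y z * (m - orient a b q) := by
    unfold orient; ring
  have : 0 ≤ orient q x z * (orient a b y - m) := by
    rw [key, hq, sub_zero]
    exact add_nonneg (add_nonneg (mul_nonneg h3 (by linarith)) (mul_nonneg h4 (by linarith)))
      (mul_nonneg h2 hm)
  have := nonneg_of_mul_nonneg_right this h1
  linarith

end Quadrilateral

/-! ### Largest triangles with a given first corner -/

/-- The points `v 0, …, v (M - 1)` are the corners of a convex polygon, in counterclockwise
order. -/
def StrictPolygon (v : ℕ → ℝ × ℝ) (M : ℕ) : Prop :=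
  ∀ i j k, i < j → j < k → k < M → 0 < orient (v i) (v j) (v k)

section Polygon

variable {v : ℕ → ℝ × ℝ} {M : ℕ}

theorem StrictPolygon.nonneg (hv : StrictPolygon v M) {i j k : ℕ} (hij : i ≤ j) (hjk : j ≤ k)
    (hk : k < M) : 0 ≤ orient (v i) (v j) (v k) := by
  rcases hij.eq_or_lt with rfl | hij
  · rw [orient_self_left]
  rcases hjk.eq_or_lt with rfl | hjk
  · rw [orient_self_right]
  exact (hv i j k hij hjk hk).le

theorem StrictPolygon.nonneg' (hv : StrictPolygon v M) {i j k : ℕ} (hij : i ≤ j) (hjk : j ≤ k)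
    (hk : k < M) : 0 ≤ orient (v j) (v k) (v i) := by
  rw [← orient_rotate]
  exact hv.nonneg hij hjk hk

theorem StrictPolygon.nonneg'' (hv : StrictPolygon v M) {i j k : ℕ} (hij : i ≤ j) (hjk : j ≤ k)
    (hk : k < M) : 0 ≤ orient (v k) (v i) (v j) := by
  rw [orient_rotate]
  exact hv.nonneg hij hjk hk

theorem lt_of_orient_pos {i j k : ℕ} (hij : i ≤ j) (hjk : j ≤ k)
    (h : 0 < orient (v i) (v j) (v k)) : i < j ∧ j < k := by
  refine ⟨lt_of_le_of_ne hij ?_, lt_of_le_of_ne hjk ?_⟩ <;> rintro rfl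
  · rw [orient_self_left] at h
    exact lt_irrefl _ h
  · rw [orient_self_right] at h
    exact lt_irrefl _ h

/-- If `v a₁ v b₁ v c₁` is a largest triangle with first corner `v a₁`, then the largest triangles
with a later first corner have later second and third corners. -/
theorem StrictPolygon.le_max (hv : StrictPolygon v M) {a₁ b₁ c₁ a b c : ℕ} (hab₁ : a₁ ≤ b₁)
    (hbc₁ : b₁ ≤ c₁) (hc₁ : c₁ < M) (hpos : 0 < orient (v a₁) (v b₁) (v c₁))
    (hopt : ∀ b c, a₁ ≤ b → b ≤ c → c < M →
      orient (v a₁) (v b) (v c) ≤ orient (v a₁) (v b₁) (v c₁))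
    (haa : a₁ < a) (hab : a ≤ b) (hbc : b ≤ c) (hc : c < M) :
    orient (v a) (v b) (v c) ≤ orient (v a) (v (max b₁ b)) (v (max c₁ c)) := by
  -- Moving one corner changes the area by the difference of the heights of the two others over the
  -- line of the motion.
  have hd : ∀ (p : ℝ × ℝ) (r : ℝ × ℝ), orient p (v b₁) r - orient p (v b) r
      = orient (v b) (v b₁) r - orient (v b) (v b₁) p := by
    intro p r; unfold orient; ring
  have he : ∀ (p : ℝ × ℝ) (r : ℝ × ℝ), orient p r (v c₁) - orient p r (v c)
      = orient (v c) (v c₁) p - orient (v c) (v c₁) r := by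
    intro p r; unfold orient; ring
  have hposb : 0 < orient (v b₁) (v c₁) (v a₁) := by rwa [← orient_rotate]
  have hposc : 0 < orient (v c₁) (v a₁) (v b₁) := by rwa [orient_rotate]
  rcases le_or_gt b₁ b with hb | hb <;> rcases le_or_gt c₁ c with hcc | hcc
  · rw [max_eq_right hb, max_eq_right hcc]
  · rw [max_eq_right hb, max_eq_left hcc.le]
    have h1 := hopt b₁ c hab₁ (by omega) hc
    have h2 := he (v a₁) (v b₁)
    -- By `he` only heights over the line from `v c` to `v c₁` matter. Optimality at `a₁` gives `v
    -- b₁` at most the height of `v a₁`, and by convexity heights do not increase afterwards; `v a`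
    -- comes before `v b` in this order.
    suffices h : orient (v c) (v c₁) (v b) ≤ orient (v c) (v c₁) (v a) by
      have := he (v a) (v b)
      linarith
    have hq : orient (v c) (v c₁) (v c₁) = 0 := orient_self_right _ _
    have hb₁ : 0 ≤ orient (v c) (v c₁) (v b₁) := hv.nonneg' (by omega) hcc.le hc₁
    rcases le_or_gt a b₁ with hab' | hab'
    · have h3 := height_between (y := v a) hposc (hv.nonneg haa.le hab' (by omega))
        (hv.nonneg'' hab' (by omega) hc₁) (hv.nonneg'' haa.le (by omega) hc₁) hq hb₁
        (by linarith) le_rfl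
      have h4 := height_descends (z := v b) hposc (hv.nonneg hab₁ hb (by omega))
        (hv.nonneg'' hb (by omega) hc₁) hq hb₁ (by linarith)
      linarith
    · have h3 := height_descends (z := v a) hposc (hv.nonneg hab₁ hab'.le (by omega))
        (hv.nonneg'' hab'.le (by omega) hc₁) hq hb₁ (by linarith)
      refine height_descends (q := v c₁) (x := v a₁) ?_ (hv.nonneg haa.le hab (by omega))
        (hv.nonneg'' hab (by omega) hc₁) hq (hv.nonneg' (by omega) hcc.le hc₁) (by linarith)
      rw [orient_rotate]
      exact hv _ _ _ haa (by omega) hc₁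
  · rw [max_eq_left hb.le, max_eq_right hcc]
    have h1 := hopt b c₁ (by omega) (by omega) hc₁
    have h2 := hd (v a₁) (v c₁)
    have hq : orient (v b) (v b₁) (v b₁) = 0 := orient_self_right _ _
    have ha₁ : 0 ≤ orient (v b) (v b₁) (v a₁) := hv.nonneg' (by omega) hb.le (by omega)
    have h3 := height_between (y := v c) hposb (hv.nonneg' (by omega) hcc hc)
      (hv.nonneg' hab₁ (by omega) hc) (hv.nonneg hbc₁ hcc hc) hq ha₁ (by linarith) le_rfl
    have h4 := height_descends (z := v a) hposb (hv.nonneg'' haa.le (by omega) hc₁)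
      (hv.nonneg'' haa.le (by omega) (by omega)) hq ha₁ (by linarith)
    have := hd (v a) (v c)
    linarith
  · rw [max_eq_left hb.le, max_eq_left hcc.le]
    by_contra! hlt
    have h1 := hopt b c₁ (by omega) (by omega) hc₁
    have h2 := hd (v a₁) (v c₁)
    have ha₁ : 0 ≤ orient (v b) (v b₁) (v a₁) := hv.nonneg' (by omega) hb.le (by omega)
    have h3 := height_descends (z := v a) hposb (hv.nonneg'' haa.le (by omega) hc₁)
      (hv.nonneg'' haa.le (by omega) (by omega)) (orient_self_right _ _) ha₁ (by linarith)
    have h4 := hd (v a) (v c₁)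
    have h5 := he (v a) (v b)
    have h6 : 0 < orient (v a) (v b) (v c) :=
      (hv.nonneg (by omega) hbc₁ hc₁).trans_lt hlt
    have h7 := height_ascends (a := v c) (b := v c₁) (x := v a₁) h6
      (hv.nonneg haa.le hab (by omega)) (hv.nonneg haa.le (by omega) hc) (orient_self_outer _ _)
      (hv.nonneg' (by omega) hcc.le hc₁) (by linarith)
    have h8 := hopt b c (by omega) hbc hc
    -- Both corners are moved at once, and the gain at `a` is compared with the gain at `a₁`, which
    -- is nonnegative by `h8`. The difference of the gains is linear in `v a₁ - v a` and splits into
    -- two height differences, with signs given by `h3` and `h7`.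
    have h9 : (orient (v a) (v b₁) (v c₁) - orient (v a) (v b) (v c))
        - (orient (v a₁) (v b₁) (v c₁) - orient (v a₁) (v b) (v c))
        = (orient (v b) (v b₁) (v a₁) - orient (v b) (v b₁) (v a))
          - (orient (v c) (v c₁) (v a₁) - orient (v c) (v c₁) (v a)) := by
      unfold orient; ring
    linarith

/-- If `v a₃ v b₃ v c₃` is a largest triangle with first corner `v a₃`, then the largest triangles
with an earlier first corner have earlier second and third corners. -/
theorem StrictPolygon.le_min (hv : StrictPolygon v M) {a₃ b₃ c₃ a b c : ℕ} (hab₃ : a₃ ≤ b₃)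
    (hbc₃ : b₃ ≤ c₃) (hc₃ : c₃ < M) (hpos : 0 < orient (v a₃) (v b₃) (v c₃))
    (hopt : ∀ b c, a₃ ≤ b → b ≤ c → c < M →
      orient (v a₃) (v b) (v c) ≤ orient (v a₃) (v b₃) (v c₃))
    (haa : a < a₃) (hab : a ≤ b) (hbc : b ≤ c) (hc : c < M) :
    orient (v a) (v b) (v c) ≤ orient (v a) (v (min b₃ b)) (v (min c₃ c)) := by
  have hd : ∀ (p : ℝ × ℝ) (r : ℝ × ℝ), orient p (v b) r - orient p (v b₃) r
      = orient (v b₃) (v b) r - orient (v b₃) (v b) p := by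
    intro p r; unfold orient; ring
  have he : ∀ (p : ℝ × ℝ) (r : ℝ × ℝ), orient p r (v c) - orient p r (v c₃)
      = orient (v c₃) (v c) p - orient (v c₃) (v c) r := by
    intro p r; unfold orient; ring
  have hposb : 0 < orient (v b₃) (v c₃) (v a₃) := by rwa [← orient_rotate]
  have hposc : 0 < orient (v c₃) (v a₃) (v b₃) := by rwa [orient_rotate]
  obtain ⟨hlt₁, hlt₂⟩ := lt_of_orient_pos hab₃ hbc₃ hpos
  rcases le_or_gt b b₃ with hb | hb <;> rcases le_or_gt c c₃ with hcc | hcc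
  · rw [min_eq_right hb, min_eq_right hcc]
  · rw [min_eq_right hb, min_eq_left hcc.le]
    have h1 := hopt b₃ c hab₃ (by omega) hc
    have h2 := he (v a₃) (v b₃)
    suffices h : orient (v c₃) (v c) (v a) ≤ orient (v c₃) (v c) (v b) by
      have := he (v a) (v b)
      linarith
    have hq : orient (v c₃) (v c) (v c₃) = 0 := orient_self_outer _ _
    have ha₃ : 0 ≤ orient (v c₃) (v c) (v a₃) := hv.nonneg' (by omega) hcc.le hc
    rcases le_or_gt a₃ b with hab' | hab'
    · have h3 := height_between (y := v b) hposc (hv.nonneg hab' hb (by omega))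
        (hv.nonneg'' hb (by omega) hc₃) (hv.nonneg'' hab' (by omega) hc₃) hq ha₃ le_rfl
        (by linarith)
      have h4 := height_ascends (x := v a) (y := v a₃) (z := v b₃) hpos
        (hv.nonneg haa.le hab₃ (by omega)) (hv.nonneg haa.le (by omega) hc₃) hq ha₃ (by linarith)
      linarith
    · have h3 := height_ascends (x := v b) (y := v a₃) (z := v b₃) hpos
        (hv.nonneg hab'.le hab₃ (by omega)) (hv.nonneg hab'.le (by omega) hc₃) hq ha₃
        (by linarith)
      exact height_ascends (z := v b₃) (q := v c₃) (hv _ _ _ (by omega) hlt₂ hc₃)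
        (hv.nonneg hab hb (by omega)) (hv.nonneg hab (by omega) hc₃) hq
        (hv.nonneg' (by omega) hcc.le hc) (by linarith)
  · rw [min_eq_left hb.le, min_eq_right hcc]
    have h1 := hopt b c₃ (by omega) (by omega) hc₃
    have h2 := hd (v a₃) (v c₃)
    have hq : orient (v b₃) (v b) (v b₃) = 0 := orient_self_outer _ _
    have hc₃' : 0 ≤ orient (v b₃) (v b) (v c₃) := hv.nonneg hb.le (by omega) hc₃
    have h3 := height_between (y := v a) hposb (hv.nonneg'' haa.le (by omega) hc₃)
      (hv.nonneg'' haa.le hab₃ (by omega)) (hv.nonneg' (by omega) hbc₃ hc₃) hq hc₃' le_rfl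
      (by linarith)
    have h4 := height_ascends (x := v c) hposc (hv.nonneg' (by omega) hcc hc₃)
      (hv.nonneg' (by omega) hcc hc₃) hq hc₃' (by linarith)
    have := hd (v a) (v c)
    linarith
  · rw [min_eq_left hb.le, min_eq_left hcc.le]
    by_contra! hlt
    have h1 := hopt b₃ c hab₃ (by omega) hc
    have h2 := he (v a₃) (v b₃)
    have ha₃ : 0 ≤ orient (v c₃) (v c) (v a₃) := hv.nonneg' (by omega) hcc.le hc
    have h3 := height_ascends (x := v a) (y := v a₃) (z := v b₃) hpos
      (hv.nonneg haa.le hab₃ (by omega)) (hv.nonneg haa.le (by omega) hc₃)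
      (orient_self_outer _ _) ha₃ (by linarith)
    have h4 := he (v a) (v b₃)
    have h5 := hd (v a) (v c)
    have h6 : 0 < orient (v b) (v c) (v a) := by
      rw [← orient_rotate]
      exact (hv.nonneg (by omega) hbc₃ hc₃).trans_lt hlt
    have h7 := height_descends (a := v b₃) (b := v b) (z := v a₃) h6
      (hv.nonneg'' haa.le (by omega) hc) (hv.nonneg'' haa.le (by omega) (by omega))
      (orient_self_right _ _) (hv.nonneg' (by omega) hb.le (by omega)) (by linarith)
    have h8 := hopt b c (by omega) hbc hc
    -- As in `StrictPolygon.le_max`: the gains of the joint move at `a` and `a₃` differ by height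
    -- differences, with signs given by `h3` and `h7`.
    have h9 : (orient (v a₃) (v b) (v c) - orient (v a₃) (v b₃) (v c₃))
        - (orient (v a) (v b) (v c) - orient (v a) (v b₃) (v c₃))
        = (orient (v b₃) (v b) (v a) - orient (v b₃) (v b) (v a₃))
          - (orient (v c₃) (v c) (v a) - orient (v c₃) (v c) (v a₃)) := by
      unfold orient; ring
    linarith

/-- `v a v b v c` is a largest triangle with first corner `v a`; the last possible choice of `b`
and `c` is made if all these triangles are degenerate. -/
structure RootOpt (v : ℕ → ℝ × ℝ) (M a b c : ℕ) : Prop where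
  le : a ≤ b
  le' : b ≤ c
  lt : c < M
  opt : ∀ b' c', a ≤ b' → b' ≤ c' → c' < M →
    orient (v a) (v b') (v c') ≤ orient (v a) (v b) (v c)
  pos_or : 0 < orient (v a) (v b) (v c) ∨ (b = M - 1 ∧ c = M - 1)

/-- Some largest triangle with first corner `v a` has its other corners at or after `bl`
and `cl`. -/
structure RootLower (v : ℕ → ℝ × ℝ) (M a bl cl : ℕ) : Prop where
  le : bl ≤ cl
  lt : cl < M
  le_max : ∀ b c, a ≤ b → b ≤ c → c < M →
    orient (v a) (v b) (v c) ≤ orient (v a) (v (max bl b)) (v (max cl c))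

/-- Some largest triangle with first corner `v a` has its other corners at or before `bh`
and `ch`. -/
structure RootUpper (v : ℕ → ℝ × ℝ) (M a bh ch : ℕ) : Prop where
  ge : a ≤ bh
  le : bh ≤ ch
  lt : ch < M
  le_min : ∀ b c, a ≤ b → b ≤ c → c < M →
    orient (v a) (v b) (v c) ≤ orient (v a) (v (min bh b)) (v (min ch c))
  pos_or : 0 < orient (v a) (v bh) (v ch) ∨ (bh = M - 1 ∧ ch = M - 1)

theorem RootLower.zero {a : ℕ} (ha : a < M) : RootLower v M a 0 0 :=
  ⟨le_rfl, by omega, fun b c _ _ _ => by simp⟩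

theorem RootUpper.last {a : ℕ} (ha : a < M) : RootUpper v M a (M - 1) (M - 1) :=
  ⟨by omega, le_rfl, by omega, fun b c _ hbc hc => by
    rw [min_eq_right (show b ≤ M - 1 by omega), min_eq_right (show c ≤ M - 1 by omega)],
    Or.inr ⟨rfl, rfl⟩⟩

theorem RootOpt.rootLower (hv : StrictPolygon v M) {a₁ b₁ c₁ a : ℕ} (h : RootOpt v M a₁ b₁ c₁)
    (ha : a₁ < a) : RootLower v M a b₁ c₁ := by
  refine ⟨h.le', h.lt, fun b c hab hbc hc => ?_⟩
  rcases h.pos_or with hpos | ⟨rfl, rfl⟩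
  · exact hv.le_max h.le h.le' h.lt hpos h.opt ha hab hbc hc
  · rw [max_eq_left (show b ≤ M - 1 by omega), max_eq_left (show c ≤ M - 1 by omega),
      orient_self_right]
    -- If all triangles with first corner `v a₁` are degenerate, no nondegenerate triangle has a
    -- later first corner: its second and third corners would serve `a₁` too.
    by_contra! hlt
    obtain ⟨h1, h2⟩ := lt_of_orient_pos hab hbc hlt
    have h3 := h.opt b c (by omega) hbc hc
    rw [orient_self_right] at h3
    exact absurd (hv a₁ b c (by omega) h2 hc) (not_lt.2 h3)

/-- The bound also inherits `pos_or`, since strict convexity makes `v a`, `v b₃`, `v c₃`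
nondegenerate when `v a₃`, `v b₃`, `v c₃` is. This makes the upper bounds a legitimate default
result of a search. -/
theorem RootOpt.rootUpper (hv : StrictPolygon v M) {a₃ b₃ c₃ a : ℕ} (h : RootOpt v M a₃ b₃ c₃)
    (ha : a < a₃) : RootUpper v M a b₃ c₃ := by
  refine ⟨ha.le.trans h.le, h.le', h.lt, fun b c hab hbc hc => ?_, ?_⟩
  · rcases h.pos_or with hpos | ⟨rfl, rfl⟩
    · exact hv.le_min h.le h.le' h.lt hpos h.opt ha hab hbc hc
    · rw [min_eq_right (show b ≤ M - 1 by omega), min_eq_right (show c ≤ M - 1 by omega)]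
  · refine h.pos_or.imp (fun hpos => ?_) id
    obtain ⟨h1, h2⟩ := lt_of_orient_pos h.le h.le' hpos
    exact hv _ _ _ (ha.trans h1) h2 h.lt

/-- The state of a search with two pointers `b` and `c` for a largest triangle with first corner
`v a`, in the range `[b₀, bh]` for the second and `[cl, ch]` for the third corner. -/
structure Search (v : ℕ → ℝ × ℝ) (a b₀ cl bh ch b c : ℕ) (best : ℝ) (bb bc : ℕ) : Prop where
  ge : b₀ ≤ b
  le : b ≤ bh + 1
  le_c : b ≤ c
  cl_le : cl ≤ c
  c_le : b ≤ bh → c ≤ ch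
  done : ∀ b' c', b₀ ≤ b' → b' < b → cl ≤ c' → b' ≤ c' → c' ≤ ch →
    orient (v a) (v b') (v c') ≤ best
  ptr : b ≤ bh → ∀ c', cl ≤ c' → b ≤ c' → c' < c →
    orient (v a) (v b) (v c') ≤ orient (v a) (v b) (v c)
  -- Until a positive area is found, the upper bounds serve as the choice; this keeps the stored
  -- choices monotone in degenerate cases.
  val : (best = 0 ∧ bb = bh ∧ bc = ch) ∨
    (0 < best ∧ best = orient (v a) (v bb) (v bc) ∧ b₀ ≤ bb ∧ bb ≤ bh ∧ bb ≤ bc ∧ cl ≤ bc ∧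
      bc ≤ ch)

variable {a b₀ cl bh ch b c : ℕ} {best : ℝ} {bb bc : ℕ}

theorem Search.init (hb₀ : b₀ ≤ bh + 1) (hch : bh ≤ ch) (hcl : cl ≤ ch) :
    Search v a b₀ cl bh ch b₀ (max cl b₀) 0 bh ch :=
  ⟨le_rfl, hb₀, le_max_right _ _, le_max_left _ _, fun h => max_le hcl (h.trans hch),
    fun _ _ h h' => by omega, fun _ c' h h' h'' => by omega, Or.inl ⟨rfl, rfl, rfl⟩⟩

theorem Search.advance (h : Search v a b₀ cl bh ch b c best bb bc) (hc : c < ch)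
    (hle : orient (v a) (v b) (v c) ≤ orient (v a) (v b) (v (c + 1))) :
    Search v a b₀ cl bh ch b (c + 1) best bb bc := by
  refine ⟨h.ge, h.le, h.le_c.trans (by omega), h.cl_le.trans (by omega), fun _ => hc, h.done,
    fun hb c' h1 h2 h3 => ?_, h.val⟩
  rcases eq_or_ne c' c with rfl | hne
  · exact hle
  · exact (h.ptr hb c' h1 h2 (by omega)).trans hle

/-- All third corners are treated for the second corner `v b` when the area starts to decrease. -/
theorem Search.column (hv : StrictPolygon v M) (h : Search v a b₀ cl bh ch b c best bb bc)
    (hab : a < b) (hb : b ≤ bh) (hM : ch < M)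
    (hdrop : c < ch → orient (v a) (v b) (v (c + 1)) < orient (v a) (v b) (v c))
    {c' : ℕ} (h1 : cl ≤ c') (h2 : b ≤ c') (h3 : c' ≤ ch) :
    orient (v a) (v b) (v c') ≤ orient (v a) (v b) (v c) := by
  rcases lt_trichotomy c' c with hlt | rfl | hgt
  · exact h.ptr hb c' h1 h2 hlt
  · exact le_rfl
  · have hs := hdrop (by omega)
    have hbc : b < c := by
      refine lt_of_le_of_ne h.le_c ?_
      rintro rfl
      rw [orient_self_right] at hs
      exact absurd hs (not_lt.2 (hv.nonneg hab.le (by omega) (by omega)))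
    refine le_trans ?_ hs.le
    -- For fixed `a` and `b` the area is the height over the line `v a v b`, which cannot rise again
    -- after the first drop.
    exact height_descends (q := v b) (x := v c) (y := v (c + 1))
      (hv _ _ _ hbc (by omega) (by omega)) (hv.nonneg (by omega) (by omega) (by omega))
      (hv.nonneg (by omega) (by omega) (by omega)) (orient_self_right _ _)
      (hv.nonneg hab.le (by omega) (by omega)) hs.le

/-- The third pointer need not move back: third corners before `c` that do not beat `c` for `b` do
not beat it for `b + 1` either. -/
theorem Search.next (hv : StrictPolygon v M) (h : Search v a b₀ cl bh ch b c best bb bc)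
    (hab : a < b) (hb : b ≤ bh) (hM : ch < M) (hbh : bh ≤ ch)
    (hdrop : c < ch → orient (v a) (v b) (v (c + 1)) < orient (v a) (v b) (v c))
    {best' : ℝ} {bb' bc' : ℕ}
    (hbest : (best < orient (v a) (v b) (v c) ∧ best' = orient (v a) (v b) (v c) ∧ bb' = b ∧
      bc' = c) ∨ (orient (v a) (v b) (v c) ≤ best ∧ best' = best ∧ bb' = bb ∧ bc' = bc)) :
    Search v a b₀ cl bh ch (b + 1) (max c (b + 1)) best' bb' bc' := by
  have hge := h.ge
  have hbc := h.le_c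
  have hcl := h.cl_le
  have hch := h.c_le hb
  have hbest0 : 0 ≤ best := by
    rcases h.val with ⟨h0, -⟩ | ⟨h0, -⟩
    · exact h0.ge
    · exact h0.le
  have hle1 : best ≤ best' := by
    rcases hbest with ⟨h1, h2, -⟩ | ⟨-, h2, -⟩ <;> rw [h2]
    exact h1.le
  have hle2 : orient (v a) (v b) (v c) ≤ best' := by
    rcases hbest with ⟨h1, h2, -⟩ | ⟨h1, h2, -⟩ <;> rw [h2]
    exact h1
  refine ⟨by omega, by omega, le_max_right _ _, hcl.trans (le_max_left _ _),
    fun h' => max_le hch (h'.trans hbh), fun b' c' h1 h2 h3 h4 h5 => ?_,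
    fun hb' c' h1 h2 h3 => ?_, ?_⟩
  · rcases eq_or_ne b' b with rfl | hne
    · exact (h.column hv hab hb hM hdrop h3 h4 h5).trans hle2
    · exact (h.done b' c' h1 (by omega) h3 h4 h5).trans hle1
  · have h4 : c' < c := by omega
    rw [max_eq_left (by omega)]
    have h5 := h.ptr hb c' h1 (by omega) h4
    -- The three-term Plücker relation for the vectors from `v a` to `v b`, `v (b + 1)`, `v c'` and
    -- `v c`.
    have key : orient (v a) (v b) (v c')
          * (orient (v a) (v (b + 1)) (v c) - orient (v a) (v (b + 1)) (v c'))
        = orient (v a) (v (b + 1)) (v c')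
            * (orient (v a) (v b) (v c) - orient (v a) (v b) (v c'))
          + orient (v a) (v b) (v (b + 1)) * orient (v a) (v c') (v c) := by
      unfold orient; ring
    have h6 : 0 ≤ orient (v a) (v b) (v c')
        * (orient (v a) (v (b + 1)) (v c) - orient (v a) (v (b + 1)) (v c')) := by
      rw [key]
      exact add_nonneg (mul_nonneg (hv.nonneg (by omega) h2 (by omega)) (by linarith))
        (mul_nonneg (hv.nonneg hab.le (by omega) (by omega))
          (hv.nonneg (by omega) h4.le (by omega)))
    have := nonneg_of_mul_nonneg_right h6 (hv _ _ _ hab (by omega) (by omega))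
    linarith
  · rcases hbest with ⟨h1, rfl, rfl, rfl⟩ | ⟨h1, rfl, rfl, rfl⟩
    · exact Or.inr ⟨hbest0.trans_lt h1, rfl, hge, hb, hbc, hcl, hch⟩
    · exact h.val

/-- A finished search has found a largest triangle with first corner `v a`. -/
theorem Search.rootOpt (hv : StrictPolygon v M) {bl : ℕ}
    (h : Search v a b₀ cl bh ch (bh + 1) c best bb bc) (hb₀ : b₀ = max bl (a + 1))
    (hl : RootLower v M a bl cl) (hu : RootUpper v M a bh ch) (hbl : bl ≤ bh) (hcl : cl ≤ ch) :
    RootOpt v M a bb bc ∧ best = orient (v a) (v bb) (v bc) ∧ bl ≤ bb ∧ bb ≤ bh ∧ cl ≤ bc ∧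
      bc ≤ ch := by
  have hl1 := hl.le
  have hl2 := hl.lt
  have hu1 := hu.ge
  have hu2 := hu.le
  have hu3 := hu.lt
  have hbest0 : 0 ≤ best := by
    rcases h.val with ⟨h0, -⟩ | ⟨h0, -⟩
    · exact h0.ge
    · exact h0.le
  have hall : ∀ b' c', a ≤ b' → b' ≤ c' → c' < M → orient (v a) (v b') (v c') ≤ best := by
    intro b' c' h1 h2 h3
    -- An arbitrary pair is raised to the lower bounds and then lowered to the upper bounds without
    -- loss of area, which brings it into the searched range.
    refine (hl.le_max b' c' h1 h2 h3).trans
      ((hu.le_min _ _ (by omega) (by omega) (by omega)).trans ?_)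
    -- The search starts at `a + 1`; the omitted second corner `a` gives area zero only.
    rcases eq_or_ne a (min bh (max bl b')) with he | hne
    · rw [← he, orient_self_left]
      exact hbest0
    · exact h.done _ _ (by omega) (by omega) (by omega) (by omega) (by omega)
  rcases h.val with ⟨rfl, rfl, rfl⟩ | ⟨hpos, hval, h1, h2, h3, h4, h5⟩
  · have h6 := hall bb bc hu1 hu2 hu3
    have h7 : orient (v a) (v bb) (v bc) = 0 := le_antisymm h6 (hv.nonneg hu1 hu2 hu3)
    exact ⟨⟨hu1, hu2, hu3, by rwa [h7], hu.pos_or⟩, h7.symm, hbl, le_rfl, hcl, le_rfl⟩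
  · exact ⟨⟨by omega, h3, by omega, by rwa [← hval], Or.inl (hval ▸ hpos)⟩, hval, by omega, h2, h4,
      h5⟩

end Polygon

/-! ### The search for a largest triangle

Index array `2` lists the corners of the polygon; the index arrays `3` and `4` get the second and
third corner of a largest triangle for every first corner (at the position of the first corner plus
one). Index registers: `11` the number of corners; `4`, `5` the distance of the treated positions
before and after a level; `6` the position; `7`, `8`, `9` the corners; `12`, `10` and `13`, `14` the
bounds for the second and the third corner; `15`, `16` the best choice. -/

/-- The larger one of two index expressions. -/
def NExp.max (e f : NExp) : NExp := NExp.add e (NExp.sub f e)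

theorem NExp.eval_max (s : RamState) (e f : NExp) :
    (NExp.max e f).eval s = Max.max (e.eval s) (f.eval s) := by
  simp only [NExp.max, NExp.eval]; omega

theorem NExp.cost_max (e f : NExp) : (NExp.max e f).cost = 2 * e.cost + f.cost + 2 := by
  simp only [NExp.max, NExp.cost]; omega

/-- Twice the area of the triangle with first corner `7`, second corner `8` and third corner `e`. -/
def areaAt (e : NExp) : RExp :=
  .orient 3 4 (.get 2 (.reg 7)) (.get 2 (.reg 8)) (.get 2 e)

/-- One step of the search. -/
def searchStep : Prog :=
  .ite (.and (.nlt (.reg 9) (.reg 14)) (.neg (.rlt (areaAt (.succ 9)) (areaAt (.reg 9)))))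
    (.setN 9 (.succ 9))
    (.block [
      .ite (.rlt (.reg 1) (areaAt (.reg 9)))
        (.block [.setR 1 (areaAt (.reg 9)), .setN 15 (.reg 8), .setN 16 (.reg 9)])
        .skip,
      .setN 8 (.succ 8),
      .setN 9 (.max (.reg 9) (.reg 8))])

/-- The search for a fixed first corner. -/
def searchLoop : Prog := .loop (.nlt (.reg 8) (.succ 10)) searchStep

/-- The corners of the polygon. -/
def corner (s : RamState) (i : ℕ) : ℝ × ℝ := vertex s 3 4 (s.narr 2 i)

theorem corner_congr {s s' : RamState} (h2 : s'.narr 2 = s.narr 2) (h3 : s'.rarr 3 = s.rarr 3)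
    (h4 : s'.rarr 4 = s.rarr 4) : corner s' = corner s := by
  funext i
  simp only [corner, vertex, h2, h3, h4]

theorem eval_areaAt (s : RamState) (e : NExp) : (areaAt e).eval s =
    orient (corner s (s.nreg 7)) (corner s (s.nreg 8)) (corner s (e.eval s)) := rfl

theorem cost_areaAt (e : NExp) : (areaAt e).cost = 2 * e.cost + 29 := by
  simp only [areaAt, RExp.cost_orient, NExp.cost]; omega

/-- Neither pointer moves back and each step advances at least one, so the total remaining range
decreases. -/
theorem wp_searchStep {M b₀ cl : ℕ} {s : RamState} (hv : StrictPolygon (corner s) M)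
    (hab : s.nreg 7 < s.nreg 8) (hb : s.nreg 8 ≤ s.nreg 10) (hM : s.nreg 14 < M)
    (hbh : s.nreg 10 ≤ s.nreg 14)
    (h : Search (corner s) (s.nreg 7) b₀ cl (s.nreg 10) (s.nreg 14) (s.nreg 8) (s.nreg 9)
      (s.rreg 1) (s.nreg 15) (s.nreg 16)) :
    wp searchStep s fun t s' => t ≤ 200 ∧
      (s'.nreg 10 + 1 - s'.nreg 8) + (s'.nreg 14 - s'.nreg 9) + 1
        ≤ (s.nreg 10 + 1 - s.nreg 8) + (s.nreg 14 - s.nreg 9) ∧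
      s.nreg 8 ≤ s'.nreg 8 ∧
      Search (corner s) (s.nreg 7) b₀ cl (s.nreg 10) (s.nreg 14) (s'.nreg 8) (s'.nreg 9)
        (s'.rreg 1) (s'.nreg 15) (s'.nreg 16) := by
  have hc := h.c_le hb
  simp only [searchStep, wp_block_cons, wp_block_one, wp_ite, wp_setN, wp_setR, wp_skip,
    BExp.Holds, RExp.eval, BExp.cost, RExp.cost, NExp.cost, eval_areaAt, cost_areaAt, NExp.eval,
    NExp.eval_succ, NExp.cost_succ, NExp.eval_max, NExp.cost_max]
  refine ⟨fun hb' => ?_, fun hb' => ⟨fun hbest => ?_, fun hbest => ?_⟩⟩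
  · refine ⟨by omega, by simp; omega, by simp, ?_⟩
    simpa using h.advance hb'.1 (not_lt.1 hb'.2)
  all_goals
    have hdrop : s.nreg 9 < s.nreg 14 → orient (corner s (s.nreg 7)) (corner s (s.nreg 8))
        (corner s (s.nreg 9 + 1)) < orient (corner s (s.nreg 7)) (corner s (s.nreg 8))
        (corner s (s.nreg 9)) := fun hlt => by
      by_contra hnl
      exact hb' ⟨hlt, hnl⟩
  · refine ⟨by omega, by simp; omega, by simp, ?_⟩
    simpa using h.next hv hab hb hM hbh hdrop (Or.inl ⟨hbest, rfl, rfl, rfl⟩)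
  · refine ⟨by omega, by simp; omega, by simp, ?_⟩
    simpa using h.next hv hab hb hM hbh hdrop (Or.inr ⟨not_lt.1 hbest, rfl, rfl, rfl⟩)

theorem wp_searchLoop {M b₀ cl : ℕ} {s : RamState} (hv : StrictPolygon (corner s) M)
    (hab : s.nreg 7 < s.nreg 8) (hM : s.nreg 14 < M) (hbh : s.nreg 10 ≤ s.nreg 14)
    (h : Search (corner s) (s.nreg 7) b₀ cl (s.nreg 10) (s.nreg 14) (s.nreg 8) (s.nreg 9)
      (s.rreg 1) (s.nreg 15) (s.nreg 16)) :
    wp searchLoop s fun t s' =>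
      t ≤ 250 * ((s.nreg 10 + 1 - s.nreg 8) + (s.nreg 14 - s.nreg 9)) + 250 ∧
      Search (corner s) (s.nreg 7) b₀ cl (s.nreg 10) (s.nreg 14) (s.nreg 10 + 1) (s'.nreg 9)
        (s'.rreg 1) (s'.nreg 15) (s'.nreg 16) := by
  refine (wp_loop_count (fun s' => corner s' = corner s ∧ s'.nreg 7 = s.nreg 7 ∧
    s'.nreg 10 = s.nreg 10 ∧ s'.nreg 14 = s.nreg 14 ∧ s.nreg 7 < s'.nreg 8 ∧
    Search (corner s) (s.nreg 7) b₀ cl (s.nreg 10) (s.nreg 14) (s'.nreg 8) (s'.nreg 9)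
      (s'.rreg 1) (s'.nreg 15) (s'.nreg 16))
    (fun s' => (s'.nreg 10 + 1 - s'.nreg 8) + (s'.nreg 14 - s'.nreg 9)) 250
    (by simp [BExp.cost, NExp.cost, NExp.cost_succ]) ?_
    ⟨rfl, rfl, rfl, rfl, hab, h⟩).mono ?_
  · rintro s' ⟨hcor, h7, h10, h14, hab', h'⟩ hb
    simp only [BExp.Holds, NExp.eval, NExp.eval_succ] at hb
    refine (wp_searchStep (M := M) (by rwa [hcor]) (by omega) (by omega) (by omega) (by omega)
      (by rwa [hcor, h7, h10, h14])).frame.mono ?_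
    rintro t s'' ⟨⟨ht, hμ, h8, hS⟩, hf⟩
    rw [hcor, h7, h10, h14] at hS
    refine ⟨⟨?_, (hf.nreg 7 (by decide)).trans h7, (hf.nreg 10 (by decide)).trans h10,
      (hf.nreg 14 (by decide)).trans h14, by omega, hS⟩, hμ, ?_⟩
    · rw [corner_congr (hf.narr 2 (by decide)) (hf.rarr 3 (by decide)) (hf.rarr 4 (by decide)),
        hcor]
    · simp only [BExp.cost, NExp.cost, NExp.cost_succ]
      omega
  · rintro t s' ⟨ht, ⟨hcor, h7, h10, h14, hab', h'⟩, hb⟩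
    simp only [BExp.Holds, NExp.eval, NExp.eval_succ] at hb
    have h1 := h'.le
    have h2 : s'.nreg 8 = s.nreg 10 + 1 := by omega
    exact ⟨ht, h2 ▸ h'⟩

/-- Looking up the bounds for the current first corner. -/
def rootPrepare : Prog :=
  .block [
    .setN 7 (.sub (.reg 6) (.const 1)),
    .ite (.nlt (.reg 11) (.add (.reg 6) (.reg 5)))
      (.block [.setN 10 (.sub (.reg 11) (.const 1)), .setN 14 (.sub (.reg 11) (.const 1))])
      (.block [.setN 10 (.get 3 (.add (.reg 6) (.reg 5))),
        .setN 14 (.get 4 (.add (.reg 6) (.reg 5)))]),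
    .setN 8 (.max (.reg 12) (.reg 6)),
    .setN 9 (.max (.reg 13) (.reg 8)),
    .setR 1 (.const 0),
    .setN 15 (.reg 10),
    .setN 16 (.reg 14)]

/-- Storing the result for the current first corner. -/
def rootStore : Prog :=
  .block [
    .putN 3 (.reg 6) (.reg 15),
    .putN 4 (.reg 6) (.reg 16),
    .ite (.rlt (.reg 0) (.reg 1))
      (.block [.setR 0 (.reg 1), .setN 1 (.get 2 (.reg 7)), .setN 2 (.get 2 (.reg 15)),
        .setN 3 (.get 2 (.reg 16))])
      .skip,
    .setN 12 (.reg 10),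
    .setN 13 (.reg 14),
    .setN 6 (.add (.add (.reg 6) (.reg 5)) (.reg 5))]

/-- Treating one first corner. -/
def rootStep : Prog := .block [rootPrepare, searchLoop, rootStore]

/-- The largest triangle so far is the one with corners `i₁`, `i₂`, `i₃`, and it has area `g / 2`. -/
def BestTriangle (s : RamState) (M : ℕ) (g : ℝ) (i₁ i₂ i₃ : ℕ) : Prop :=
  -- The default for degenerate polygons: a valid choice of three different segments for `n` at
  -- least 3.
  (g = 0 ∧ i₁ = 0 ∧ i₂ = 1 ∧ i₃ = 2) ∨
    (0 < g ∧ ∃ i j k, i < M ∧ j < M ∧ k < M ∧ i₁ = s.narr 2 i ∧ i₂ = s.narr 2 j ∧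
      i₃ = s.narr 2 k ∧ g = orient (corner s i) (corner s j) (corner s k))

theorem BestTriangle.nonneg {s : RamState} {M : ℕ} {g : ℝ} {i₁ i₂ i₃ : ℕ}
    (h : BestTriangle s M g i₁ i₂ i₃) : 0 ≤ g := by
  rcases h with ⟨h, -⟩ | ⟨h, -⟩
  · exact h.ge
  · exact h.le

theorem wp_rootPrepare (s : RamState) {bh ch : ℕ}
    (hbh : bh = if s.nreg 11 < s.nreg 6 + s.nreg 5 then s.nreg 11 - 1
      else s.narr 3 (s.nreg 6 + s.nreg 5))
    (hch : ch = if s.nreg 11 < s.nreg 6 + s.nreg 5 then s.nreg 11 - 1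
      else s.narr 4 (s.nreg 6 + s.nreg 5)) :
    wp rootPrepare s fun t s' => t ≤ 60 ∧ s'.nreg 7 = s.nreg 6 - 1 ∧ s'.nreg 10 = bh ∧
      s'.nreg 14 = ch ∧ s'.nreg 8 = max (s.nreg 12) (s.nreg 6) ∧
      s'.nreg 9 = max (s.nreg 13) (max (s.nreg 12) (s.nreg 6)) ∧ s'.rreg 1 = 0 ∧
      s'.nreg 15 = bh ∧ s'.nreg 16 = ch := by
  simp only [rootPrepare, wp_block_cons, wp_block_one, wp_ite, wp_setN, wp_setR,
    BExp.Holds, RExp.eval, BExp.cost, RExp.cost, NExp.cost, NExp.eval, NExp.eval_max,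
    NExp.cost_max]
  refine ⟨fun hb => ?_, fun hb => ?_⟩
  · simp at hb
    rw [if_pos hb] at hbh hch
    simp [hbh, hch]
  · simp at hb
    rw [if_neg (by omega)] at hbh hch
    simp [hbh, hch]

/-- The cost is linear in the widths of the two ranges, and the upper bounds are left behind as
lower bounds for the next first corner. Together these make the costs of a level telescope. -/
theorem wp_rootStep {s : RamState} (hv : StrictPolygon (corner s) (s.nreg 11)) {bh ch : ℕ}
    (ht : 1 ≤ s.nreg 6)
    (hbh : bh = if s.nreg 11 < s.nreg 6 + s.nreg 5 then s.nreg 11 - 1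
      else s.narr 3 (s.nreg 6 + s.nreg 5))
    (hch : ch = if s.nreg 11 < s.nreg 6 + s.nreg 5 then s.nreg 11 - 1
      else s.narr 4 (s.nreg 6 + s.nreg 5))
    (hl : RootLower (corner s) (s.nreg 11) (s.nreg 6 - 1) (s.nreg 12) (s.nreg 13))
    (hu : RootUpper (corner s) (s.nreg 11) (s.nreg 6 - 1) bh ch)
    (hbl : s.nreg 12 ≤ bh) (hcl : s.nreg 13 ≤ ch)
    (hbest : BestTriangle s (s.nreg 11) (s.rreg 0) (s.nreg 1) (s.nreg 2) (s.nreg 3)) :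
    wp rootStep s fun t s' =>
      t ≤ 250 * ((bh - s.nreg 12) + (ch - s.nreg 13)) + 800 ∧
      s'.nreg 6 = s.nreg 6 + 2 * s.nreg 5 ∧ s'.nreg 12 = bh ∧ s'.nreg 13 = ch ∧
      BestTriangle s (s.nreg 11) (s'.rreg 0) (s'.nreg 1) (s'.nreg 2) (s'.nreg 3) ∧
      s.rreg 0 ≤ s'.rreg 0 ∧
      ∃ bb bc, s'.narr 3 = Function.update (s.narr 3) (s.nreg 6) bb ∧
        s'.narr 4 = Function.update (s.narr 4) (s.nreg 6) bc ∧
        RootOpt (corner s) (s.nreg 11) (s.nreg 6 - 1) bb bc ∧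
        s.nreg 12 ≤ bb ∧ bb ≤ bh ∧ s.nreg 13 ≤ bc ∧ bc ≤ ch ∧
        orient (corner s (s.nreg 6 - 1)) (corner s bb) (corner s bc) ≤ s'.rreg 0 := by
  have hge := hu.ge
  have hle := hu.le
  have hlt := hu.lt
  have hll := hl.le
  simp only [rootStep, wp_block_cons, wp_block_one]
  refine (wp_rootPrepare s hbh hch).frame.mono ?_
  rintro t₁ s₁ ⟨⟨ht₁, h7, h10, h14, h8, h9, hr1, h15, h16⟩, hf₁⟩
  have hcor₁ : corner s₁ = corner s :=
    corner_congr (hf₁.narr 2 (by decide)) (hf₁.rarr 3 (by decide)) (hf₁.rarr 4 (by decide))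
  have hS := Search.init (v := corner s) (a := s.nreg 6 - 1) (b₀ := max (s.nreg 12) (s.nreg 6))
    (cl := s.nreg 13) (bh := bh) (ch := ch) (by omega) hle hcl
  refine (wp_searchLoop (M := s.nreg 11) (by rwa [hcor₁]) (by omega) (by omega) (by omega)
    (by rwa [hcor₁, h7, h10, h14, h8, h9, hr1, h15, h16])).frame.mono ?_
  rintro t₂ s₂ ⟨⟨ht₂, hS₂⟩, hf₂⟩
  rw [hcor₁, h7, h10, h14] at hS₂
  obtain ⟨hopt, hval, h17, h18, h19, h20⟩ := hS₂.rootOpt hv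
    (by rw [Nat.sub_add_cancel ht]) hl hu hbl hcl
  have g6 : s₂.nreg 6 = s.nreg 6 :=
    (hf₂.nreg 6 (by decide)).trans (hf₁.nreg 6 (by decide))
  have g5 : s₂.nreg 5 = s.nreg 5 :=
    (hf₂.nreg 5 (by decide)).trans (hf₁.nreg 5 (by decide))
  have g7 : s₂.nreg 7 = s.nreg 6 - 1 := (hf₂.nreg 7 (by decide)).trans h7
  have g10 : s₂.nreg 10 = bh := (hf₂.nreg 10 (by decide)).trans h10
  have g14 : s₂.nreg 14 = ch := (hf₂.nreg 14 (by decide)).trans h14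
  have g1 : s₂.nreg 1 = s.nreg 1 := (hf₂.nreg 1 (by decide)).trans (hf₁.nreg 1 (by decide))
  have g2 : s₂.nreg 2 = s.nreg 2 := (hf₂.nreg 2 (by decide)).trans (hf₁.nreg 2 (by decide))
  have g3 : s₂.nreg 3 = s.nreg 3 := (hf₂.nreg 3 (by decide)).trans (hf₁.nreg 3 (by decide))
  have gr : s₂.rreg 0 = s.rreg 0 := (hf₂.rreg 0 (by decide)).trans (hf₁.rreg 0 (by decide))
  have a2 : s₂.narr 2 = s.narr 2 := (hf₂.narr 2 (by decide)).trans (hf₁.narr 2 (by decide))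
  have a3 : s₂.narr 3 = s.narr 3 := (hf₂.narr 3 (by decide)).trans (hf₁.narr 3 (by decide))
  have a4 : s₂.narr 4 = s.narr 4 := (hf₂.narr 4 (by decide)).trans (hf₁.narr 4 (by decide))
  have htime : t₂ ≤ 250 * ((bh - s.nreg 12) + (ch - s.nreg 13)) + 500 := by
    refine ht₂.trans ?_
    rw [h10, h14, h8, h9]
    omega
  simp only [rootStore, wp_block_cons, wp_block_one, wp_ite, wp_setN, wp_setR, wp_skip, wp_putN,
    BExp.Holds, RExp.eval, BExp.cost, RExp.cost, NExp.cost, NExp.eval]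
  refine ⟨fun hb => ?_, fun hb => ?_⟩
  · simp [g6, g5, g7, g10, g14, a2, a3, a4]
    rw [gr] at hb
    refine ⟨by omega, by omega, Or.inr ⟨hbest.nonneg.trans_lt hb, _, _, _,
      (hopt.le.trans hopt.le').trans_lt hopt.lt, hopt.le'.trans_lt hopt.lt, hopt.lt, rfl, rfl,
      rfl, hval⟩, hb.le, _, rfl, _, rfl, hopt, h17, h18, h19, h20, hval.ge⟩
  · simp [g6, g5, g10, g14, a3, a4, g1, g2, g3, gr]
    rw [gr] at hb
    exact ⟨by omega, by omega, hbest, _, rfl, _, rfl, hopt, h17, h18, h19, h20,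
      hval ▸ not_lt.1 hb⟩

/-- `B` and `C` hold monotone largest triangles for the positions that satisfy `D`, and twice their
areas are at most `g`. -/
structure Roots (v : ℕ → ℝ × ℝ) (M : ℕ) (B C : ℕ → ℕ) (D : ℕ → Prop) (g : ℝ) : Prop where
  opt : ∀ t, D t → 1 ≤ t → t ≤ M → RootOpt v M (t - 1) (B t) (C t)
  mono : ∀ t t', D t → D t' → 1 ≤ t → t ≤ t' → t' ≤ M → B t ≤ B t' ∧ C t ≤ C t'
  best : ∀ t, D t → 1 ≤ t → t ≤ M → orient (v (t - 1)) (v (B t)) (v (C t)) ≤ g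

section

variable {v : ℕ → ℝ × ℝ} {M : ℕ} {B C : ℕ → ℕ} {D D' : ℕ → Prop} {g g' : ℝ}

theorem Roots.congr (h : Roots v M B C D g) (hD : ∀ t, 1 ≤ t → t ≤ M → D' t → D t) :
    Roots v M B C D' g :=
  ⟨fun t h1 h2 h3 => h.opt t (hD t h2 h3 h1) h2 h3,
    fun t t' h1 h2 h3 h4 h5 => h.mono t t' (hD t h3 (h4.trans h5) h1)
      (hD t' (h3.trans h4) h5 h2) h3 h4 h5,
    fun t h1 h2 h3 => h.best t (hD t h2 h3 h1) h2 h3⟩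

/-- The new entries lie between bounds that separate the entries at earlier and later positions, so
monotonicity is kept. -/
theorem Roots.insert (h : Roots v M B C D g) {t bl cl bh ch bb bc : ℕ}
    (hlow : ∀ t', D t' → 1 ≤ t' → t' < t → t' ≤ M → B t' ≤ bl ∧ C t' ≤ cl)
    (hupp : ∀ t', D t' → t < t' → t' ≤ M → bh ≤ B t' ∧ ch ≤ C t')
    (hopt : RootOpt v M (t - 1) bb bc) (h1 : bl ≤ bb) (h2 : bb ≤ bh) (h3 : cl ≤ bc) (h4 : bc ≤ ch)
    (hg : g ≤ g') (hbest : orient (v (t - 1)) (v bb) (v bc) ≤ g') :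
    Roots v M (Function.update B t bb) (Function.update C t bc) (fun t' => D t' ∨ t' = t) g' := by
  refine ⟨fun u hu hu1 huM => ?_, fun u u' hu hu' hu1 huu huM => ?_, fun u hu hu1 huM => ?_⟩
  · rcases eq_or_ne u t with rfl | hne
    · simpa using hopt
    · simpa [hne] using h.opt u (hu.resolve_right hne) hu1 huM
  · by_cases hne : u = t <;> by_cases hne' : u' = t
    · rw [hne, hne']
      exact ⟨le_rfl, le_rfl⟩
    · obtain ⟨h5, h6⟩ := hupp u' (hu'.resolve_right hne') (by omega) huM
      subst hne
      simp only [Function.update_self, Function.update_of_ne hne']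
      omega
    · obtain ⟨h5, h6⟩ := hlow u (hu.resolve_right hne) hu1 (by omega) (by omega)
      subst hne'
      simp only [Function.update_self, Function.update_of_ne hne]
      omega
    · simp only [Function.update_of_ne hne, Function.update_of_ne hne']
      exact h.mono u u' (hu.resolve_right hne) (hu'.resolve_right hne') hu1 huu huM
  · rcases eq_or_ne u t with rfl | hne
    · simpa using hbest
    · simpa [hne] using (h.best u (hu.resolve_right hne) hu1 huM).trans hg

/-- The positions that are treated when a level with distance `h` has reached position `t`. -/
def Treated (h t u : ℕ) : Prop := 2 * h ∣ u ∨ (h ∣ u ∧ u < t)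

theorem Treated.dvd {h t u : ℕ} (hu : Treated h t u) : h ∣ u := by
  rcases hu with hu | ⟨hu, -⟩
  · exact (Dvd.intro_left 2 rfl).trans hu
  · exact hu

/-- From `t`, an odd multiple of `h`, up to `t + 2 * h` exclusively there are two multiples of `h`:
`t` itself and `t + h`, which is a multiple of `2 * h` and was treated on an earlier level. -/
theorem Treated.of_next {h t m u : ℕ} (ht : t = h + 2 * h * m)
    (hu : Treated h (t + 2 * h) u) : Treated h t u ∨ u = t := by
  rcases hu with hu | ⟨⟨k, rfl⟩, hlt⟩
  · exact Or.inl (Or.inl hu)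
  · have h1 : h * k < h * (2 * m + 3) := by
      calc h * k < t + 2 * h := hlt
        _ = h * (2 * m + 3) := by rw [ht]; ring
    have h2 : k < 2 * m + 3 := lt_of_mul_lt_mul_left h1 (Nat.zero_le _)
    have ht' : t = h * (2 * m + 1) := by rw [ht]; ring
    obtain ⟨q, hq | hq⟩ := Nat.even_or_odd' k
    · exact Or.inl (Or.inl ⟨q, by rw [hq]; ring⟩)
    · rcases (show q ≤ m by omega).eq_or_lt with rfl | hlt'
      · exact Or.inr (by rw [ht', hq])
      · refine Or.inl (Or.inr ⟨⟨k, rfl⟩, ?_⟩)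
        rw [ht']
        have : 0 < h := Nat.pos_of_ne_zero fun h0 => by simp [h0] at h1
        exact Nat.mul_lt_mul_of_pos_left (by omega) this

theorem Treated.next {h t m : ℕ} (ht : t = h + 2 * h * m) : Treated h t (t + h) :=
  Or.inl ⟨m + 1, by rw [ht]; ring⟩

theorem le_of_dvd_of_lt {h t u : ℕ} (ht : h ∣ t) (hu : h ∣ u) (htu : t < u) : t + h ≤ u := by
  have h1 : h ∣ u - t := Nat.dvd_sub hu ht
  have h2 := Nat.le_of_dvd (by omega) h1
  omega

end

/-- Treating the positions at the odd multiples of the register `5`. -/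
def levelPass : Prog :=
  .block [
    .setN 6 (.reg 5),
    .setN 12 (.const 0),
    .setN 13 (.const 0),
    .loop (.nlt (.reg 6) (.succ 11)) rootStep]

/-- The largest triangle of the polygon. -/
def searchPolygon : Prog :=
  .block [
    .setN 1 (.const 0),
    .setN 2 (.const 1),
    .setN 3 (.const 2),
    .setR 0 (.const 0),
    .setN 4 (.const 1),
    .loop (.nlt (.reg 4) (.succ 11)) (.setN 4 (.add (.reg 4) (.reg 4))),
    .loop (.nlt (.const 1) (.reg 4))
      (.block [.setN 5 (.half (.reg 4)), levelPass, .setN 4 (.reg 5)])]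

/-- The invariant of a level. -/
structure Level (s₀ : RamState) (M h : ℕ) (s : RamState) : Prop where
  corner : corner s = corner s₀
  list : s.narr 2 = s₀.narr 2
  size : s.nreg 11 = M
  dist : s.nreg 5 = h
  pos : ∃ m, s.nreg 6 = h + 2 * h * m
  roots : Roots (_root_.corner s₀) M (s.narr 3) (s.narr 4) (Treated h (s.nreg 6)) (s.rreg 0)
  best : BestTriangle s₀ M (s.rreg 0) (s.nreg 1) (s.nreg 2) (s.nreg 3)
  lower : s.nreg 6 ≤ M →
    RootLower (_root_.corner s₀) M (s.nreg 6 - 1) (s.nreg 12) (s.nreg 13)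
  before : ∀ u, Treated h (s.nreg 6) u → 1 ≤ u → u < s.nreg 6 → u ≤ M →
    s.narr 3 u ≤ s.nreg 12 ∧ s.narr 4 u ≤ s.nreg 13
  after : ∀ u, Treated h (s.nreg 6) u → s.nreg 6 ≤ u → u ≤ M →
    s.nreg 12 ≤ s.narr 3 u ∧ s.nreg 13 ≤ s.narr 4 u

theorem BestTriangle.congr {s s' : RamState} {M : ℕ} {g : ℝ} {i₁ i₂ i₃ : ℕ}
    (hc : corner s' = corner s) (hl : s'.narr 2 = s.narr 2)
    (h : BestTriangle s M g i₁ i₂ i₃) : BestTriangle s' M g i₁ i₂ i₃ := by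
  unfold BestTriangle at *
  rwa [hc, hl]

/-- The distance of the current lower bounds from `M` is the potential: the search cost is
proportional to the amount by which these bounds rise. -/
theorem wp_rootStep_level {s₀ s : RamState} {M h : ℕ} (hv : StrictPolygon (corner s₀) M)
    (hh : 0 < h) (hs : Level s₀ M h s) (hb : s.nreg 6 ≤ M) :
    wp rootStep s fun t s' => Level s₀ M h s' ∧ s'.nreg 6 = s.nreg 6 + 2 * h ∧
      t + 250 * ((M - s'.nreg 12) + (M - s'.nreg 13)) ≤
        250 * ((M - s.nreg 12) + (M - s.nreg 13)) + 800 := by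
  obtain ⟨hcor, hlist, hsize, hdist, ⟨m, hm⟩, hroots, hbest, hlow, hbef, haft⟩ := hs
  set t := s.nreg 6 with ht
  have hl := hlow hb
  have hl1 := hl.le
  have hl2 := hl.lt
  have ht1 : 1 ≤ t := by rw [hm]; omega
  have hdt : h ∣ t := ⟨1 + 2 * m, by rw [hm]; ring⟩
  have hnext : Treated h t (t + h) := Treated.next hm
  obtain ⟨bh, hbh⟩ : ∃ bh, bh = if s.nreg 11 < s.nreg 6 + s.nreg 5 then s.nreg 11 - 1
      else s.narr 3 (s.nreg 6 + s.nreg 5) := ⟨_, rfl⟩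
  obtain ⟨ch, hch⟩ : ∃ ch, ch = if s.nreg 11 < s.nreg 6 + s.nreg 5 then s.nreg 11 - 1
      else s.narr 4 (s.nreg 6 + s.nreg 5) := ⟨_, rfl⟩
  have hbh' := hbh
  have hch' := hch
  rw [hsize, hdist, ← ht] at hbh' hch'
  have hnextEq : t + h ≤ M → bh = s.narr 3 (t + h) ∧ ch = s.narr 4 (t + h) := fun hle => by
    rw [if_neg (by omega)] at hbh' hch'
    exact ⟨hbh', hch'⟩
  -- The upper bounds are the results at the next multiple of `2 * h`, known from earlier levels, or
  -- the last corner if there is no such position.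
  have hu : RootUpper (corner s₀) M (t - 1) bh ch ∧ s.nreg 12 ≤ bh ∧ s.nreg 13 ≤ ch := by
    by_cases hle : t + h ≤ M
    · obtain ⟨rfl, rfl⟩ := hnextEq hle
      exact ⟨(hroots.opt _ hnext (by omega) hle).rootUpper hv (by omega),
        haft _ hnext (by omega) hle⟩
    · rw [if_pos (by omega)] at hbh' hch'
      subst hbh' hch'
      exact ⟨RootUpper.last (by omega), by omega, by omega⟩
  obtain ⟨hu, hbl, hcl⟩ := hu
  have hu1 := hu.le
  have hu2 := hu.lt
  refine (wp_rootStep (by rwa [hcor, hsize]) ht1 hbh hch (by rwa [hcor, hsize])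
    (by rwa [hcor, hsize]) hbl hcl (by
      rw [hsize]; exact hbest.congr hcor hlist)).frame.mono ?_
  rintro T s' ⟨⟨hT, h6, h12, h13, hbest', hg, bb, bc, h3, h4, hopt, k1, k2, k3, k4, hle⟩, hf⟩
  rw [← ht] at h6 h3 h4 hopt hle
  rw [hcor, hsize] at hopt
  rw [hcor] at hle
  rw [hsize] at hbest'
  rw [hdist] at h6
  have hlist' : s'.narr 2 = s₀.narr 2 := (hf.narr 2 (by decide)).trans hlist
  have hupp : ∀ u, Treated h t u → t < u → u ≤ M → bh ≤ s.narr 3 u ∧ ch ≤ s.narr 4 u := by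
    intro u hu' htu huM
    have h5 := le_of_dvd_of_lt hdt hu'.dvd htu
    obtain ⟨rfl, rfl⟩ := hnextEq (by omega)
    exact hroots.mono _ _ hnext hu' (by omega) h5 huM
  have hroots' := hroots.insert hbef hupp hopt k1 k2 k3 k4 hg hle
  rw [← h3, ← h4] at hroots'
  refine ⟨⟨?_, hlist', (hf.nreg 11 (by decide)).trans hsize, (hf.nreg 5 (by decide)).trans hdist,
    ⟨m + 1, by rw [h6, hm]; ring⟩, ?_, ?_, fun hM => ?_, fun u hu' hu1 hut huM => ?_,
    fun u hu' hut huM => ?_⟩, h6, ?_⟩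
  · rw [corner_congr (hf.narr 2 (by decide)) (hf.rarr 3 (by decide)) (hf.rarr 4 (by decide)),
      hcor]
  · refine hroots'.congr fun u _ _ hu' => ?_
    rw [h6] at hu'
    exact hu'.of_next hm
  · exact hbest'.congr hcor.symm hlist.symm
  · rw [h12, h13]
    obtain ⟨rfl, rfl⟩ := hnextEq (by omega)
    exact (hroots.opt _ hnext (by omega) (by omega)).rootLower hv (by omega)
  · rw [h6] at hu' hut
    rw [h12, h13, h3, h4]
    rcases eq_or_ne u t with rfl | hne
    · simp only [Function.update_self]
      exact ⟨k2, k4⟩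
    · simp only [Function.update_of_ne hne]
      have hD := (hu'.of_next hm).resolve_right hne
      rcases lt_or_gt_of_ne hne with hlt | hgt
      · obtain ⟨h7, h8⟩ := hbef u hD hu1 hlt huM
        omega
      · have h5 := le_of_dvd_of_lt hdt hD.dvd hgt
        rcases h5.eq_or_lt with h9 | h9
        · obtain ⟨h10, h11⟩ := hnextEq (by omega)
          rw [h10, h11, h9]
          exact ⟨le_rfl, le_rfl⟩
        · have := le_of_dvd_of_lt (hdt.add (dvd_refl h)) hD.dvd h9
          omega
  · rw [h6] at hu' hut
    rw [h12, h13, h3, h4]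
    have hne : u ≠ t := by omega
    simp only [Function.update_of_ne hne]
    exact hupp u ((hu'.of_next hm).resolve_right hne) (by omega) huM
  · rw [h12, h13]
    omega

theorem wp_levelPass {s₀ s : RamState} {M h : ℕ} (hv : StrictPolygon (corner s₀) M)
    (hh : 0 < h) (hcor : corner s = corner s₀) (hlist : s.narr 2 = s₀.narr 2)
    (hsize : s.nreg 11 = M) (hdist : s.nreg 5 = h)
    (hroots : Roots (corner s₀) M (s.narr 3) (s.narr 4) (fun u => 2 * h ∣ u) (s.rreg 0))
    (hbest : BestTriangle s₀ M (s.rreg 0) (s.nreg 1) (s.nreg 2) (s.nreg 3)) :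
    wp levelPass s fun t s' => t ≤ 1400 * M + 100 ∧
      Roots (corner s₀) M (s'.narr 3) (s'.narr 4) (fun u => h ∣ u) (s'.rreg 0) ∧
      BestTriangle s₀ M (s'.rreg 0) (s'.nreg 1) (s'.nreg 2) (s'.nreg 3) := by
  simp only [levelPass, wp_block_cons, wp_block_one, wp_setN, NExp.eval, NExp.cost]
  have htr : ∀ u, 1 ≤ u → u ≤ M → Treated h h u → 2 * h ∣ u := by
    rintro u hu _ (hu' | ⟨hd, hlt⟩)
    · exact hu'
    · exact absurd (Nat.le_of_dvd hu hd) (by omega)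
  -- The first term is the full potential of the two bounds; 850 covers the constant cost of a
  -- position with its loop test.
  refine (wp_loop (b := .nlt (.reg 6) (.succ 11)) (c := rootStep) (d := 250 * (M + M) + 850 * (M + 1 - h) + 50)
    (Q := fun s' => Level s₀ M h s' ∧ M < s'.nreg 6)
    (fun d s' => Level s₀ M h s' ∧
      d = 250 * ((M - s'.nreg 12) + (M - s'.nreg 13)) + 850 * (M + 1 - s'.nreg 6) + 50)
    ?_ ?_ ?_).mono ?_
  · rintro d s' ⟨hL, rfl⟩ hb
    simp only [BExp.Holds, NExp.eval, NExp.eval_succ, hL.size] at hb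
    exact ⟨by simp only [BExp.cost, NExp.cost, NExp.cost_succ]; omega, hL, by omega⟩
  · rintro d s' ⟨hL, rfl⟩ hb
    simp only [BExp.Holds, NExp.eval, NExp.eval_succ, hL.size] at hb
    refine (wp_rootStep_level hv hh hL (by omega)).mono ?_
    rintro t s'' ⟨hL', h6, ht⟩
    refine ⟨_, ⟨hL', rfl⟩, ?_⟩
    simp only [BExp.cost, NExp.cost, NExp.cost_succ]
    omega
  · have hd : ∀ u, Treated h h u → 1 ≤ u → u < h → u ≤ M → False := by
      intro u hu hu1 hlt _
      exact absurd (Nat.le_of_dvd hu1 hu.dvd) (by omega)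
    refine ⟨⟨?_, hlist, by simpa using hsize, by simpa using hdist, ⟨0, by simp [hdist]⟩, ?_, ?_,
      ?_, ?_, ?_⟩, ?_⟩
    · exact hcor
    · simpa [hdist] using hroots.congr htr
    · simpa using hbest
    · intro hM
      simp [hdist] at hM ⊢
      exact RootLower.zero (by omega)
    · intro u hu hu1 hlt huM
      simp [hdist] at hu hlt
      exact (hd u hu hu1 hlt huM).elim
    · intro u hu hlt huM
      simp
    · simp [hdist]
  · rintro t s' ⟨ht, hL, hM⟩
    refine ⟨by omega, hL.roots.congr fun u _ hu hd => Or.inr ⟨hd, by omega⟩, hL.best⟩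

/-- Register `4` starts at a power of two above `M`, which divides no position in `[1, M]`, so
nothing has to be known at first. It is halved until it is 1 and divides all positions. Positions
are shifted by one because 0 is a multiple of everything. -/
theorem wp_searchPolygon {s : RamState} {M : ℕ} (hM : 1 ≤ M) (hsize : s.nreg 11 = M)
    (hv : StrictPolygon (corner s) M) :
    wp searchPolygon s fun t s' => t ≤ (1400 * M + 200) * (Nat.log 2 M + 3) ∧
      BestTriangle s M (s'.rreg 0) (s'.nreg 1) (s'.nreg 2) (s'.nreg 3) ∧
      ∀ i j k, i ≤ j → j ≤ k → k < M →
        orient (corner s i) (corner s j) (corner s k) ≤ s'.rreg 0 := by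
  simp only [searchPolygon, wp_block_cons, wp_block_one]
  rw [wp_setN, wp_setN, wp_setN, wp_setR, wp_setN]
  simp only [NExp.eval, RExp.eval, NExp.cost, RExp.cost]
  have hlog : 2 ^ Nat.log 2 M ≤ M := Nat.pow_log_le_self 2 (by omega)
  refine (wp_loop (b := .nlt (.reg 4) (.succ 11)) (c := .setN 4 (.add (.reg 4) (.reg 4)))
    (d := 20 * (Nat.log 2 M + 1) + 10)
    (Q := fun s' => M < s'.nreg 4 ∧ ∃ j ≤ Nat.log 2 M + 1, s'.nreg 4 = 2 ^ j)
    (fun d s' => s'.nreg 11 = M ∧ ∃ j ≤ Nat.log 2 M + 1, s'.nreg 4 = 2 ^ j ∧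
      d = 20 * (Nat.log 2 M + 1 - j) + 10) ?_ ?_ ?_).frame.mono ?_
  · rintro d s' ⟨h11, j, hj, h4, rfl⟩ hb
    simp only [BExp.Holds, NExp.eval, NExp.eval_succ, h11] at hb
    exact ⟨by simp only [BExp.cost, NExp.cost, NExp.cost_succ]; omega, by omega, j, hj, h4⟩
  · rintro d s' ⟨h11, j, hj, h4, rfl⟩ hb
    simp only [BExp.Holds, NExp.eval, NExp.eval_succ, h11] at hb
    have hj' : j ≤ Nat.log 2 M := Nat.le_log_of_pow_le (by norm_num) (by omega)
    simp only [wp_setN, NExp.eval, NExp.cost, BExp.cost, NExp.cost_succ]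
    refine ⟨_, ⟨by simp [h11], j + 1, by omega, by simp [h4, pow_succ, mul_two], rfl⟩, by omega⟩
  · exact ⟨by simpa using hsize, 0, by omega, by simp, by simp⟩
  rintro t₁ s₁ ⟨⟨ht₁, hbig, j₀, hj₀, h4₁⟩, hf₁⟩
  have hcor₁ : corner s₁ = corner s :=
    corner_congr (by rw [hf₁.narr 2 (by decide)]) (by rw [hf₁.rarr 3 (by decide)])
      (by rw [hf₁.rarr 4 (by decide)])
  have hlist₁ : s₁.narr 2 = s.narr 2 := by rw [hf₁.narr 2 (by decide)]
  refine (wp_loop (b := .nlt (.const 1) (.reg 4))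
    (c := .block [.setN 5 (.half (.reg 4)), levelPass, .setN 4 (.reg 5)])
    (d := (1400 * M + 200) * j₀ + 10)
    (Q := fun s' => Roots (corner s) M (s'.narr 3) (s'.narr 4) (fun _ => True) (s'.rreg 0) ∧
      BestTriangle s M (s'.rreg 0) (s'.nreg 1) (s'.nreg 2) (s'.nreg 3))
    (fun d s' => corner s' = corner s ∧ s'.narr 2 = s.narr 2 ∧ s'.nreg 11 = M ∧
      Roots (corner s) M (s'.narr 3) (s'.narr 4) (fun u => s'.nreg 4 ∣ u) (s'.rreg 0) ∧
      BestTriangle s M (s'.rreg 0) (s'.nreg 1) (s'.nreg 2) (s'.nreg 3) ∧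
      ∃ j, s'.nreg 4 = 2 ^ j ∧ d = (1400 * M + 200) * j + 10) ?_ ?_ ?_).mono ?_
  · rintro d s' ⟨-, -, -, hroots, hbest, j, h4, rfl⟩ hb
    simp only [BExp.Holds, NExp.eval] at hb
    have : s'.nreg 4 = 1 := by
      have : 0 < s'.nreg 4 := by rw [h4]; positivity
      omega
    exact ⟨by simp only [BExp.cost, NExp.cost]; omega,
      hroots.congr fun u _ _ _ => this ▸ one_dvd u, hbest⟩
  · rintro d s' ⟨hcor, hlist, h11, hroots, hbest, j, h4, rfl⟩ hb
    simp only [BExp.Holds, NExp.eval] at hb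
    obtain ⟨i, rfl⟩ : ∃ i, j = i + 1 := by
      refine ⟨j - 1, ?_⟩
      have : j ≠ 0 := by
        rintro rfl
        omega
      omega
    have hhalf : s'.nreg 4 / 2 = 2 ^ i := by rw [h4, pow_succ]; omega
    have h4' : s'.nreg 4 = 2 * 2 ^ i := by rw [h4, pow_succ]; omega
    simp only [wp_block_cons, wp_block_one, wp_setN, NExp.eval, NExp.cost]
    refine (wp_levelPass (s₀ := s)
      (s := { s' with nreg := Function.update s'.nreg 5 (s'.nreg 4 / 2) }) (M := M)
      (h := 2 ^ i) hv (by positivity) hcor hlist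
      (by simpa using h11) (by simpa using hhalf) (by simpa [h4'] using hroots)
      (by simpa using hbest)).frame.mono ?_
    rintro t s'' ⟨⟨ht, hroots', hbest'⟩, hf⟩
    have h5 : s''.nreg 5 = 2 ^ i := by rw [hf.nreg 5 (by decide)]; simpa using hhalf
    refine ⟨_, ⟨?_, ?_, ?_, ?_, ?_, i, by simp [h5], rfl⟩, ?_⟩
    · rw [← hcor]
      exact corner_congr (hf.narr 2 (by decide)) (hf.rarr 3 (by decide)) (hf.rarr 4 (by decide))
    · rw [← hlist]
      exact hf.narr 2 (by decide)
    · simp only [ne_eq, Function.update_of_ne, show (11 : ℕ) ≠ 4 by decide, not_false_eq_true]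
      rw [hf.nreg 11 (by decide)]
      simpa using h11
    · simpa [h5] using hroots'
    · simpa using hbest'
    · simp only [BExp.cost, NExp.cost, Nat.mul_add, Nat.mul_one]
      omega
  · refine ⟨hcor₁, hlist₁, ?_, ⟨fun u hu hu1 huM => ?_, fun u u' hu hu' hu1 huu huM => ?_,
      fun u hu hu1 huM => ?_⟩, Or.inl ⟨?_, ?_, ?_, ?_⟩, j₀, h4₁, rfl⟩
    · rw [hf₁.nreg 11 (by decide)]
      simpa using hsize
    · exact absurd (Nat.le_of_dvd hu1 hu) (by omega)
    · exact absurd (Nat.le_of_dvd hu1 hu) (by omega)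
    · exact absurd (Nat.le_of_dvd hu1 hu) (by omega)
    · rw [hf₁.rreg 0 (by decide)]
      simp
    · rw [hf₁.nreg 1 (by decide)]
      simp
    · rw [hf₁.nreg 2 (by decide)]
      simp
    · rw [hf₁.nreg 3 (by decide)]
      simp
  · rintro t s' ⟨ht, hroots, hbest⟩
    refine ⟨?_, hbest, fun i j k hij hjk hk => ?_⟩
    · have : (1400 * M + 200) * j₀ ≤ (1400 * M + 200) * (Nat.log 2 M + 1) :=
        Nat.mul_le_mul_left _ hj₀
      have h20 : 20 * (Nat.log 2 M + 1) ≤ 20 * (M + 1) := by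
        have := Nat.log_le_self 2 M
        omega
      simp only [Nat.mul_add, Nat.mul_one] at this ⊢
      omega
    · have h1 := (hroots.opt (i + 1) trivial (by omega) (by omega)).opt j k hij hjk hk
      have h2 := hroots.best (i + 1) trivial (by omega) (by omega)
      simp only [Nat.add_sub_cancel] at h1 h2
      exact h1.trans h2

/-! ### The polygon program -/

section

variable {S U : ℕ → ℝ × ℝ} {s t : ℕ} {Q : Set (ℝ × ℝ)}

/-- `S s` is the lowest and `-U 0` the highest among the rightmost points, so comparing ordinates
decides whether they coincide. -/
theorem LowerChain.last_eq (h : LowerChain S s Q) (h' : LowerChain U t (-Q))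
    (hy : (-U 0).2 ≤ (S s).2) : S s = -U 0 := by
  have h1 := h.mem s le_rfl
  have h2 : -U 0 ∈ Q := h'.mem 0 (Nat.zero_le _)
  have h3 := h.last_le _ h2
  have h4 := h'.first_le (-S s) (by simpa using h1)
  simp only [Prod.fst_neg, Prod.snd_neg] at *
  have hx : (S s).1 = -(U 0).1 := by linarith
  have h5 := h'.first_low (-S s) (by simpa using h1) (by simp only [Prod.fst_neg]; linarith)
  simp only [Prod.snd_neg] at h5
  exact Prod.ext hx (by simp only [Prod.snd_neg]; linarith)

theorem LowerChain.first_eq (h : LowerChain S s Q) (h' : LowerChain U t (-Q))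
    (hy : (-U t).2 ≤ (S 0).2) : S 0 = -U t := by
  have h1 := h.mem 0 (Nat.zero_le _)
  have h2 : -U t ∈ Q := h'.mem t le_rfl
  have h3 := h.first_le _ h2
  have h4 := h'.last_le (-S 0) (by simpa using h1)
  simp only [Prod.fst_neg, Prod.snd_neg] at *
  have hx : (S 0).1 = -(U t).1 := by linarith
  have h5 := h.first_low (-U t) h2 (by simp only [Prod.fst_neg]; linarith)
  simp only [Prod.snd_neg] at h5
  exact Prod.ext hx (by simp only [Prod.snd_neg]; linarith)

end

/-- Appending the upper chain in the index array `5` to the lower chain in the index array `2`,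
without repeating the ends. -/
def joinChains : Prog :=
  .block [
    .ite (.rlt (.get 4 (.get 2 (.sub (.reg 11) (.const 1)))) (.get 4 (.get 5 (.const 0))))
      (.setN 5 (.const 0)) (.setN 5 (.const 1)),
    .ite (.rlt (.get 4 (.get 2 (.const 0))) (.get 4 (.get 5 (.reg 7))))
      (.setN 8 (.succ 7)) (.setN 8 (.reg 7)),
    .loop (.nlt (.reg 5) (.reg 8))
      (.block [.putN 2 (.reg 11) (.get 5 (.reg 5)), .setN 11 (.succ 11), .setN 5 (.succ 5)])]

theorem wp_appendLoop (s : RamState) :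
    wp (.loop (.nlt (.reg 5) (.reg 8))
      (.block [.putN 2 (.reg 11) (.get 5 (.reg 5)), .setN 11 (.succ 11), .setN 5 (.succ 5)])) s
      fun t s' => t ≤ 30 * (s.nreg 8 - s.nreg 5) + 30 ∧
        s'.nreg 11 = s.nreg 11 + (s.nreg 8 - s.nreg 5) ∧
        (∀ i < s.nreg 11, s'.narr 2 i = s.narr 2 i) ∧
        ∀ i, s.nreg 11 ≤ i → i < s'.nreg 11 →
          s'.narr 2 i = s.narr 5 (i - s.nreg 11 + s.nreg 5) := by
  refine (wp_loop_count (fun s' => s'.nreg 8 = s.nreg 8 ∧ s'.narr 5 = s.narr 5 ∧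
    -- The second alternative covers an empty range with register `5` beyond register `8`, which
    -- occurs if all points coincide.
    s.nreg 5 ≤ s'.nreg 5 ∧ (s'.nreg 5 ≤ s.nreg 8 ∨ s'.nreg 5 = s.nreg 5) ∧
    s'.nreg 11 = s.nreg 11 + (s'.nreg 5 - s.nreg 5) ∧
    (∀ i < s.nreg 11, s'.narr 2 i = s.narr 2 i) ∧
    ∀ i, s.nreg 11 ≤ i → i < s'.nreg 11 →
      s'.narr 2 i = s.narr 5 (i - s.nreg 11 + s.nreg 5))
    (fun s' => s.nreg 8 - s'.nreg 5) 30 (by simp [BExp.cost, NExp.cost]) ?_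
    ⟨rfl, rfl, le_rfl, Or.inr rfl, by omega, fun _ _ => rfl, fun i h1 h2 => by omega⟩).mono ?_
  · rintro s' ⟨h8, ha, hle, hor, h11, hold, hnew⟩ hb
    simp only [BExp.Holds, NExp.eval] at hb
    simp only [wp_block_cons, wp_block_one, wp_putN, wp_setN, NExp.eval, NExp.cost, BExp.cost,
      NExp.eval_succ, NExp.cost_succ]
    refine ⟨⟨by simp [h8], by simp [ha], by simp; omega, by simp; omega, by simp; omega, ?_, ?_⟩,
      by simp; omega, by omega⟩
    · intro i hi
      have hne : i ≠ s'.nreg 11 := by omega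
      simp [hne, hold i hi]
    · intro i hi hi'
      simp at hi'
      by_cases hne : i = s'.nreg 11
      · subst hne
        simp [ha]
        congr 1
        omega
      · simp [hne]
        exact hnew i hi (by omega)
  · rintro t s' ⟨ht, ⟨h8, ha, hle, hor, h11, hold, hnew⟩, hb⟩
    simp only [BExp.Holds, NExp.eval] at hb
    exact ⟨ht, by omega, hold, hnew⟩

theorem wp_joinChains {s : RamState} {k : ℕ} (hk : s.nreg 11 = k + 1) {U : ℕ → ℝ × ℝ}
    {Q : Set (ℝ × ℝ)}
    (hU : ∀ j ≤ s.nreg 7, vertex s 3 4 (s.narr 5 j) = -U j)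
    (h : LowerChain (corner s) k Q) (h' : LowerChain U (s.nreg 7) (-Q)) :
    wp joinChains s fun t s' => t ≤ 30 * s.nreg 7 + 120 ∧
      (∃ a b, JoinedChains (corner s) U k (s.nreg 7) a b (s'.nreg 11)
        (fun i => vertex s 3 4 (s'.narr 2 i))) ∧
      ∀ i < s'.nreg 11, (∃ j ≤ k, s'.narr 2 i = s.narr 2 j) ∨
        ∃ j ≤ s.nreg 7, s'.narr 2 i = s.narr 5 j := by
  have key : ∀ (a b : ℕ) (s₁ : RamState), s₁.narr = s.narr → s₁.nreg 11 = k + 1 →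
      s₁.nreg 5 = a → s₁.nreg 8 = s.nreg 7 + 1 - b →
      ((a = 0 ∧ corner s k ≠ -U 0) ∨ (a = 1 ∧ corner s k = -U 0)) →
      ((b = 0 ∧ corner s 0 ≠ -U (s.nreg 7)) ∨ (b = 1 ∧ corner s 0 = -U (s.nreg 7))) →
      wp (.loop (.nlt (.reg 5) (.reg 8))
        (.block [.putN 2 (.reg 11) (.get 5 (.reg 5)), .setN 11 (.succ 11), .setN 5 (.succ 5)])) s₁
        fun t s' => t ≤ 30 * s.nreg 7 + 60 ∧
          (∃ a b, JoinedChains (corner s) U k (s.nreg 7) a b (s'.nreg 11)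
            (fun i => vertex s 3 4 (s'.narr 2 i))) ∧
          ∀ i < s'.nreg 11, (∃ j ≤ k, s'.narr 2 i = s.narr 2 j) ∨
            ∃ j ≤ s.nreg 7, s'.narr 2 i = s.narr 5 j := by
    intro a b s₁ hn h11 h5 h8 ha hb
    refine (wp_appendLoop s₁).mono ?_
    rintro t s' ⟨ht, hM, hold, hnew⟩
    rw [h11, h8, h5] at hM
    rw [h8, h5] at ht
    rw [h11, hn] at hold
    rw [h11, hn, h5] at hnew
    refine ⟨by omega, ⟨a, b, fun i hi => ?_, fun i hi hiM => ?_, by omega, ha, hb⟩,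
      fun i hi => ?_⟩
    · simp only [hold i (by omega)]
      rfl
    · simp only [hnew i (by omega) hiM]
      exact hU _ (by omega)
    · by_cases hik : i ≤ k
      · exact Or.inl ⟨i, hik, hold i (by omega)⟩
      · exact Or.inr ⟨_, by omega, hnew i (by omega) hi⟩
  have hk' : s.nreg 11 - 1 = k := by omega
  have h0 : (-U 0).2 = s.rarr 4 (s.narr 5 0) := by rw [← hU 0 (Nat.zero_le _)]; rfl
  have ht : (-U (s.nreg 7)).2 = s.rarr 4 (s.narr 5 (s.nreg 7)) := by
    rw [← hU _ le_rfl]; rfl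
  have ha : s.rarr 4 (s.narr 2 k) < s.rarr 4 (s.narr 5 0) → corner s k ≠ -U 0 := by
    intro hlt he
    have := congrArg Prod.snd he
    rw [h0] at this
    exact hlt.ne this
  have ha' : ¬ s.rarr 4 (s.narr 2 k) < s.rarr 4 (s.narr 5 0) → corner s k = -U 0 :=
    fun hge => h.last_eq h' (by rw [h0]; exact not_lt.1 hge)
  have hb : s.rarr 4 (s.narr 2 0) < s.rarr 4 (s.narr 5 (s.nreg 7)) →
      corner s 0 ≠ -U (s.nreg 7) := by
    intro hlt he
    have := congrArg Prod.snd he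
    rw [ht] at this
    exact hlt.ne this
  have hb' : ¬ s.rarr 4 (s.narr 2 0) < s.rarr 4 (s.narr 5 (s.nreg 7)) →
      corner s 0 = -U (s.nreg 7) :=
    fun hge => h.first_eq h' (by rw [ht]; exact not_lt.1 hge)
  simp only [joinChains, wp_block_cons, wp_block_one, wp_ite, wp_setN, BExp.Holds, RExp.eval,
    BExp.cost, RExp.cost, NExp.cost, NExp.eval, NExp.eval_succ, NExp.cost_succ, hk']
  have e75 : (7 : ℕ) ≠ 5 := by decide
  simp only [Function.update_of_ne e75]
  refine ⟨fun h1 => ⟨fun h2 => ?_, fun h2 => ?_⟩, fun h1 => ⟨fun h2 => ?_, fun h2 => ?_⟩⟩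
  · refine (key 0 0 _ ?_ ?_ ?_ ?_ (Or.inl ⟨rfl, ha h1⟩)
      (Or.inl ⟨rfl, hb h2⟩)).mono ?_
    · rfl
    · simp [hk]
    · simp
    · simp
    rintro t s' ⟨ht, hQ⟩
    exact ⟨by omega, hQ⟩
  · refine (key 0 1 _ ?_ ?_ ?_ ?_ (Or.inl ⟨rfl, ha h1⟩)
      (Or.inr ⟨rfl, hb' h2⟩)).mono ?_
    · rfl
    · simp [hk]
    · simp
    · simp
    rintro t s' ⟨ht, hQ⟩
    exact ⟨by omega, hQ⟩
  · refine (key 1 0 _ ?_ ?_ ?_ ?_ (Or.inr ⟨rfl, ha' h1⟩)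
      (Or.inl ⟨rfl, hb h2⟩)).mono ?_
    · rfl
    · simp [hk]
    · simp
    · simp
    rintro t s' ⟨ht, hQ⟩
    exact ⟨by omega, hQ⟩
  · refine (key 1 1 _ ?_ ?_ ?_ ?_ (Or.inr ⟨rfl, ha' h1⟩)
      (Or.inr ⟨rfl, hb' h2⟩)).mono ?_
    · rfl
    · simp [hk]
    · simp
    · simp
    rintro t s' ⟨ht, hQ⟩
    exact ⟨by omega, hQ⟩

/-- The convex hull of the points in the real arrays `3` and `4`, whose opposites are in the real
arrays `5` and `6`. -/
def hullProgram : Prog :=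
  .block [
    mergeSort,
    chainScan 3 4 2 (.get 0 (.reg 5)),
    .setN 11 (.succ 7),
    -- Negation reverses the order of abscissae, so the sorted list is read backwards, from position
    -- `n - 1`.
    chainScan 5 6 5 (.get 0 (.sub (.sub (.reg 0) (.const 1)) (.reg 5))),
    joinChains]

/-- Sorting uses abscissae only; ties in arbitrary order are harmless since the scan handles equal
abscissae itself. -/
theorem wp_hullProgram {s : RamState} {n : ℕ} (hn : s.nreg 0 = n) (hpos : 0 < n)
    (hid : ∀ i < n, s.narr 0 i = i) (h5 : ∀ i < n, s.rarr 5 i = -s.rarr 3 i)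
    (h6 : ∀ i < n, s.rarr 6 i = -s.rarr 4 i) :
    wp hullProgram s fun t s' =>
      t ≤ (300 * n + 310) * (Nat.clog 2 n + 1) + 1000 * n + 500 ∧
      1 ≤ s'.nreg 11 ∧ s'.nreg 11 ≤ 2 * n ∧ StrictPolygon (corner s') (s'.nreg 11) ∧
      (∀ i < s'.nreg 11, s'.narr 2 i < n) ∧
      ∀ i < n, vertex s 3 4 i ∈ convexHull ℝ (corner s' '' Set.Iio (s'.nreg 11)) := by
  simp only [hullProgram, wp_block_cons, wp_block_one]
  refine (wp_mergeSort s).frame.mono ?_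
  rintro t₁ s₁ ⟨⟨ht₁, hsame, hsort⟩, hf₁⟩
  rw [hn] at ht₁ hsame hsort
  have hr₁ : s₁.rarr = s.rarr := funext fun a => hf₁.rarr a (by
    simp [mergeSort, mergePass, mergeBlock, mergeStep, Prog.block, Prog.rarrs])
  have hn₁ : s₁.nreg 0 = n := (hf₁.nreg 0 (by decide)).trans hn
  set A := s₁.narr 0 with hA
  have hAlt : ∀ i < n, A i < n := by
    intro i hi
    obtain ⟨q, hq, he⟩ := hsame.1 i hi
    rw [he, hid q hq]
    exact hq
  have hAsurj : ∀ i < n, ∃ p < n, A p = i := by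
    intro i hi
    obtain ⟨p, hp, he⟩ := hsame.2 i hi
    exact ⟨p, hp, he.trans (hid i hi)⟩
  have hv₁ : ∀ xa ya, vertex s₁ xa ya = vertex s xa ya := by
    intro xa ya; funext i; simp only [vertex, hr₁]
  set Q : Set (ℝ × ℝ) := vertex s 3 4 '' Set.Iio n with hQ
  have hQ₁ : (fun i => vertex s 3 4 (A i)) '' Set.Iio n = Q := by
    ext z
    constructor
    · rintro ⟨i, hi, rfl⟩
      exact ⟨A i, hAlt i hi, rfl⟩
    · rintro ⟨i, hi, rfl⟩
      obtain ⟨p, hp, he⟩ := hAsurj i hi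
      exact ⟨p, hp, by simp only [he]⟩
  have hneg : ∀ i < n, vertex s 5 6 i = -vertex s 3 4 i := by
    intro i hi
    exact Prod.ext (h5 i hi) (h6 i hi)
  have hQ₂ : (fun i => vertex s 5 6 (A (n - 1 - i))) '' Set.Iio n = -Q := by
    ext z
    constructor
    · rintro ⟨i, hi, rfl⟩
      simp only [Set.mem_Iio] at hi
      have h := hAlt (n - 1 - i) (by omega)
      simp only [hneg _ h, Set.mem_neg, neg_neg]
      exact ⟨_, h, rfl⟩
    · rintro ⟨i, hi, hz⟩
      obtain ⟨p, hp, he⟩ := hAsurj i hi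
      refine ⟨n - 1 - p, by simp only [Set.mem_Iio]; omega, ?_⟩
      have hpp : n - 1 - (n - 1 - p) = p := by omega
      simp only [hpp, he, hneg i hi, hz, neg_neg]
  refine (wp_chainScan (s := s₁) (f := A) (P := fun i => i < n) (by decide)
    (by simp [NExp.cost]) (by omega) (fun s' _ ha => by simp only [NExp.eval, ha, hA]) ?_
    (by rwa [hn₁])).frame.mono ?_
  · intro i j hij hj
    rw [hv₁]
    exact hsort i j hij (by omega)
  rintro t₂ s₂ ⟨⟨ht₂, htop₂, hC₂, hP₂⟩, hf₂⟩
  rw [hn₁, hv₁, hQ₁] at hC₂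
  rw [hn₁] at ht₂ htop₂
  rw [wp_setN]
  set s₃ : RamState := { s₂ with nreg := Function.update s₂.nreg 11 (NExp.eval s₂ (.succ 7)) }
    with hs₃
  have hr₃ : s₃.rarr = s.rarr := (funext fun a => hf₂.rarr a (by
    simp [chainScan, chainRound, popLoop, Prog.block, Prog.rarrs])).trans hr₁
  have hn₃ : s₃.nreg 0 = n := by
    rw [← hn₁, ← hf₂.nreg 0 (by simp [chainScan, chainRound, popLoop, Prog.block, Prog.nregs])]
    simp [hs₃]
  have ha₃ : s₃.narr 0 = A :=
    hf₂.narr 0 (by simp [chainScan, chainRound, popLoop, Prog.block, Prog.narrs])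
  have h11₃ : s₃.nreg 11 = s₂.nreg 7 + 1 := by simp [hs₃, NExp.eval_succ]
  have hv₃ : ∀ xa ya, vertex s₃ xa ya = vertex s xa ya := by
    intro xa ya; funext i; simp only [vertex, hr₃]
  refine (wp_chainScan (s := s₃) (f := fun i => A (n - 1 - i)) (P := fun i => i < n) (by decide)
    (by simp [NExp.cost]) (by omega) (fun s' h0 ha => by
      simp only [NExp.eval, ha, ha₃, h0, hn₃]) ?_ ?_).frame.mono ?_
  · intro i j hij hj
    rw [hn₃] at hj
    rw [hv₃]
    simp only [hneg _ (hAlt (n - 1 - i) (by omega)), hneg _ (hAlt (n - 1 - j) (by omega)),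
      Prod.fst_neg]
    exact neg_le_neg (hsort _ _ (by omega) (by omega))
  · intro i hi
    exact hAlt _ (by omega)
  rintro t₄ s₄ ⟨⟨ht₄, htop₄, hC₄, hP₄⟩, hf₄⟩
  rw [hn₃, hv₃] at hC₄
  simp only [hQ₂] at hC₄
  rw [hn₃] at ht₄ htop₄
  have hr₄ : s₄.rarr = s.rarr := (funext fun a => hf₄.rarr a (by
    simp [chainScan, chainRound, popLoop, Prog.block, Prog.rarrs])).trans hr₃
  have h11₄ : s₄.nreg 11 = s₂.nreg 7 + 1 := by
    rw [← h11₃]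
    exact hf₄.nreg 11 (by simp [chainScan, chainRound, popLoop, Prog.block, Prog.nregs])
  have ha₄ : s₄.narr 2 = s₂.narr 2 :=
    hf₄.narr 2 (by simp [chainScan, chainRound, popLoop, Prog.block, Prog.narrs])
  have hv₄ : ∀ xa ya, vertex s₄ xa ya = vertex s xa ya := by
    intro xa ya; funext i; simp only [vertex, hr₄]
  have hcor₄ : corner s₄ = fun j => vertex s 3 4 (s₂.narr 2 j) := by
    funext j; simp only [corner, hv₄, ha₄]
  refine (wp_joinChains (s := s₄) h11₄ (U := fun j => vertex s 5 6 (s₄.narr 5 j)) (Q := Q)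
    (fun j hj => by simp only [hv₄, hneg _ (hP₄ j hj), neg_neg]) (by rwa [hcor₄])
    hC₄).frame.mono ?_
  rintro t₅ s₅ ⟨⟨ht₅, ⟨a, b, hJ⟩, hent⟩, hf₅⟩
  have hr₅ : s₅.rarr = s.rarr := (funext fun a => hf₅.rarr a (by
    simp [joinChains, Prog.block, Prog.rarrs])).trans hr₄
  have hcor₅ : (fun i => vertex s₄ 3 4 (s₅.narr 2 i)) = corner s₅ := by
    funext j; simp only [corner, vertex, hr₄, hr₅]
  rw [hcor₅, hcor₄] at hJ
  have hsz := hJ.size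
  refine ⟨?_, by omega, by omega, fun i j k hij hjk hk => hJ.orient_pos hC₂ hC₄ hij hjk hk,
    fun i hi => ?_, fun i hi => hJ.subset_convexHull hC₂ hC₄ ⟨i, hi, rfl⟩⟩
  · simp only [NExp.cost_succ]
    omega
  · rcases hent i hi with ⟨j, hj, he⟩ | ⟨j, hj, he⟩
    · rw [he, ha₄]
      exact hP₂ j hj
    · rw [he]
      exact hP₄ j hj

/-! ### The placement program -/

/-- The test whether the segment `e` is a single point. -/
def BExp.isPoint (e : NExp) : BExp := .neg (.rlt (.get 1 e) (.get 2 e))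

/-- Stores in register `v` a single-point segment that is extreme with respect to the order `lt` of
the segments in the registers `5` and `v`. -/
def extremePoint (v : ℕ) (lt : BExp) : Prog :=
  .block [
    .setN v (.const 0),
    .setN 5 (.const 0),
    .loop (.nlt (.reg 5) (.reg 0)) (.block [
      .ite (.and (.isPoint (.reg 5)) (.neg (.and (.isPoint (.reg v)) (.neg lt))))
        (.setN v (.reg 5)) .skip,
      .setN 5 (.succ 5)])]

/-- The function `g` is the identity or negation and treats both extremes at once. The initial
candidate `0` need not be a point, hence the claim is conditional on the existence of a point
segment `i`. -/
theorem wp_extremePoint {v : ℕ} {lt : BExp} {g : ℝ → ℝ} (hv0 : v ≠ 0) (hv5 : v ≠ 5)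
    (hcost : lt.cost ≤ 10)
    (hlt : ∀ s, lt.Holds s ↔ g (s.rarr 0 (s.nreg 5)) < g (s.rarr 0 (s.nreg v)))
    {s : RamState} (hs : 0 < s.nreg 0) :
    wp (extremePoint v lt) s fun t s' => t ≤ 100 * s.nreg 0 + 120 ∧ s'.nreg v < s.nreg 0 ∧
      ∀ i < s.nreg 0, s.rarr 2 i ≤ s.rarr 1 i →
        s.rarr 2 (s'.nreg v) ≤ s.rarr 1 (s'.nreg v) ∧
        g (s.rarr 0 (s'.nreg v)) ≤ g (s.rarr 0 i) := by
  have hloop := @wp_loop_count (.nlt (.reg 5) (.reg 0)) (.block [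
      .ite (.and (.isPoint (.reg 5)) (.neg (.and (.isPoint (.reg v)) (.neg lt))))
        (.setN v (.reg 5)) .skip,
      .setN 5 (.succ 5)])
    (fun s' => s'.nreg 0 = s.nreg 0 ∧ s'.rarr = s.rarr ∧ s'.nreg 5 ≤ s.nreg 0 ∧
      s'.nreg v < s.nreg 0 ∧ ∀ i < s'.nreg 5, s.rarr 2 i ≤ s.rarr 1 i →
        s.rarr 2 (s'.nreg v) ≤ s.rarr 1 (s'.nreg v) ∧
        g (s.rarr 0 (s'.nreg v)) ≤ g (s.rarr 0 i))
    (fun s' => s.nreg 0 - s'.nreg 5) 100 (by simp [BExp.cost, NExp.cost]) ?_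
  · simp only [extremePoint, wp_block_cons, wp_block_one]
    rw [wp_setN, wp_setN]
    refine (hloop ?_).mono ?_
    · exact ⟨by simp [hv0.symm], rfl, by simp [NExp.eval], by simpa [hv5, NExp.eval],
        by simp [NExp.eval]⟩
    rintro t s' ⟨ht, ⟨h0, h1, h2, h3, h4⟩, hb⟩
    simp only [BExp.Holds, NExp.eval, not_lt, h0] at hb
    refine ⟨?_, h3, fun i hi => h4 i (by omega)⟩
    simp [NExp.eval, NExp.cost] at ht ⊢
    omega
  · rintro s' ⟨h0, h1, h2, h3, h4⟩ hb
    simp only [BExp.Holds, NExp.eval, h0] at hb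
    simp only [wp_block_cons, wp_block_one]
    rw [wp_ite]
    simp only [wp_setN, wp_skip, BExp.Holds, BExp.isPoint, RExp.eval, NExp.eval, h1, hlt, not_lt,
      BExp.cost, RExp.cost, NExp.cost, NExp.eval_succ, NExp.cost_succ]
    refine ⟨fun h => ?_, fun h => ?_⟩
    · refine ⟨⟨by simp [hv0.symm, h0], trivial, by simp [hv5.symm]; omega,
        by simpa [hv5] using hb, ?_⟩, by simp [hv5.symm]; omega, by omega⟩
      simp only [Function.update_self, Function.update_of_ne hv5, Function.update_of_ne hv5.symm]
      intro i hi hp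
      refine ⟨h.1, ?_⟩
      rcases Nat.lt_succ_iff_lt_or_eq.1 hi with hi | rfl
      · obtain ⟨h5, h6⟩ := h4 i hi hp
        by_contra hcon
        exact h.2 ⟨h5, h6.trans (not_le.1 hcon).le⟩
      · exact le_rfl
    · refine ⟨⟨by simp [h0], trivial, by simp; omega, by simpa [hv5] using h3, ?_⟩,
        by simp; omega, by omega⟩
      simp only [Function.update_self, Function.update_of_ne hv5]
      intro i hi hp
      rcases Nat.lt_succ_iff_lt_or_eq.1 hi with hi | rfl
      · exact h4 i hi hp
      · by_contra hcon
        exact h ⟨hp, hcon⟩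

/-- The point of the segment `(x, lo, hi)` that is closest to the chord of `a` and `b`. -/
noncomputable def clampOrdinate (a b : ℝ × ℝ) (x lo hi : ℝ) : ℝ :=
  max lo (min hi (chordAt a b x))

/-- The body of the loop of `placePoints`. -/
def placePoint : Prog :=
  .block [
    .setR 0 (.add (.get 1 (.reg 4)) (.div (.mul (.sub (.get 1 (.reg 6)) (.get 1 (.reg 4)))
      (.sub (.get 0 (.reg 5)) (.get 0 (.reg 4)))) (.sub (.get 0 (.reg 6)) (.get 0 (.reg 4))))),
    .ite (.rlt (.get 2 (.reg 5)) (.reg 0)) (.setR 0 (.get 2 (.reg 5))) .skip,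
    .ite (.rlt (.reg 0) (.get 1 (.reg 5))) (.setR 0 (.get 1 (.reg 5))) .skip,
    .putR 3 (.reg 5) (.get 0 (.reg 5)),
    .putR 4 (.reg 5) (.reg 0),
    .putR 5 (.reg 5) (.sub (.const 0) (.get 0 (.reg 5))),
    .putR 6 (.reg 5) (.sub (.const 0) (.reg 0)),
    .putN 0 (.reg 5) (.reg 5),
    .setN 5 (.succ 5)]

/-- Puts on every segment the point that is closest to the chord of the two segments in the
registers `4` and `6`. -/
def placePoints : Prog :=
  .block [.setN 5 (.const 0), .loop (.nlt (.reg 5) (.reg 0)) placePoint]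

theorem wp_placePoint {s : RamState} {c : ℝ}
    (hc : c = clampOrdinate (vertex s 0 1 (s.nreg 4)) (vertex s 0 1 (s.nreg 6))
      (s.rarr 0 (s.nreg 5)) (s.rarr 1 (s.nreg 5)) (s.rarr 2 (s.nreg 5)))
    (hle : s.rarr 1 (s.nreg 5) ≤ s.rarr 2 (s.nreg 5)) :
    wp placePoint s fun t s' => t ≤ 100 ∧ s'.nreg 5 = s.nreg 5 + 1 ∧
      s'.narr 0 = Function.update (s.narr 0) (s.nreg 5) (s.nreg 5) ∧
      s'.rarr 3 = Function.update (s.rarr 3) (s.nreg 5) (s.rarr 0 (s.nreg 5)) ∧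
      s'.rarr 4 = Function.update (s.rarr 4) (s.nreg 5) c ∧
      s'.rarr 5 = Function.update (s.rarr 5) (s.nreg 5) (-s.rarr 0 (s.nreg 5)) ∧
      s'.rarr 6 = Function.update (s.rarr 6) (s.nreg 5) (-c) := by
  simp only [clampOrdinate, chordAt, vertex] at hc
  simp only [placePoint, wp_block_cons, wp_block_one]
  rw [wp_setR, wp_ite]
  simp only [wp_ite, wp_setR, wp_skip, wp_putR, wp_putN, wp_setN, BExp.Holds, RExp.eval, NExp.eval,
    NExp.eval_succ, NExp.cost_succ, BExp.cost, RExp.cost, NExp.cost, Function.update_self, not_lt]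
  refine ⟨fun h1 => ⟨fun h2 => ?_, fun h2 => ?_⟩, fun h1 => ⟨fun h2 => ?_, fun h2 => ?_⟩⟩
  · exact absurd h2 hle.not_gt
  · rw [min_eq_left h1.le, max_eq_right h2] at hc
    simp [hc]
  · rw [min_eq_right h1, max_eq_left h2.le] at hc
    simp [hc]
  · rw [min_eq_right h1, max_eq_right h2] at hc
    simp [hc]

theorem wp_placePoints {s : RamState} (hle : ∀ i < s.nreg 0, s.rarr 1 i ≤ s.rarr 2 i)
    {c : ℕ → ℝ} (hc : ∀ i < s.nreg 0, c i = clampOrdinate (vertex s 0 1 (s.nreg 4))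
      (vertex s 0 1 (s.nreg 6)) (s.rarr 0 i) (s.rarr 1 i) (s.rarr 2 i)) :
    wp placePoints s fun t s' => t ≤ 110 * s.nreg 0 + 120 ∧ ∀ i < s.nreg 0,
      s'.narr 0 i = i ∧ s'.rarr 3 i = s.rarr 0 i ∧ s'.rarr 4 i = c i ∧
      s'.rarr 5 i = -s.rarr 0 i ∧ s'.rarr 6 i = -c i := by
  have hloop := @wp_loop_count (.nlt (.reg 5) (.reg 0)) placePoint
    (fun s' => s'.nreg 0 = s.nreg 0 ∧ s'.nreg 4 = s.nreg 4 ∧ s'.nreg 6 = s.nreg 6 ∧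
      s'.rarr 0 = s.rarr 0 ∧ s'.rarr 1 = s.rarr 1 ∧ s'.rarr 2 = s.rarr 2 ∧
      s'.nreg 5 ≤ s.nreg 0 ∧ ∀ i < s'.nreg 5,
      s'.narr 0 i = i ∧ s'.rarr 3 i = s.rarr 0 i ∧ s'.rarr 4 i = c i ∧
      s'.rarr 5 i = -s.rarr 0 i ∧ s'.rarr 6 i = -c i)
    (fun s' => s.nreg 0 - s'.nreg 5) 110 (by simp [BExp.cost, NExp.cost]) ?_
  · simp only [placePoints, wp_block_cons, wp_block_one]
    rw [wp_setN]
    refine (hloop ?_).mono ?_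
    · exact ⟨by simp, by simp, by simp, rfl, rfl, rfl, by simp [NExp.eval], by simp [NExp.eval]⟩
    rintro t s' ⟨ht, ⟨h0, -, -, -, -, -, -, h⟩, hb⟩
    simp only [BExp.Holds, NExp.eval, not_lt, h0] at hb
    refine ⟨?_, fun i hi => h i (by omega)⟩
    simp [NExp.eval, NExp.cost] at ht ⊢
    omega
  · rintro s' ⟨h0, h4, h6, hx, hlo, hhi, h5, h⟩ hb
    simp only [BExp.Holds, NExp.eval, h0] at hb
    refine (wp_placePoint (c := c (s'.nreg 5)) ?_ ?_).frame.mono ?_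
    · rw [hc _ hb]
      simp only [vertex, hx, hlo, hhi, h4, h6]
    · rw [hlo, hhi]
      exact hle _ hb
    · rintro t s'' ⟨⟨ht, h5', hN, h3', h4', h5'', h6'⟩, hf⟩
      have hr : ∀ a < 3, s''.rarr a = s'.rarr a := fun a ha => hf.rarr a (by
        simp [placePoint, Prog.block, Prog.rarrs]; omega)
      refine ⟨⟨(hf.nreg 0 (by decide)).trans h0, (hf.nreg 4 (by decide)).trans h4,
        (hf.nreg 6 (by decide)).trans h6, (hr 0 (by decide)).trans hx,
        (hr 1 (by decide)).trans hlo, (hr 2 (by decide)).trans hhi, by omega, ?_⟩, by omega, ?_⟩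
      · intro i hi
        rw [hN, h3', h4', h5'', h6', hx]
        rcases eq_or_ne i (s'.nreg 5) with rfl | hne
        · simp
        · simp only [Function.update_of_ne hne]
          exact h i (by omega)
      · simp only [BExp.cost, NExp.cost]
        omega

/-! ### The solution -/

theorem StrictPolygon.triangleArea_le {v : ℕ → ℝ × ℝ} {M : ℕ} (hv : StrictPolygon v M) {g : ℝ}
    (hg : ∀ i j k, i ≤ j → j ≤ k → k < M → orient (v i) (v j) (v k) ≤ g) {i j k : ℕ}
    (hi : i < M) (hj : j < M) (hk : k < M) : triangleArea (v i) (v j) (v k) ≤ g / 2 := by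
  have hsorted : ∀ i j k, i ≤ j → j ≤ k → k < M → triangleArea (v i) (v j) (v k) ≤ g / 2 := by
    intro i j k hij hjk hk
    rw [triangleArea_eq_orient, abs_of_nonneg (hv.nonneg hij hjk hk)]
    linarith [hg i j k hij hjk hk]
  rcases le_total i j with hij | hij <;> rcases le_total j k with hjk | hjk <;>
    rcases le_total i k with hik | hik
  · exact hsorted _ _ _ hij hjk hk
  · exact hsorted _ _ _ hij hjk hk
  · rw [triangleArea_swap]
    exact hsorted _ _ _ hik hjk hj
  · rw [← triangleArea_rotate]
    exact hsorted _ _ _ hik hij hj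
  · rw [triangleArea_swap, ← triangleArea_rotate]
    exact hsorted _ _ _ hij hik hk
  · rw [triangleArea_rotate]
    exact hsorted _ _ _ hjk hik hi
  · rw [triangleArea_swap, triangleArea_rotate]
    exact hsorted _ _ _ hjk hij hi
  · rw [triangleArea_swap, triangleArea_rotate]
    exact hsorted _ _ _ hjk hij hi

/-- The solution of the MinMaxArea problem. -/
def solve : Prog :=
  .block [
    extremePoint 4 (.rlt (.get 0 (.reg 5)) (.get 0 (.reg 4))),
    extremePoint 6 (.rlt (.get 0 (.reg 6)) (.get 0 (.reg 5))),
    placePoints,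
    hullProgram,
    searchPolygon,
    .setR 0 (.div (.reg 0) (.const 2))]

/-- The hull of the polygon's corners contains the placement, so `g / 2` bounds all its triangles;
the reported triangle attains it. If `g = 0`, the default triangle does, as no area is negative. -/
theorem holdsSolution_of_bestTriangle {n : ℕ} {L : Fin n → VSeg} {s s' : RamState} {M : ℕ}
    (hn : 3 ≤ n) (hp : IsPlacement L (outputPlacement n s))
    (hK : convexHull ℝ (Set.range (outputPlacement n s)) = convexBody L)
    (hv : StrictPolygon (corner s) M) (hid : ∀ i < M, s.narr 2 i < n)
    (hhull : ∀ i < n, vertex s 3 4 i ∈ convexHull ℝ (corner s '' Set.Iio M))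
    (h3 : s'.rarr 3 = s.rarr 3) (h4 : s'.rarr 4 = s.rarr 4) {g : ℝ}
    (hbest : BestTriangle s M g (s'.nreg 1) (s'.nreg 2) (s'.nreg 3))
    (hg : ∀ i j k, i ≤ j → j ≤ k → k < M →
      orient (corner s i) (corner s j) (corner s k) ≤ g) (h0 : s'.rreg 0 = g / 2) :
    HoldsSolution L s' := by
  have hout : outputPlacement n s' = outputPlacement n s := by
    funext i
    simp only [outputPlacement, h3, h4]
  have hle : ∀ A ∈ inscribedAreas (convexHull ℝ (Set.range (outputPlacement n s))), A ≤ g / 2 := by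
    rintro A ⟨u, hu, v, hv', w, hw, rfl⟩
    have hsub : convexHull ℝ (Set.range (outputPlacement n s)) ⊆
        convexHull ℝ (corner s '' Set.Iio M) := by
      refine convexHull_min ?_ (convex_convexHull ℝ _)
      rintro _ ⟨i, rfl⟩
      exact hhull i i.2
    obtain ⟨_, ⟨i, hi, rfl⟩, _, ⟨j, hj, rfl⟩, _, ⟨k, hk, rfl⟩, h⟩ :=
      exists_triangleArea_ge (hsub hu) (hsub hv') (hsub hw)
    exact h.trans (hv.triangleArea_le hg hi hj hk)
  have hmem : ∀ i, outputPlacement n s i ∈ convexHull ℝ (Set.range (outputPlacement n s)) :=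
    fun i => subset_convexHull ℝ _ ⟨i, rfl⟩
  have htri : ∃ i j k : Fin n, OutputTriangle s' i j k ∧ i ≠ j ∧ i ≠ k ∧ j ≠ k ∧
      triangleArea (outputPlacement n s i) (outputPlacement n s j) (outputPlacement n s k)
        = g / 2 := by
    rcases hbest with ⟨rfl, h1, h2, h3⟩ | ⟨hpos, i, j, k, hi, hj, hk, h1, h2, h3, hgo⟩
    · refine ⟨⟨0, by omega⟩, ⟨1, by omega⟩, ⟨2, by omega⟩, ⟨h1, h2, h3⟩, by simp, by simp,
        by simp, le_antisymm ?_ ?_⟩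
      · exact hle _ ⟨_, hmem _, _, hmem _, _, hmem _, rfl⟩
      · rw [zero_div]
        exact triangleArea_nonneg _ _ _
    · have harea : triangleArea (outputPlacement n s ⟨_, hid i hi⟩)
          (outputPlacement n s ⟨_, hid j hj⟩) (outputPlacement n s ⟨_, hid k hk⟩) = g / 2 := by
        rw [triangleArea_eq_orient, ← abs_of_pos hpos, hgo]
        rfl
      obtain ⟨hij, hik, hjk⟩ := ne_of_triangleArea_pos (p := outputPlacement n s)
        (harea ▸ half_pos hpos)
      exact ⟨_, _, _, ⟨h1, h2, h3⟩, hij, hik, hjk, harea⟩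
  obtain ⟨i, j, k, hijk, hij, hik, hjk, harea⟩ := htri
  have hgreatest : IsGreatest (cornerAreas (outputPlacement n s)) (g / 2) := by
    rw [isGreatest_cornerAreas_iff hn]
    exact ⟨⟨_, hmem i, _, hmem j, _, hmem k, harea.symm⟩, hle⟩
  rw [HoldsSolution, hout, outputArea, h0]
  exact ⟨isMinMaxArea_of_convexHull_eq hn hp hK hgreatest,
    isOptimalPlacement_of_convexHull_eq hn hp hK, hK, i, j, k, hijk, hij, hik, hjk, harea⟩

theorem wp_solve {n : ℕ} {L : Fin n → VSeg} {l r : Fin n} (hn : 3 ≤ n)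
    (hL : HasFixedExtremes L l r) :
    wp solve (inputState L) fun t s =>
      t ≤ 20000 * n * (Nat.log 2 n + 1) ∧ HoldsSolution L s := by
  obtain ⟨-, hl, hr, hpl, hpr⟩ := hL
  set s := inputState L with hs
  have hs0 : s.nreg 0 = n := rfl
  have hX : ∀ i : Fin n, s.rarr 0 i = (L i).x := fun i => by simp [hs, inputState]
  have hlo : ∀ i : Fin n, s.rarr 1 i = (L i).lo := fun i => by simp [hs, inputState]
  have hhi : ∀ i : Fin n, s.rarr 2 i = (L i).hi := fun i => by simp [hs, inputState]
  simp only [solve, wp_block_cons, wp_block_one]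
  refine (wp_extremePoint (g := id) (by decide) (by decide) (by decide) (fun _ => Iff.rfl)
    (by omega)).frame.mono ?_
  rintro t₁ s₁ ⟨⟨ht₁, hlt₁, hl₁⟩, hf₁⟩
  have hr₁ : s₁.rarr = s.rarr := funext fun a => hf₁.rarr a (by
    simp [extremePoint, Prog.block, Prog.rarrs])
  have hn₁ : s₁.nreg 0 = n := (hf₁.nreg 0 (by decide)).trans hs0
  refine (wp_extremePoint (g := Neg.neg) (by decide) (by decide) (by decide)
    (fun _ => neg_lt_neg_iff.symm) (by omega)).frame.mono ?_
  rintro t₂ s₂ ⟨⟨ht₂, hlt₂, hl₂⟩, hf₂⟩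
  have hr₂ : s₂.rarr = s.rarr := (funext fun a => hf₂.rarr a (by
    simp [extremePoint, Prog.block, Prog.rarrs])).trans hr₁
  have hn₂ : s₂.nreg 0 = n := (hf₂.nreg 0 (by decide)).trans hn₁
  have h42 : s₂.nreg 4 = s₁.nreg 4 := hf₂.nreg 4 (by decide)
  obtain ⟨l', hl'⟩ : ∃ l' : Fin n, s₂.nreg 4 = l' := ⟨⟨s₁.nreg 4, by omega⟩, h42⟩
  obtain ⟨r', hr'⟩ : ∃ r' : Fin n, s₂.nreg 6 = r' := ⟨⟨s₂.nreg 6, by omega⟩, rfl⟩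
  have hle : ∀ i < n, s.rarr 1 i ≤ s.rarr 2 i := fun i hi => by
    rw [hlo ⟨i, hi⟩, hhi ⟨i, hi⟩]
    exact (L _).lo_le_hi
  obtain ⟨hpl', hll'⟩ := hl₁ l (by omega) (by rw [hlo, hhi]; exact hpl.ge)
  obtain ⟨hpr', hrr'⟩ := hl₂ r (by omega) (by rw [hr₁, hlo, hhi]; exact hpr.ge)
  rw [← h42, hl'] at hpl' hll'
  rw [hr₁, hr'] at hpr' hrr'
  have hpl'' : (L l').IsPoint := (L l').lo_le_hi.antisymm (by rwa [hlo, hhi] at hpl')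
  have hpr'' : (L r').IsPoint := (L r').lo_le_hi.antisymm (by rwa [hlo, hhi] at hpr')
  -- The program may find another point segment than `l`, but it is no further right than `l`, hence
  -- also leftmost.
  have hleft : ∀ i, (L l').x ≤ (L i).x := fun i => by
    simp only [id, hX] at hll'
    exact hll'.trans (hl i)
  have hright : ∀ i, (L i).x ≤ (L r').x := fun i => by
    simp only [hX, neg_le_neg_iff] at hrr'
    exact (hr i).trans hrr'
  refine (wp_placePoints (s := s₂) (by rw [hn₂, hr₂]; exact hle)
    (c := fun i => clampOrdinate (vertex s₂ 0 1 (s₂.nreg 4)) (vertex s₂ 0 1 (s₂.nreg 6))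
      (s₂.rarr 0 i) (s₂.rarr 1 i) (s₂.rarr 2 i)) fun _ _ => rfl).frame.mono ?_
  rintro t₃ s₃ ⟨⟨ht₃, hplace⟩, hf₃⟩
  have hn₃ : s₃.nreg 0 = n := (hf₃.nreg 0 (by decide)).trans hn₂
  rw [hn₂] at hplace ht₃
  have hpt : outputPlacement n s₃ = fun i => clampPoint (L l').lower (L r').lower (L i) := by
    funext i
    obtain ⟨-, h3, h4, -⟩ := hplace i i.2
    simp only [outputPlacement, h3, h4, clampPoint, clampOrdinate, vertex, hr₂, hl', hr', hX, hlo,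
      hhi]
    rfl
  refine (wp_hullProgram hn₃ (by omega) (fun i hi => (hplace i hi).1)
    (fun i hi => by rw [(hplace i hi).2.2.2.1, (hplace i hi).2.1])
    (fun i hi => by rw [(hplace i hi).2.2.2.2, (hplace i hi).2.2.1])).frame.mono ?_
  rintro t₄ s₄ ⟨⟨ht₄, hM1, hM2, hv, hid, hhull⟩, hf₄⟩
  have h34 : s₄.rarr 3 = s₃.rarr 3 := hf₄.rarr 3 (by decide)
  have h44 : s₄.rarr 4 = s₃.rarr 4 := hf₄.rarr 4 (by decide)
  have hpt₄ : outputPlacement n s₄ = outputPlacement n s₃ := by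
    funext i
    simp only [outputPlacement, h34, h44]
  refine (wp_searchPolygon hM1 rfl hv).frame.mono ?_
  rintro t₅ s₅ ⟨⟨ht₅, hbest, hopt⟩, hf₅⟩
  rw [wp_setR]
  constructor
  -- All logarithms are reduced to `Nat.log 2 n`; the polygon has at most `2 * n` corners. As `n` is
  -- at least 3, `310 ≤ 110 * n` and `200 ≤ 100 * n` absorb the additive constants.
  · have hc : Nat.clog 2 n ≤ Nat.log 2 n + 1 :=
      Nat.clog_le_of_le_pow (Nat.lt_pow_succ_log_self (by decide) n).le
    have hl2 : Nat.log 2 (s₄.nreg 11) ≤ Nat.log 2 n + 1 := by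
      refine (Nat.log_mono_right hM2).trans ?_
      rw [mul_comm, Nat.log_mul_base (by decide) (by omega)]
    have h4 : (300 * n + 310) * (Nat.clog 2 n + 1) ≤ (300 * n + 110 * n) * (Nat.log 2 n + 2) :=
      Nat.mul_le_mul (by omega) (by omega)
    have h5 : (1400 * s₄.nreg 11 + 200) * (Nat.log 2 (s₄.nreg 11) + 3) ≤
        (2800 * n + 100 * n) * (Nat.log 2 n + 4) :=
      Nat.mul_le_mul (by omega) (by omega)
    simp only [RExp.cost]
    rw [hs0] at ht₁
    rw [hn₁] at ht₂
    have h6 : n * 1 ≤ n * (Nat.log 2 n + 1) := Nat.mul_le_mul le_rfl (by omega)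
    nlinarith
  · refine holdsSolution_of_bestTriangle hn ?_ ?_ hv hid
      (fun i hi => ?_) (hf₅.rarr 3 (by decide)) (hf₅.rarr 4 (by decide)) hbest hopt ?_
    · rw [hpt₄, hpt]
      exact isPlacement_clampPoint _ _
    · rw [hpt₄, hpt]
      exact convexHull_clampPoint hleft hright hpl'' hpr''
    · have := hhull i hi
      simpa only [vertex, h34, h44] using this
    · simp [RExp.eval]

/-! ### Natural logarithms and the main theorem -/

/-- Since `e < 3 ≤ n`, the summand 1 is at most `Real.log n`, and `1 / Real.log 2 < 2` converts the
base. -/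
theorem natLog_add_one_le {n : ℕ} (hn : 3 ≤ n) : (Nat.log 2 n + 1 : ℝ) ≤ 3 * Real.log n := by
  have h3 : (3 : ℝ) ≤ n := by exact_mod_cast hn
  have h1 : 1 ≤ Real.log n := by
    rw [Real.le_log_iff_exp_le (by linarith)]
    exact (Real.exp_one_lt_d9.le.trans (by norm_num)).trans h3
  have h2 : Nat.log 2 n * Real.log 2 ≤ Real.log n := by
    rw [← Real.log_pow]
    refine Real.log_le_log (by positivity) ?_
    exact_mod_cast Nat.pow_log_le_self 2 (by omega)
  have hlog2 := Real.log_two_gt_d9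
  have h0 : (0 : ℝ) ≤ Nat.log 2 n := Nat.cast_nonneg _
  nlinarith

theorem mainTheorem6 :
    -- the optimal placements and the value, in terms of the convex body region
    (∀ (n : ℕ) (L : Fin n → VSeg) (l r : Fin n), 3 ≤ n → HasFixedExtremes L l r →
      (∃ p, IsOptimalPlacement L p ∧ convexHull ℝ (Set.range p) = convexBody L) ∧
      (∀ p, IsPlacement L p → convexHull ℝ (Set.range p) = convexBody L →
        IsOptimalPlacement L p) ∧
      (∃ m, IsMinMaxArea L m ∧ IsGreatest (inscribedAreas (convexBody L)) m)) ∧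
    -- one real RAM program solves the problem within `C * n * log n` steps
    (∃ (c : Prog) (C : ℝ), ∀ (n : ℕ) (L : Fin n → VSeg) (l r : Fin n), 3 ≤ n →
      HasFixedExtremes L l r →
      ∃ (t : ℕ) (s : RamState), Runs c (inputState L) t s ∧
        (t : ℝ) ≤ C * ((n : ℝ) * Real.log (n : ℝ)) ∧ HoldsSolution L s) := by
  -- The constant is `20000` from `wp_solve` times `3` from `natLog_add_one_le`.
  refine ⟨fun n L l r hn hL => minMaxArea_structure hn hL, solve, 60000, fun n L l r hn hL => ?_⟩
  obtain ⟨t, s, hrun, ht, hs⟩ := wp_solve hn hL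
  refine ⟨t, s, hrun, ?_, hs⟩
  have ht' : (t : ℝ) ≤ 20000 * n * (Nat.log 2 n + 1) := by exact_mod_cast ht
  have := mul_le_mul_of_nonneg_left (natLog_add_one_le hn) (by positivity : (0 : ℝ) ≤ 20000 * n)
  linarith
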